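/- Let $G_\tau(x,y)=\frac1{4\pi\tau}e^{-(x^2+y^2)/(4\tau)}$ on $\mathbb R^2$, let $M\in\mathbb N$, and let $\gamma_{m,i}\in\mathbb R$ ($0\le i<m\le M$) satisfy $\sum_{i=0}^{m-1}\gamma_{m,i}=1$ for $1\le m\le M$. For $\tau>0$ and $\bar\Sigma_0\subset\mathbb R^2$ define the stages $$\bar\Sigma_m=\Big\{G_\tau*\sum_{i=0}^{m-1}\gamma_{m,i}\mathbf 1_{\bar\Sigma_i}\ge\tfrac12\Big\},\qquad 1\le m\le M.$$ Define $\beta_{1,0}=\dots=\beta_{5,0}=0$ and, for $m\ge1$, with all sums over $0\le i\le m-1$, $$\beta_{1,m}=1+\sum\gamma_{m,i}\beta_{1,i},\qquad \beta_{2,m}=\tfrac12+\sum\gamma_{m,i}\beta_{2,i}+\sum\gamma_{m,i}\beta_{4,i},$$ $$\beta_{3,m}=\tfrac23+\tfrac16\Big(\sum\gamma_{m,i}\beta_{1,i}\Big)^3-\tfrac14\Big(\sum\gamma_{m,i}\beta_{1,i}\Big)\Big(\sum\gamma_{m,i}\beta_{1,i}^2\Big)+\tfrac1{12}\sum\gamma_{m,i}\beta_{1,i}^3+\sum\gamma_{m,i}\beta_{3,i}+\sum\gamma_{m,i}\beta_{5,i},$$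 $$\beta_{4,m}=1+\sum\gamma_{m,i}\beta_{4,i},\qquad \beta_{5,m}=2+\sum\gamma_{m,i}\beta_{5,i}.$$ (1) Let $f:\mathbb R\to\mathbb R$ be $C^\infty$ with $f(0)=f'(0)=0$, and let the stages be started from $\bar\Sigma_0=\{(x,y):y\le f(x)\}$ with $\tau=t$. There are $r>0$ and functions $h_i=h_{i,t}$ such that, for all $0\le i\le M$ and all sufficiently small $t>0$, $h_i$ is $C^2$ on $(-r,r)$ with $|h_i|<r$ there, and in the square $|x|,|y|<r$ one has $(x,y)\in\bar\Sigma_i\iff y\le h_i(x)$. Moreover, for each $0\le i\le M$ and any functions $h_i=h_{i,t}$ that for some $r>0$ satisfy this last equivalence for all sufficiently small $t>0$ (in particular if $\bar\Sigma_i=\{y\le h_i(x)\}$ globally), as $t\to0^+$, $$h_i(0)=t\,\beta_{1,i}f''(0)+t^2\big(\beta_{2,i}f''''(0)-\beta_{3,i}f''(0)^3\big)+O(t^3),$$ $$h_i''(0)=f''(0)+t\big(\beta_{4,i}f''''(0)-\beta_{5,i}f''(0)^3\big)+O(t^2).$$ (2) Suppose $\beta_{1,M}>0$. Call the scheme second order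 accurate if for every $C^\infty$ function $f:\mathbb R\times[0,\infty)\to\mathbb R$ with $f_t=\frac{f_{xx}}{1+f_x^2}$ and $f(0,0)=f_x(0,0)=0$, the last stage $\bar\Sigma_M$ obtained from $\bar\Sigma_0=\{y\le f(x,0)\}$ with $\tau=\delta/\beta_{1,M}$ coincides, for some $r>0$ and all small $\delta>0$, in the square $|x|,|y|<r$ with the region $\{y\le H_\delta(x)\}$ for a continuous $H_\delta:(-r,r)\to(-r,r)$, and $H_\delta(0)=f(0,\delta)+O(\delta^3)$ as $\delta\to0^+$. Then the scheme is second order accurate if and only if $$\frac{\beta_{2,M}}{\beta_{1,M}^2}=\frac12\quad\text{and}\quad\frac{\beta_{3,M}}{\beta_{1,M}^2}=1.$$ -/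

import Mathlib

open Filter Topology Asymptotics MeasureTheory
open scoped ContDiff

namespace ThresholdDynamics

/-- The two-dimensional Gaussian kernel `G_t(x, y) = (4 π t)⁻¹ exp (-(x² + y²) / (4 t))`. -/
noncomputable def gaussKernel (t : ℝ) (p : ℝ × ℝ) : ℝ :=
  1 / (4 * Real.pi * t) * Real.exp (-(p.1 ^ 2 + p.2 ^ 2) / (4 * t))

/-- The region `{(x, y) : y ≤ f x}` below the graph of `f`. -/
def subgraph (f : ℝ → ℝ) : Set (ℝ × ℝ) := {p | p.2 ≤ f p.1}

/-- The stages of the multistage scheme with kernel `G_τ`, started from `S`: stage `0` is `S`, and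
stage `m ≥ 1` is `{p : (G_τ * ∑_{i < m} γ_{m,i} 1_{stage i}) p ≥ 1/2}`. -/
noncomputable def stage (γ : ℕ → ℕ → ℝ) (τ : ℝ) (S : Set (ℝ × ℝ)) : ℕ → Set (ℝ × ℝ)
  | 0 => S
  | m + 1 => {p | 1 / 2 ≤ convolution (gaussKernel τ)
      (fun q => ∑ i : Fin (m + 1), γ (m + 1) i * (stage γ τ S i).indicator (fun _ => (1 : ℝ)) q)
      (ContinuousLinearMap.mul ℝ ℝ) volume p}
  termination_by m => m
  decreasing_by exact i.2

/-- The coefficients of the stage expansions, given by recursion in the stage number. -/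
noncomputable def beta1 (γ : ℕ → ℕ → ℝ) : ℕ → ℝ
  | 0 => 0
  | m + 1 => 1 + ∑ i : Fin (m + 1), γ (m + 1) i * beta1 γ i
  termination_by m => m
  decreasing_by exact i.2

noncomputable def beta4 (γ : ℕ → ℕ → ℝ) : ℕ → ℝ
  | 0 => 0
  | m + 1 => 1 + ∑ i : Fin (m + 1), γ (m + 1) i * beta4 γ i
  termination_by m => m
  decreasing_by exact i.2

noncomputable def beta5 (γ : ℕ → ℕ → ℝ) : ℕ → ℝ
  | 0 => 0
  | m + 1 => 2 + ∑ i : Fin (m + 1), γ (m + 1) i * beta5 γ i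
  termination_by m => m
  decreasing_by exact i.2

noncomputable def beta2 (γ : ℕ → ℕ → ℝ) : ℕ → ℝ
  | 0 => 0
  | m + 1 => 1 / 2 + ∑ i : Fin (m + 1), γ (m + 1) i * beta2 γ i
      + ∑ i : Fin (m + 1), γ (m + 1) i * beta4 γ i
  termination_by m => m
  decreasing_by exact i.2

noncomputable def beta3 (γ : ℕ → ℕ → ℝ) : ℕ → ℝ
  | 0 => 0
  | m + 1 => 2 / 3 + 1 / 6 * (∑ i : Fin (m + 1), γ (m + 1) i * beta1 γ i) ^ 3
      - 1 / 4 * (∑ i : Fin (m + 1), γ (m + 1) i * beta1 γ i)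
          * (∑ i : Fin (m + 1), γ (m + 1) i * beta1 γ i ^ 2)
      + 1 / 12 * ∑ i : Fin (m + 1), γ (m + 1) i * beta1 γ i ^ 3
      + ∑ i : Fin (m + 1), γ (m + 1) i * beta3 γ i
      + ∑ i : Fin (m + 1), γ (m + 1) i * beta5 γ i
  termination_by m => m
  decreasing_by exact i.2

/-- Inside the open square of half-side `r` centred at the origin, the set `S` is the region below
the graph of `h`. -/
def IsSubgraphNear (r : ℝ) (S : Set (ℝ × ℝ)) (h : ℝ → ℝ) : Prop :=
  ∀ x y : ℝ, |x| < r → |y| < r → ((x, y) ∈ S ↔ y ≤ h x)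

/-- `f : ℝ × [0, ∞) → ℝ` is smooth (up to time `0`) and its graphs move by mean curvature:
`f_t = f_xx / (1 + f_x²)`. -/
def IsCurvatureMotion (f : ℝ → ℝ → ℝ) : Prop :=
  ContDiffOn ℝ ∞ (fun p : ℝ × ℝ => f p.1 p.2) (Set.univ ×ˢ Set.Ici 0) ∧
  ∀ x t : ℝ, 0 ≤ t →
    derivWithin (fun s => f x s) (Set.Ici 0) t =
      iteratedDeriv 2 (fun z => f z t) x / (1 + deriv (fun z => f z t) x ^ 2)

/-- Second order accuracy of the `M`-stage scheme: for every smooth graph moving by mean curvature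
through the origin with horizontal tangent there at time `0`, one step of size `δ` of the scheme
(its kernel time is `τ = δ / β_{1,M}`) produces a set whose interface crosses the vertical axis
within `O(δ³)` of the exact interface at time `δ`. -/
def IsSecondOrderAccurate (γ : ℕ → ℕ → ℝ) (M : ℕ) : Prop :=
  ∀ f : ℝ → ℝ → ℝ, IsCurvatureMotion f → f 0 0 = 0 → deriv (fun x => f x 0) 0 = 0 →
    ∃ r : ℝ, 0 < r ∧ ∃ H : ℝ → ℝ → ℝ,
      (∀ᶠ δ in 𝓝[>] (0 : ℝ),
        ContinuousOn (H δ) (Set.Ioo (-r) r) ∧ (∀ x ∈ Set.Ioo (-r) r, |H δ x| < r) ∧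
        IsSubgraphNear r (stage γ (δ / beta1 γ M) (subgraph fun x => f x 0) M) (H δ)) ∧
      (fun δ => H δ 0 - f 0 δ) =O[𝓝[>] (0 : ℝ)] fun δ => δ ^ 3

end ThresholdDynamics

open ThresholdDynamics

/-! Put ε = √t and use the coordinates (x, u(x) + ε z), where u is smooth, compactly supported and
equal to f near 0. The claim behind both expansions is that each stage is, near the origin and up to
errors smaller than every power of ε, the region below u + ε Z(·, ε) with Z smooth and odd in ε
(`IsCorrector`).

For an exact region of this kind, integrating out the vertical Gaussian variable turns the
convolution at (x, u(x) + ε z) into a Gaussian average over ξ of `heatCDF` of the relative height ξ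
· `diffQuot u (x, ε ξ)` + Z(x + ε ξ, ε) - z (`smear_subgraph`). The difference quotient is smooth
through ε = 0, so the profile is smooth in (x, ε, z), also for ε ≤ 0. At x = ε = 0 the z-derivative
of the weighted profile is -`heat z`, because the weights sum to one; their signs play no role. The
implicit function theorem then yields the corrector Y of the next stage (`exists_corrector`). The
symmetry (ε, z, ξ) ↦ (-ε, -z, -ξ), which replaces a profile by one minus it, makes Y odd, so ε Y(x,
ε) expands in integer powers of t.

One ε-derivative of the level equation gives Y_ε(x, 0) = k(x) + Σ γ Z_ε(x, 0) with k = u''/(1 +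
u'²), hence Y_ε(x, 0) = β₁ k(x) near 0. Two x-derivatives at 0 produce k''(0) = f''''(0) - 2
f''(0)³, which is why β₄ = β₁ and β₅ = 2β₁. The third ε-derivative at x = 0, evaluated with Gaussian
moments, gives the recursions for β₂ and β₃ (`HasCoefficients.step`).

The true stages only approximate such regions (`IsApprox`). After rescaling by 1/ε the discrepancy
has tiny mass on a ball of radius of order 1/ε, and the kernel is Schwartz, so the convolution error
and its derivatives are O(εᴺ) for all N (`exists_abs_smearError_le`). The profile crosses 1/2
transversally; hence the true interface is a smooth graph that differs from Y by O(εᴺ), and at the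
origin so does its second derivative (`exists_next`). Induction on the stage closes the argument.

For the second part, the motion satisfies f(0, δ) = δ f'' + (δ²/2)(f'''' - 2 f''³) + O(δ³), so one
step has error δ² ((β₂/β₁² - 1/2) f'''' - (β₃/β₁² - 1) f''³) + O(δ³). The consistency equations make
it vanish. Conversely the exact motions arsinh(A e^{-t} cos x) - arsinh A, for two values of A, give
independent linear conditions on the two bracketed constants. -/

section Development

open Function

/-! ### Closure properties of functions of temperate growth. -/

namespace Function.HasTemperateGrowth

variable {D E F : Type*} [NormedAddCommGroup D] [NormedSpace ℝ D] [NormedAddCommGroup E]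
  [NormedSpace ℝ E] [NormedAddCommGroup F] [NormedSpace ℝ F]

theorem fderiv_right {f : E → F} (hf : f.HasTemperateGrowth) : (fderiv ℝ f).HasTemperateGrowth := by
  refine ⟨hf.1.fderiv_right (by simp), fun n => ?_⟩
  obtain ⟨k, C, h⟩ := hf.2 (n + 1)
  exact ⟨k, C, fun x => by rw [norm_iteratedFDeriv_fderiv]; exact h x⟩

theorem clm_comp (L : E →L[ℝ] F) {f : D → E} (hf : f.HasTemperateGrowth) :
    (fun x => L (f x)).HasTemperateGrowth :=
  L.hasTemperateGrowth.comp hf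

@[fun_prop]
theorem fst {f : D → E × F} (hf : f.HasTemperateGrowth) :
    (fun x => (f x).1).HasTemperateGrowth :=
  hf.clm_comp (ContinuousLinearMap.fst ℝ E F)

@[fun_prop]
theorem snd {f : D → E × F} (hf : f.HasTemperateGrowth) :
    (fun x => (f x).2).HasTemperateGrowth :=
  hf.clm_comp (ContinuousLinearMap.snd ℝ E F)

@[fun_prop]
theorem prodMk {f : D → E} {g : D → F} (hf : f.HasTemperateGrowth) (hg : g.HasTemperateGrowth) :
    (fun x => (f x, g x)).HasTemperateGrowth := by
  have := (hf.clm_comp (ContinuousLinearMap.inl ℝ E F)).add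
    (hg.clm_comp (ContinuousLinearMap.inr ℝ E F))
  convert this using 2
  simp

end Function.HasTemperateGrowth

/-! ### Smoothness of integrals depending on a parameter. -/

section Integral

variable {E : Type} [NormedAddCommGroup E] [NormedSpace ℝ E]

/-- All moments of the measure are finite. -/
def HasMoments (μ : Measure ℝ) : Prop := ∀ n : ℕ, Integrable (fun ξ : ℝ => (1 + |ξ|) ^ n) μ

/-- The growth is split into a factor in the parameter and a factor in ξ: the first is locally
bounded, the second is integrable by `HasMoments`, which is what domination needs. -/
theorem Function.HasTemperateGrowth.norm_le_mul {F : Type*} [NormedAddCommGroup F]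
    [NormedSpace ℝ F] {f : E × ℝ → F} (hf : f.HasTemperateGrowth) :
    ∃ (k : ℕ) (C : ℝ), 0 ≤ C ∧ ∀ p ξ, ‖f (p, ξ)‖ ≤ C * (1 + ‖p‖) ^ k * (1 + |ξ|) ^ k := by
  obtain ⟨k, C, hC, h⟩ := hf.norm_iteratedFDeriv_le_uniform 0
  refine ⟨k, C, hC, fun p ξ => ?_⟩
  have := h 0 le_rfl (p, ξ)
  rw [norm_iteratedFDeriv_zero] at this
  refine this.trans ?_
  rw [mul_assoc, ← mul_pow]
  gcongr
  have h1 : ‖(p, ξ)‖ ≤ ‖p‖ + |ξ| := by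
    rw [Prod.norm_def]
    exact max_le (by simp) (by simp)
  nlinarith [norm_nonneg p, abs_nonneg ξ, mul_nonneg (norm_nonneg p) (abs_nonneg ξ)]

theorem Function.HasTemperateGrowth.aestronglyMeasurable_right {F : Type*} [NormedAddCommGroup F]
    [NormedSpace ℝ F] {μ : Measure ℝ} {f : E × ℝ → F} (hf : f.HasTemperateGrowth) (p : E) :
    AEStronglyMeasurable (fun ξ => f (p, ξ)) μ :=
  (hf.1.continuous.comp (by fun_prop : Continuous fun ξ : ℝ => (p, ξ))).aestronglyMeasurable

theorem Function.HasTemperateGrowth.integrable_right {F : Type*} [NormedAddCommGroup F]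
    [NormedSpace ℝ F] {μ : Measure ℝ} (hμ : HasMoments μ) {f : E × ℝ → F}
    (hf : f.HasTemperateGrowth) (p : E) : Integrable (fun ξ => f (p, ξ)) μ := by
  obtain ⟨k, C, hC, h⟩ := hf.norm_le_mul
  exact ((hμ k).const_mul (C * (1 + ‖p‖) ^ k)).mono' (hf.aestronglyMeasurable_right p)
    (ae_of_all _ fun ξ => h p ξ)

/-- Differentiation under the integral sign for integrands of temperate growth. -/
theorem Function.HasTemperateGrowth.hasFDerivAt_integral {F : Type*} [NormedAddCommGroup F]
    [NormedSpace ℝ F] {μ : Measure ℝ} (hμ : HasMoments μ) {f : E × ℝ → F}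
    (hf : f.HasTemperateGrowth) (p : E) :
    HasFDerivAt (fun p => ∫ ξ, f (p, ξ) ∂μ)
      (∫ ξ, (fderiv ℝ f (p, ξ)).comp (ContinuousLinearMap.inl ℝ E ℝ) ∂μ) p := by
  have hf' : (fun q => (fderiv ℝ f q).comp
      (ContinuousLinearMap.inl ℝ E ℝ)).HasTemperateGrowth :=
    hf.fderiv_right.clm_comp ((ContinuousLinearMap.compL ℝ E (E × ℝ) F).flip
      (ContinuousLinearMap.inl ℝ E ℝ))
  obtain ⟨k, C, hC, h⟩ := hf'.norm_le_mul
  refine hasFDerivAt_integral_of_dominated_of_fderiv_le (s := Metric.ball p 1)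
    (bound := fun ξ => C * (1 + (‖p‖ + 1)) ^ k * (1 + |ξ|) ^ k)
    (F' := fun p ξ => (fderiv ℝ f (p, ξ)).comp (ContinuousLinearMap.inl ℝ E ℝ))
    (Metric.ball_mem_nhds p one_pos)
    (Eventually.of_forall fun q => hf.aestronglyMeasurable_right q) (hf.integrable_right hμ p)
    (hf'.aestronglyMeasurable_right p) (ae_of_all _ fun ξ q hq => ?_) ((hμ k).const_mul _)
    (ae_of_all _ fun ξ q _ => ?_)
  · refine (h q ξ).trans ?_
    have : ‖q‖ ≤ ‖p‖ + 1 := by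
      have := norm_le_norm_add_norm_sub' q p
      have h2 : ‖q - p‖ < 1 := by simpa [dist_eq_norm] using hq
      linarith
    gcongr
  · exact ((hf.1.differentiable (by simp)) (q, ξ)).hasFDerivAt.comp q
      (hasFDerivAt_prodMk_left q ξ)

/-- Induction on the order: the derivative of the integral is the integral of a derivative that
again has temperate growth. The target space changes at each step, so `key` quantifies over it after
n, and all spaces live in `Type` to stay in one universe. -/
theorem Function.HasTemperateGrowth.integral {F : Type} [NormedAddCommGroup F] [NormedSpace ℝ F]
    {μ : Measure ℝ} (hμ : HasMoments μ) {f : E × ℝ → F} (hf : f.HasTemperateGrowth) :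
    (fun p => ∫ ξ, f (p, ξ) ∂μ).HasTemperateGrowth := by
  have key : ∀ n : ℕ, ∀ (F : Type) [NormedAddCommGroup F] [NormedSpace ℝ F] (f : E × ℝ → F),
      f.HasTemperateGrowth → ContDiff ℝ n (fun p => ∫ ξ, f (p, ξ) ∂μ) ∧
      ∃ (k : ℕ) (C : ℝ), ∀ p, ‖iteratedFDeriv ℝ n (fun p => ∫ ξ, f (p, ξ) ∂μ) p‖
        ≤ C * (1 + ‖p‖) ^ k := by
    intro n
    induction n with
    | zero =>
      intro F _ _ f hf
      refine ⟨contDiff_zero.2 (continuous_iff_continuousAt.2 fun p =>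
        (hf.hasFDerivAt_integral hμ p).continuousAt), ?_⟩
      obtain ⟨k, C, hC, h⟩ := hf.norm_le_mul
      refine ⟨k, C * ∫ ξ, (1 + |ξ|) ^ k ∂μ, fun p => ?_⟩
      rw [norm_iteratedFDeriv_zero]
      refine (norm_integral_le_of_norm_le ((hμ k).const_mul (C * (1 + ‖p‖) ^ k))
        (ae_of_all _ fun ξ => h p ξ)).trans_eq ?_
      rw [integral_const_mul]
      ring
    | succ n ih =>
      intro F _ _ f hf
      have hf' : (fun q => (fderiv ℝ f q).comp
          (ContinuousLinearMap.inl ℝ E ℝ)).HasTemperateGrowth :=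
        hf.fderiv_right.clm_comp ((ContinuousLinearMap.compL ℝ E (E × ℝ) F).flip
          (ContinuousLinearMap.inl ℝ E ℝ))
      have hd : fderiv ℝ (fun p => ∫ ξ, f (p, ξ) ∂μ) = fun p =>
          ∫ ξ, (fderiv ℝ f (p, ξ)).comp (ContinuousLinearMap.inl ℝ E ℝ) ∂μ :=
        funext fun p => (hf.hasFDerivAt_integral hμ p).fderiv
      obtain ⟨h1, k, C, h2⟩ := ih _ _ hf'
      refine ⟨?_, k, C, fun p => ?_⟩
      · push_cast
        refine contDiff_succ_iff_fderiv.2 ⟨fun p =>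
          (hf.hasFDerivAt_integral hμ p).differentiableAt, by simp, ?_⟩
        rw [hd]; exact h1
      · rw [← norm_iteratedFDeriv_fderiv, hd]; exact h2 p
  exact ⟨contDiff_infty.2 fun n => (key n F f hf).1, fun n => (key n F f hf).2⟩

/-- Differentiation under the integral sign with respect to a real parameter. -/
theorem Function.HasTemperateGrowth.hasDerivAt_integral {μ : Measure ℝ} (hμ : HasMoments μ)
    {f : ℝ × ℝ → ℝ} (hf : f.HasTemperateGrowth) (p : ℝ) :
    HasDerivAt (fun p => ∫ ξ, f (p, ξ) ∂μ) (∫ ξ, fderiv ℝ f (p, ξ) (1, 0) ∂μ) p := by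
  have h := (hf.hasFDerivAt_integral hμ p).hasDerivAt
  rw [ContinuousLinearMap.integral_apply] at h
  · simpa using h
  · exact Function.HasTemperateGrowth.integrable_right hμ (hf.fderiv_right.clm_comp
      ((ContinuousLinearMap.compL ℝ ℝ (ℝ × ℝ) ℝ).flip (ContinuousLinearMap.inl ℝ ℝ ℝ))) p

end Integral

/-! ### The Gaussian weight and its distribution function. -/

section Gaussian

/-- The power is dominated by n! exp(1 + r), and completing the square in r - c r² leaves the
constant 1/(4c). -/
theorem one_add_pow_mul_exp_neg_sq_bounded {c : ℝ} (hc : 0 < c) (n : ℕ) :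
    ∃ C : ℝ, ∀ r : ℝ, 0 ≤ r → (1 + r) ^ n * Real.exp (-(c * r ^ 2)) ≤ C := by
  refine ⟨n.factorial * Real.exp (1 + 1 / (4 * c)), fun r hr => ?_⟩
  have h1 : (1 + r) ^ n ≤ n.factorial * Real.exp (1 + r) := by
    have := Real.pow_div_factorial_le_exp (1 + r) (by positivity) n
    rw [div_le_iff₀ (by positivity)] at this
    linarith
  calc (1 + r) ^ n * Real.exp (-(c * r ^ 2))
      ≤ n.factorial * Real.exp (1 + r) * Real.exp (-(c * r ^ 2)) := by gcongr
    _ = n.factorial * Real.exp (1 + r + -(c * r ^ 2)) := by rw [mul_assoc, ← Real.exp_add]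
    _ ≤ _ := by
      refine mul_le_mul_of_nonneg_left (Real.exp_le_exp.2 ?_) (by positivity)
      have : 0 ≤ c * (r - 1 / (2 * c)) ^ 2 := by positivity
      have h2 : c * (r - 1 / (2 * c)) ^ 2 = c * r ^ 2 - r + 1 / (4 * c) := by
        field_simp; ring
      linarith

/-- The function `exp (-q)`, for `q` of temperate growth and bounded below by a positive multiple
of the squared norm, as a Schwartz function. -/
noncomputable def expNegSchwartz {E : Type*} [NormedAddCommGroup E] [NormedSpace ℝ E] (q : E → ℝ)
    (hq : q.HasTemperateGrowth) {c : ℝ} (hc : 0 < c) (h : ∀ x, c * ‖x‖ ^ 2 ≤ q x) :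
    SchwartzMap E ℝ where
  toFun x := Real.exp (-q x)
  smooth' := Real.contDiff_exp.comp hq.1.neg
  decay' k n := by
    obtain ⟨m, C, hC, hD⟩ := hq.neg.norm_iteratedFDeriv_le_uniform n
    obtain ⟨B, hB⟩ := one_add_pow_mul_exp_neg_sq_bounded hc (k + m * n)
    refine ⟨n.factorial * (1 + C) ^ n * B, fun x => ?_⟩
    -- Faà di Bruno bound: all derivatives of `exp` at -q equal exp(-q). The bound for the inner
    -- i-th derivative must have the form Dⁱ with i ≥ 1, so D is made at least 1 by using 1 + C.
    have h1 : ‖iteratedFDeriv ℝ n (Real.exp ∘ (-q)) x‖ ≤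
        n.factorial * Real.exp (-q x) * ((1 + C) * (1 + ‖x‖) ^ m) ^ n := by
      refine norm_iteratedFDeriv_comp_le Real.contDiff_exp hq.neg.1 (by exact_mod_cast le_top) x
        (fun i _ => ?_) (fun i hi hi' => ?_)
      · rw [norm_iteratedFDeriv_eq_norm_iteratedDeriv, iteratedDeriv_eq_iterate,
          Real.iter_deriv_exp]
        simp
      · refine (hD i hi' x).trans ?_
        refine le_trans ?_ (le_self_pow₀ ?_ (by omega))
        · gcongr; simp
        · exact one_le_mul_of_one_le_of_one_le (by simp [hC]) (one_le_pow₀ (by simp))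
    have h2 : (Real.exp ∘ (-q)) = fun x => Real.exp (-q x) := rfl
    rw [h2] at h1
    calc ‖x‖ ^ k * ‖iteratedFDeriv ℝ n (fun x => Real.exp (-q x)) x‖
        ≤ (1 + ‖x‖) ^ k * (n.factorial * Real.exp (-(c * ‖x‖ ^ 2)) *
          ((1 + C) * (1 + ‖x‖) ^ m) ^ n) := by
          refine mul_le_mul (by gcongr; simp) (h1.trans ?_) (norm_nonneg _) (by positivity)
          gcongr
          exact h x
      _ = n.factorial * (1 + C) ^ n * ((1 + ‖x‖) ^ (k + m * n) * Real.exp (-(c * ‖x‖ ^ 2))) := by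
          rw [mul_pow, ← pow_mul, pow_add]; ring
      _ ≤ _ := by
          gcongr
          exact hB _ (norm_nonneg x)

theorem hasTemperateGrowth_exp_neg_mul_sq {b : ℝ} (hb : 0 < b) :
    (fun x : ℝ => Real.exp (-(b * x ^ 2))).HasTemperateGrowth :=
  (expNegSchwartz (fun x : ℝ => b * x ^ 2) (by fun_prop) hb (by simp)).hasTemperateGrowth

/-- The centred Gaussian probability measure of variance `2`. -/
noncomputable abbrev heatMeasure : Measure ℝ := ProbabilityTheory.gaussianReal 0 2

/-- The heat kernel at time `1` on the line. -/
noncomputable def heat (x : ℝ) : ℝ := 1 / Real.sqrt (4 * Real.pi) * Real.exp (-(1 / 4 * x ^ 2))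

theorem gaussianPDFReal_eq_heat : ProbabilityTheory.gaussianPDFReal 0 2 = heat := by
  ext x
  simp only [ProbabilityTheory.gaussianPDFReal, heat]
  have : (2 * Real.pi * ((2 : NNReal) : ℝ)) = 4 * Real.pi := by push_cast; ring
  rw [this]
  congr 2
  · simp
  · push_cast; ring

theorem heat_pos (x : ℝ) : 0 < heat x := by
  unfold heat; positivity

theorem heat_neg (x : ℝ) : heat (-x) = heat x := by simp [heat]

@[fun_prop]
theorem hasTemperateGrowth_heat : heat.HasTemperateGrowth := by
  unfold heat
  exact (HasTemperateGrowth.const _).mul (hasTemperateGrowth_exp_neg_mul_sq (by norm_num))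

theorem integral_heatMeasure (f : ℝ → ℝ) : ∫ x, f x ∂heatMeasure = ∫ x, heat x * f x := by
  rw [ProbabilityTheory.integral_gaussianReal_eq_integral_smul (by norm_num)]
  simp [gaussianPDFReal_eq_heat]

theorem hasMoments_heatMeasure : HasMoments heatMeasure := by
  intro n
  have h1 : MemLp (fun x : ℝ => 1 + |x|) n heatMeasure := by
    have := (ProbabilityTheory.memLp_id_gaussianReal' (μ := 0) (v := 2) (n : ENNReal)
      (by simp)).norm
    exact (memLp_const (1 : ℝ)).add this
  have := h1.integrable_norm_pow'
  refine this.congr (ae_of_all _ fun x => ?_)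
  simp only [Real.norm_eq_abs]
  rw [abs_of_nonneg (by positivity)]

theorem integral_neg_heatMeasure (f : ℝ → ℝ) :
    ∫ x, f (-x) ∂heatMeasure = ∫ x, f x ∂heatMeasure := by
  rw [integral_heatMeasure, integral_heatMeasure, ← integral_neg_eq_self]
  simp [heat_neg]

/-- The distribution function of `heatMeasure`. -/
noncomputable def heatCDF (x : ℝ) : ℝ := ProbabilityTheory.cdf heatMeasure x

theorem heatCDF_nonneg (x : ℝ) : 0 ≤ heatCDF x := ProbabilityTheory.cdf_nonneg _ _
theorem heatCDF_le_one (x : ℝ) : heatCDF x ≤ 1 := ProbabilityTheory.cdf_le_one _ _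

theorem heatCDF_eq (x : ℝ) : heatCDF x = heatMeasure.real (Set.Iic x) :=
  ProbabilityTheory.cdf_eq_real _ _

theorem heatCDF_eq_integral (x : ℝ) : heatCDF x = ∫ y in Set.Iic x, heat y := by
  rw [heatCDF_eq, Measure.real, ProbabilityTheory.gaussianReal_apply_eq_integral _ (by norm_num),
    ENNReal.toReal_ofReal]
  · rw [gaussianPDFReal_eq_heat]
  · exact integral_nonneg fun _ => ProbabilityTheory.gaussianPDFReal_nonneg _ _ _

theorem integrable_heat : Integrable heat := by
  rw [← gaussianPDFReal_eq_heat]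
  exact ProbabilityTheory.integrable_gaussianPDFReal _ _

theorem continuous_heat : Continuous heat := hasTemperateGrowth_heat.1.continuous

theorem hasDerivAt_heatCDF (x : ℝ) : HasDerivAt heatCDF (heat x) x := by
  have h : heatCDF = fun x => (∫ y in Set.Iic 0, heat y) + ∫ y in (0)..x, heat y := by
    ext x
    rw [heatCDF_eq_integral, ← intervalIntegral.integral_Iic_sub_Iic
      integrable_heat.integrableOn integrable_heat.integrableOn]
    ring
  rw [h]
  exact (intervalIntegral.integral_hasDerivAt_right integrable_heat.intervalIntegrable
    continuous_heat.aestronglyMeasurable.stronglyMeasurableAtFilter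
    continuous_heat.continuousAt).const_add _

@[fun_prop]
-- The function is bounded by 1 and its derivative `heat` has temperate growth.
theorem hasTemperateGrowth_heatCDF : heatCDF.HasTemperateGrowth := by
  refine HasTemperateGrowth.of_fderiv (k := 0) (C := 1) ?_
    (fun x => (hasDerivAt_heatCDF x).differentiableAt) fun x => ?_
  · have : fderiv ℝ heatCDF = fun x => ContinuousLinearMap.toSpanSingletonCLE (𝕜 := ℝ) (heat x) := by
      ext x
      simp [(hasDerivAt_heatCDF x).hasFDerivAt.fderiv]
    rw [this]
    exact hasTemperateGrowth_heat.clm_comp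
      (ContinuousLinearMap.toSpanSingletonCLE (𝕜 := ℝ) (E := ℝ)).toContinuousLinearMap
  · simp [abs_of_nonneg (heatCDF_nonneg x), heatCDF_le_one]

theorem heatMeasure_Ici (x : ℝ) : heatMeasure.real (Set.Ici x) = heatCDF (-x) := by
  have h := map_measureReal_apply (μ := heatMeasure) (f := fun y : ℝ => -y) (by fun_prop)
    (measurableSet_Iic (a := -x))
  rw [ProbabilityTheory.gaussianReal_map_neg, neg_zero] at h
  rw [heatCDF_eq, h]
  congr 1
  ext y; simp

/-- The Gaussian is symmetric and has no atoms. This is one half of the symmetry that makes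
correctors odd. -/
theorem heatCDF_neg (x : ℝ) : heatCDF (-x) = 1 - heatCDF x := by
  have := ProbabilityTheory.nullSingletonClass_gaussianReal (μ := 0) (v := 2) (by norm_num)
  have h2 : heatMeasure.real (Set.Ici x) = heatMeasure.real (Set.Ioi x) :=
    measureReal_congr Ioi_ae_eq_Ici.symm
  rw [← heatMeasure_Ici, h2, heatCDF_eq, ← Set.compl_Iic,
    probReal_compl_eq_one_sub measurableSet_Iic]

end Gaussian

/-! ### The implicit function theorem and regularity of continuous solutions. -/

section Implicit

variable {E : Type*} [NormedAddCommGroup E] [NormedSpace ℝ E]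

theorem isInvertible_of_apply_one_ne_zero {L : ℝ →L[ℝ] ℝ} (h : L 1 ≠ 0) : L.IsInvertible :=
  ⟨ContinuousLinearEquiv.unitsEquivAut ℝ (Units.mk0 (L 1) h), by ext; simp⟩

theorem HasDerivAt.fderiv_comp_inr_apply_one {f : E × ℝ → ℝ} {q : E} {z d : ℝ}
    (hd : HasDerivAt (fun y => f (q, y)) d z) (hf : DifferentiableAt ℝ f (q, z)) :
    (fderiv ℝ f (q, z) ∘L .inr ℝ E ℝ) 1 = d := by
  have h := (hf.hasFDerivAt.comp z (hasFDerivAt_prodMk_right q z)).hasDerivAt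
  exact h.unique hd

/-- The implicit function theorem for one real unknown. -/
theorem exists_implicit [CompleteSpace E] {f : E × ℝ → ℝ} {n : WithTop ℕ∞} (hn : n ≠ 0) {q : E} {z d : ℝ}
    (hf : ContDiffAt ℝ n f (q, z)) (hd : HasDerivAt (fun y => f (q, y)) d z) (hd0 : d ≠ 0) :
    ∃ ψ : E → ℝ, ContDiffAt ℝ n ψ q ∧ ψ q = z ∧ (∀ᶠ x in 𝓝 q, f (x, ψ x) = f (q, z)) ∧
      ∀ᶠ v in 𝓝 (q, z), f v = f (q, z) → ψ v.1 = v.2 := by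
  have h2 : (fderiv ℝ f (q, z) ∘L .inr ℝ E ℝ).IsInvertible := by
    apply isInvertible_of_apply_one_ne_zero
    rwa [hd.fderiv_comp_inr_apply_one (hf.differentiableAt hn)]
  exact ⟨hf.implicitFunction hn h2, hf.contDiffAt_implicitFunction hn h2,
    hf.implicitFunction_apply_self hn h2, hf.eventually_apply_implicitFunction hn h2,
    (hf.eventually_apply_eq_iff_implicitFunction hn h2).mono fun v hv => hv.1⟩

/-- A continuous solution of a smooth nondegenerate equation is smooth. -/
theorem ContinuousAt.contDiffAt_of_implicit [CompleteSpace E] {f : E × ℝ → ℝ} {n : WithTop ℕ∞} (hn : n ≠ 0)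
    {q : E} {ψ : E → ℝ} (hψ : ContinuousAt ψ q) {c : ℝ} (hc : ∀ᶠ x in 𝓝 q, f (x, ψ x) = c) {d : ℝ}
    (hf : ContDiffAt ℝ n f (q, ψ q)) (hd : HasDerivAt (fun y => f (q, y)) d (ψ q)) (hd0 : d ≠ 0) :
    ContDiffAt ℝ n ψ q := by
  obtain ⟨φ, hφ, hφq, -, hu⟩ := exists_implicit hn hf hd hd0
  refine hφ.congr_of_eventuallyEq ?_
  have ht : Tendsto (fun x => (x, ψ x)) (𝓝 q) (𝓝 (q, ψ q)) :=
    continuousAt_id.prodMk hψ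
  filter_upwards [ht.eventually hu, hc] with x hx hx'
  rw [hx (hx'.trans hc.self_of_nhds.symm)]

end Implicit

/-! ### Difference quotients that are smooth across a zero increment. -/

section Slope

/-- The difference quotient `(u (x + s) - u x) / s`, extended smoothly to `s = 0`. -/
noncomputable def diffQuot (u : ℝ → ℝ) (p : ℝ × ℝ) : ℝ :=
  ∫ θ, deriv u (p.1 + θ * p.2) ∂(volume.restrict (Set.Ioc (0 : ℝ) 1))

theorem hasMoments_restrict_Ioc : HasMoments (volume.restrict (Set.Ioc (0 : ℝ) 1)) := fun n =>
  ((by fun_prop : Continuous fun ξ : ℝ => (1 + |ξ|) ^ n).integrableOn_Icc (a := 0) (b := 1)).mono_set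
    Set.Ioc_subset_Icc_self

variable {u : ℝ → ℝ}

theorem Function.HasTemperateGrowth.deriv_right (hu : u.HasTemperateGrowth) :
    (deriv u).HasTemperateGrowth :=
  hu.fderiv_right.clm_comp (ContinuousLinearMap.apply ℝ ℝ (1 : ℝ))

/-- The quotient is a parameter integral over (0, 1], a measure with all moments, so the general
differentiation theorem applies. -/
theorem Function.HasTemperateGrowth.diffQuot_right (hu : u.HasTemperateGrowth) :
    (diffQuot u).HasTemperateGrowth := by
  have h1 : (fun q : (ℝ × ℝ) × ℝ => q.1.1 + q.2 * q.1.2).HasTemperateGrowth := by fun_prop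
  exact (hu.deriv_right.comp h1).integral hasMoments_restrict_Ioc

theorem diffQuot_zero (x : ℝ) : diffQuot u (x, 0) = deriv u x := by
  simp [diffQuot]

theorem mul_diffQuot (hu : ContDiff ℝ ∞ u) (x s : ℝ) : s * diffQuot u (x, s) = u (x + s) - u x := by
  have h1 : ∀ θ ∈ Set.uIcc (0 : ℝ) 1, HasDerivAt (fun θ => u (x + θ * s))
      (s * deriv u (x + θ * s)) θ := fun θ _ => by
    have h2 : HasDerivAt (fun θ : ℝ => x + θ * s) s θ := by
      simpa using ((hasDerivAt_id θ).mul_const s).const_add x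
    have := ((hu.differentiable (by simp)) (x + θ * s)).hasDerivAt.comp θ h2
    rwa [mul_comm] at this
  have hc : Continuous (deriv u) := hu.continuous_deriv (by simp)
  have h3 := intervalIntegral.integral_eq_sub_of_hasDerivAt h1
    (Continuous.intervalIntegrable (by fun_prop) _ _)
  rw [intervalIntegral.integral_of_le zero_le_one, integral_const_mul] at h3
  simpa [diffQuot] using h3

theorem abs_diffQuot_le {B : ℝ} (hB : ∀ x, |deriv u x| ≤ B) (p : ℝ × ℝ) : |diffQuot u p| ≤ B := by
  have := norm_integral_le_of_norm_le_const (μ := volume.restrict (Set.Ioc (0 : ℝ) 1))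
    (f := fun θ => deriv u (p.1 + θ * p.2)) (C := B) (ae_of_all _ fun θ => hB _)
  simpa [diffQuot] using this

end Slope

/-! ### Rescaled profiles, their symmetry, and the corrector solving the level equation. -/

section Profile

/-- A smooth compactly supported function of `(x, ε)`, odd in `ε`. -/
structure IsCorrector (Z : ℝ × ℝ → ℝ) : Prop where
  smooth : ContDiff ℝ ∞ Z
  compact : HasCompactSupport Z
  odd : ∀ x e, Z (x, -e) = -Z (x, e)

theorem IsCorrector.hasTemperateGrowth {Z : ℝ × ℝ → ℝ} (hZ : IsCorrector Z) :
    Z.HasTemperateGrowth := hZ.compact.hasTemperateGrowth hZ.smooth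

theorem IsCorrector.apply_zero {Z : ℝ × ℝ → ℝ} (hZ : IsCorrector Z) (x : ℝ) : Z (x, 0) = 0 := by
  have := hZ.odd x 0
  rw [neg_zero] at this
  linarith

theorem IsCorrector.zero : IsCorrector fun _ => 0 :=
  ⟨contDiff_const, HasCompactSupport.zero, by simp⟩

/-- The height over the point `x + ε ξ` of the graph of `u + ε Z`, relative to the point
`(x, u x + ε z)` and in units of `ε`. -/
noncomputable def relHeight (u : ℝ → ℝ) (Z : ℝ × ℝ → ℝ) (Q : ((ℝ × ℝ) × ℝ) × ℝ) : ℝ :=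
  Q.2 * diffQuot u (Q.1.1.1, Q.1.1.2 * Q.2) + Z (Q.1.1.1 + Q.1.1.2 * Q.2, Q.1.1.2) - Q.1.2

/-- The Gaussian average over the region below the graph of `u + ε Z`, at the point
`(x, u x + ε z)`, as a function of `((x, ε), z)`. -/
noncomputable def profile (u : ℝ → ℝ) (Z : ℝ × ℝ → ℝ) (P : (ℝ × ℝ) × ℝ) : ℝ :=
  ∫ ξ, heatCDF (relHeight u Z (P, ξ)) ∂heatMeasure

variable {u : ℝ → ℝ} {Z : ℝ × ℝ → ℝ}

theorem hasTemperateGrowth_relHeight (hu : u.HasTemperateGrowth) (hZ : Z.HasTemperateGrowth) :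
    (relHeight u Z).HasTemperateGrowth := by
  have h1 := hu.diffQuot_right
  have h2 : (fun Q : ((ℝ × ℝ) × ℝ) × ℝ => (Q.1.1.1, Q.1.1.2 * Q.2)).HasTemperateGrowth := by fun_prop
  have h3 : (fun Q : ((ℝ × ℝ) × ℝ) × ℝ =>
    (Q.1.1.1 + Q.1.1.2 * Q.2, Q.1.1.2)).HasTemperateGrowth := by fun_prop
  have h4 := h1.comp h2
  have h5 := hZ.comp h3
  have h6 : (fun Q : ((ℝ × ℝ) × ℝ) × ℝ => Q.2).HasTemperateGrowth := by fun_prop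
  have h7 : (fun Q : ((ℝ × ℝ) × ℝ) × ℝ => Q.1.2).HasTemperateGrowth := by fun_prop
  exact ((h6.mul h4).add h5).sub h7

theorem hasTemperateGrowth_profile (hu : u.HasTemperateGrowth) (hZ : Z.HasTemperateGrowth) :
    (profile u Z).HasTemperateGrowth :=
  (hasTemperateGrowth_heatCDF.comp (hasTemperateGrowth_relHeight hu hZ)).integral
    hasMoments_heatMeasure

theorem hasDerivAt_profile (hu : u.HasTemperateGrowth) (hZ : Z.HasTemperateGrowth) (q : ℝ × ℝ)
    (z : ℝ) : HasDerivAt (fun z => profile u Z (q, z))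
      (-∫ ξ, heat (relHeight u Z ((q, z), ξ)) ∂heatMeasure) z := by
  have h0 : (fun p : ℝ × ℝ => ((q, p.1), p.2)).HasTemperateGrowth := by fun_prop
  have h1 := (hasTemperateGrowth_relHeight hu hZ).comp h0
  have h := (hasTemperateGrowth_heatCDF.comp h1).hasDerivAt_integral hasMoments_heatMeasure z
  refine HasDerivAt.congr_deriv (f := fun z => profile u Z (q, z)) h ?_
  rw [← integral_neg]
  congr 1
  ext ξ
  have h2 : HasFDerivAt (heatCDF ∘ (relHeight u Z ∘ fun p : ℝ × ℝ => ((q, p.1), p.2)))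
      (fderiv ℝ (heatCDF ∘ (relHeight u Z ∘ fun p : ℝ × ℝ => ((q, p.1), p.2))) (z, ξ)) (z, ξ) :=
    ((hasTemperateGrowth_heatCDF.comp h1).1.differentiable (by simp) (z, ξ)).hasFDerivAt
  have h3 := (h2.comp z (hasFDerivAt_prodMk_left z ξ)).hasDerivAt
  have h4 : HasDerivAt (fun z => relHeight u Z ((q, z), ξ)) (-1) z := by
    simpa [relHeight] using (hasDerivAt_id z).const_sub
      (ξ * diffQuot u (q.1, q.2 * ξ) + Z (q.1 + q.2 * ξ, q.2))
  have h5 := (hasDerivAt_heatCDF (relHeight u Z ((q, z), ξ))).comp z h4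
  have := h3.unique h5
  simpa using this

theorem relHeight_neg (hZ : ∀ x e, Z (x, -e) = -Z (x, e)) (x e z ξ : ℝ) :
    relHeight u Z (((x, -e), -z), ξ) = -relHeight u Z (((x, e), z), -ξ) := by
  simp only [relHeight]
  rw [show -e * ξ = e * -ξ by ring, hZ]
  ring

/-- Reversing ε, z and ξ together reverses the relative height; symmetry of the Gaussian in ξ and
`heatCDF_neg` do the rest. -/
theorem profile_neg (hu : u.HasTemperateGrowth) (hZ : IsCorrector Z) (x e z : ℝ) :
    profile u Z ((x, -e), -z) = 1 - profile u Z ((x, e), z) := by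
  simp only [profile, relHeight_neg hZ.odd, heatCDF_neg]
  rw [integral_sub (integrable_const _), integral_neg_heatMeasure
    (fun ξ => heatCDF (relHeight u Z (((x, e), z), ξ)))]
  · simp
  · rw [← integrable_neg_iff]
    have h0 : (fun p : ((ℝ × ℝ) × ℝ) × ℝ => (p.1, -p.2)).HasTemperateGrowth := by fun_prop
    have := (hasTemperateGrowth_heatCDF.comp ((hasTemperateGrowth_relHeight hu
      hZ.hasTemperateGrowth).comp h0)).integrable_right hasMoments_heatMeasure ((x, e), z)
    exact this.neg

theorem profile_zero (hu : u.HasTemperateGrowth) (hZ : IsCorrector Z) (x : ℝ) :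
    profile u Z ((x, 0), 0) = 1 / 2 := by
  have := profile_neg hu hZ x 0 0
  rw [neg_zero] at this
  linarith

variable {ι : Type*} [Fintype ι]

/-- The weighted average of the profiles of several stages. -/
noncomputable def sumProfile (u : ℝ → ℝ) (c : ι → ℝ) (Z : ι → ℝ × ℝ → ℝ) (P : (ℝ × ℝ) × ℝ) : ℝ :=
  ∑ i, c i * profile u (Z i) P

/-- Minus the vertical derivative of `sumProfile`. -/
noncomputable def sumDensity (u : ℝ → ℝ) (c : ι → ℝ) (Z : ι → ℝ × ℝ → ℝ) (P : (ℝ × ℝ) × ℝ) : ℝ :=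
  ∑ i, c i * ∫ ξ, heat (relHeight u (Z i) (P, ξ)) ∂heatMeasure

variable {c : ι → ℝ} {Z : ι → ℝ × ℝ → ℝ}

theorem hasTemperateGrowth_sumProfile (hu : u.HasTemperateGrowth) (hZ : ∀ i, IsCorrector (Z i)) :
    (sumProfile u c Z).HasTemperateGrowth :=
  HasTemperateGrowth.sum fun i _ => (HasTemperateGrowth.const (c i)).mul
    (hasTemperateGrowth_profile hu (hZ i).hasTemperateGrowth)

theorem hasTemperateGrowth_sumDensity (hu : u.HasTemperateGrowth) (hZ : ∀ i, IsCorrector (Z i)) :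
    (sumDensity u c Z).HasTemperateGrowth :=
  HasTemperateGrowth.sum fun i _ => (HasTemperateGrowth.const (c i)).mul
    ((hasTemperateGrowth_heat.comp (hasTemperateGrowth_relHeight hu
      (hZ i).hasTemperateGrowth)).integral hasMoments_heatMeasure)

theorem hasDerivAt_sumProfile (hu : u.HasTemperateGrowth) (hZ : ∀ i, IsCorrector (Z i))
    (q : ℝ × ℝ) (z : ℝ) :
    HasDerivAt (fun z => sumProfile u c Z (q, z)) (-sumDensity u c Z (q, z)) z := by
  have := HasDerivAt.fun_sum (u := Finset.univ) fun i _ =>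
    (hasDerivAt_profile hu (hZ i).hasTemperateGrowth q z).const_mul (c i)
  simpa [sumProfile, sumDensity] using this

/-- At x = ε = 0 the slope of u and all correctors vanish, so every relative height is -z and only
the total weight matters. This supplies transversality even when some weights are negative. -/
theorem sumDensity_zero (hu0 : deriv u 0 = 0) (hZ : ∀ i, IsCorrector (Z i)) (hc : ∑ i, c i = 1)
    (z : ℝ) : sumDensity u c Z ((0, 0), z) = heat z := by
  simp [sumDensity, relHeight, diffQuot_zero, hu0, (hZ _).apply_zero, heat_neg, ← Finset.sum_mul,
    hc]

theorem sumProfile_neg (hu : u.HasTemperateGrowth) (hZ : ∀ i, IsCorrector (Z i))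
    (hc : ∑ i, c i = 1) (x e z : ℝ) :
    sumProfile u c Z ((x, -e), -z) = 1 - sumProfile u c Z ((x, e), z) := by
  simp only [sumProfile, profile_neg hu (hZ _), mul_sub, Finset.sum_sub_distrib, mul_one, hc]

theorem sumProfile_zero (hu : u.HasTemperateGrowth) (hZ : ∀ i, IsCorrector (Z i))
    (hc : ∑ i, c i = 1) (x : ℝ) : sumProfile u c Z ((x, 0), 0) = 1 / 2 := by
  simp only [sumProfile, profile_zero hu (hZ _), ← Finset.sum_mul, hc, one_mul]

/-- The level set `1/2` of the averaged profile is the graph of a corrector. -/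
theorem exists_corrector (hu : u.HasTemperateGrowth) (hu0 : deriv u 0 = 0)
    (hZ : ∀ i, IsCorrector (Z i)) (hc : ∑ i, c i = 1) :
    ∃ Y : ℝ × ℝ → ℝ, IsCorrector Y ∧ ∀ᶠ q in 𝓝 (0 : ℝ × ℝ), sumProfile u c Z (q, Y q) = 1 / 2 := by
  have hS := (hasTemperateGrowth_sumProfile (c := c) hu hZ).1
  have hval : sumProfile u c Z ((0 : ℝ × ℝ), 0) = 1 / 2 := sumProfile_zero hu hZ hc 0
  have hne : ∀ᶠ v in 𝓝 ((0 : ℝ × ℝ), (0 : ℝ)), sumDensity u c Z v ≠ 0 := by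
    refine (hasTemperateGrowth_sumDensity hu hZ).1.continuous.continuousAt.eventually_ne ?_
    have := sumDensity_zero hu0 hZ hc 0
    exact this ▸ (heat_pos 0).ne'
  obtain ⟨ψ, hψ, hψ0, hsol, huniq⟩ := exists_implicit (n := ∞) (by simp) hS.contDiffAt
    (hasDerivAt_sumProfile hu hZ 0 0) (neg_ne_zero.2 hne.self_of_nhds)
  rw [hval] at hsol huniq
  have hcont : ∀ᶠ q in 𝓝 (0 : ℝ × ℝ), ContinuousAt ψ q :=
    ((hψ.of_le (by simp : (1 : WithTop ℕ∞) ≤ ∞)).eventually (by simp)).mono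
      fun q hq => hq.continuousAt
  have htend : Tendsto (fun q => (q, ψ q)) (𝓝 0) (𝓝 ((0 : ℝ × ℝ), 0)) := by
    have := continuousAt_id.prodMk hψ.continuousAt
    simpa [ContinuousAt, hψ0] using this
  -- Order `∞` at a single point gives neighbourhoods that may shrink with the finite order; solving
  -- the equation anew at each nearby point gives smoothness on a fixed neighbourhood.
  have hsmooth : ∀ᶠ q in 𝓝 (0 : ℝ × ℝ), ContDiffAt ℝ ∞ ψ q := by
    filter_upwards [hcont, hsol.eventually_nhds, htend.eventually hne] with q h1 h2 h3
    exact h1.contDiffAt_of_implicit (by simp) h2 hS.contDiffAt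
      (hasDerivAt_sumProfile hu hZ q (ψ q)) (neg_ne_zero.2 h3)
  -- By the symmetry of the profile the reflected point also lies on the level 1/2, and local
  -- uniqueness identifies it with the graph of ψ.
  have hodd : ∀ᶠ q in 𝓝 (0 : ℝ × ℝ), ψ (q.1, -q.2) = -ψ q := by
    have ht : Tendsto (fun q : ℝ × ℝ => ((q.1, -q.2), -ψ q)) (𝓝 0) (𝓝 ((0 : ℝ × ℝ), 0)) := by
      have h1 : ContinuousAt (fun q : ℝ × ℝ => ((q.1, -q.2), -ψ q)) 0 :=
        ContinuousAt.prodMk (by fun_prop) hψ.continuousAt.neg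
      have e : (((0 : ℝ × ℝ).1, -(0 : ℝ × ℝ).2), -ψ 0) = ((0 : ℝ × ℝ), (0 : ℝ)) := by simp [hψ0]
      exact e ▸ h1.tendsto
    filter_upwards [ht.eventually huniq, hsol] with q h1 h2
    apply h1
    have := sumProfile_neg hu hZ hc q.1 q.2 (ψ q)
    rw [this, h2]
    norm_num
  obtain ⟨r, hr, hball⟩ := Metric.eventually_nhds_iff_ball.1 hsmooth
  let b : ContDiffBump (0 : ℝ × ℝ) := ⟨r / 3, r / 2, by positivity, by linarith⟩
  have hbs : ContDiff ℝ ∞ (fun q => b q * ψ q) := by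
    refine contDiff_iff_contDiffAt.2 fun q => ?_
    by_cases hq : q ∈ tsupport (fun q => b q * ψ q)
    swap
    · exact (contDiffAt_const (c := (0 : ℝ))).congr_of_eventuallyEq
        (notMem_tsupport_iff_eventuallyEq.1 hq)
    have hq' : q ∈ tsupport b := tsupport_mul_subset_left hq
    rw [b.tsupport_eq] at hq'
    exact b.contDiff.contDiffAt.mul (hball q (Metric.closedBall_subset_ball
      (show r / 2 < r by linarith) hq'))
  have hbc : HasCompactSupport (fun q => b q * ψ q) := b.hasCompactSupport.mul_right
  let σ : (ℝ × ℝ) ≃L[ℝ] (ℝ × ℝ) := (ContinuousLinearEquiv.refl ℝ ℝ).prodCongr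
    (ContinuousLinearEquiv.neg ℝ)
  have hσ : ∀ q, σ q = (q.1, -q.2) := fun q => rfl
  -- The cut-off need not be even in ε, so the odd part of b ψ is taken. Near the origin both
  -- cut-offs equal 1 and ψ is odd, hence nothing changes there.
  refine ⟨fun q => (b q * ψ q - b (σ q) * ψ (σ q)) / 2, ⟨?_, ?_, ?_⟩, ?_⟩
  · exact (hbs.sub (hbs.comp σ.contDiff)).div_const 2
  · have h1 := hbc.sub (hbc.comp_homeomorph σ.toHomeomorph)
    have := h1.mul_right (f' := fun _ => (2 : ℝ)⁻¹)
    simp only [div_eq_mul_inv]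
    exact this
  · intro x e
    simp only [hσ, neg_neg]
    ring
  · have hb1 : ∀ᶠ q in 𝓝 (0 : ℝ × ℝ), b q = 1 := b.eventuallyEq_one
    have hσt : Tendsto σ (𝓝 0) (𝓝 0) := by simpa using σ.continuous.tendsto 0
    filter_upwards [hb1, hσt.eventually hb1, hodd, hsol] with q h1 h2 h3 h4
    rw [h1, h2, hσ, h3]
    convert h4 using 3
    ring

end Profile

theorem two_le_infty : (2 : WithTop ℕ∞) ≤ ∞ := by
  exact WithTop.coe_le_coe.2 (le_top : (2 : ℕ∞) ≤ ⊤)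

theorem three_le_infty : (3 : WithTop ℕ∞) ≤ ∞ := by
  exact WithTop.coe_le_coe.2 (le_top : (3 : ℕ∞) ≤ ⊤)

/-! ### Iterated directional derivatives in the (x, ε) plane. -/

section DirDeriv

/-- The derivative of `f` in the direction `v`, as a function. -/
noncomputable def dirDeriv (v : ℝ × ℝ) (f : ℝ × ℝ → ℝ) (p : ℝ × ℝ) : ℝ := fderiv ℝ f p v

variable {f g : ℝ × ℝ → ℝ}

theorem ContDiff.dirDeriv (hf : ContDiff ℝ ∞ f) (v : ℝ × ℝ) : ContDiff ℝ ∞ (dirDeriv v f) :=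
  (hf.fderiv_right (m := ∞) (by simp)).clm_apply contDiff_const

theorem Function.HasTemperateGrowth.dirDeriv_right (hf : f.HasTemperateGrowth) (v : ℝ × ℝ) :
    (dirDeriv v f).HasTemperateGrowth :=
  hf.fderiv_right.clm_comp (ContinuousLinearMap.apply ℝ ℝ v)

theorem hasDerivAt_comp_line (hf : ContDiff ℝ ∞ f) (p v : ℝ × ℝ) (s : ℝ) :
    HasDerivAt (fun s => f (p + s • v)) (dirDeriv v f (p + s • v)) s := by
  have h1 : HasDerivAt (fun s : ℝ => p + s • v) v s := by
    simpa using ((hasDerivAt_id s).smul_const v).const_add p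
  exact ((hf.differentiable (by simp)) (p + s • v)).hasFDerivAt.comp_hasDerivAt s h1

theorem iteratedDeriv_comp_line (hf : ContDiff ℝ ∞ f) (p v : ℝ × ℝ) (n : ℕ) (s : ℝ) :
    iteratedDeriv n (fun s => f (p + s • v)) s = (dirDeriv v)^[n] f (p + s • v) := by
  induction n generalizing f with
  | zero => simp
  | succ n ih =>
    rw [iteratedDeriv_succ', iterate_succ_apply, ← ih (hf.dirDeriv v)]
    congr 1
    exact funext fun s => (hasDerivAt_comp_line hf p v s).deriv

theorem dirDeriv_comm (hf : ContDiff ℝ ∞ f) (v w : ℝ × ℝ) :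
    dirDeriv v (dirDeriv w f) = dirDeriv w (dirDeriv v f) := by
  ext p
  have hd : DifferentiableAt ℝ (fderiv ℝ f) p :=
    (hf.fderiv_right (m := ∞) (by simp)).differentiable (by simp) p
  have h : ∀ v w, dirDeriv v (dirDeriv w f) p = fderiv ℝ (fderiv ℝ f) p v w := fun v w => by
    have := (hd.hasFDerivAt.clm_apply (hasFDerivAt_const w p)).fderiv
    simp only [dirDeriv]
    change fderiv ℝ (fun q => fderiv ℝ f q w) p v = _
    rw [this]; simp
  rw [h, h]
  exact (hf.contDiffAt.isSymmSndFDerivAt (n := ∞) (by simpa using two_le_infty)) v w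

theorem dirDeriv_add (hf : ContDiff ℝ ∞ f) (hg : ContDiff ℝ ∞ g) (v : ℝ × ℝ) (a : ℝ) :
    dirDeriv v (fun p => a * f p + g p) = fun p => a * dirDeriv v f p + dirDeriv v g p := by
  ext p
  have := (((hf.differentiable (by simp) p).hasFDerivAt.const_mul a).add
    (hg.differentiable (by simp) p).hasFDerivAt).fderiv
  simp only [dirDeriv]
  erw [this]
  simp

theorem dirDeriv_mk_one (f : ℝ × ℝ → ℝ) (a : ℝ) :
    dirDeriv (a, 1) f = fun p => a * dirDeriv (1, 0) f p + dirDeriv (0, 1) f p := by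
  ext p
  simp only [dirDeriv]
  rw [show ((a, 1) : ℝ × ℝ) = a • (1, 0) + (0, 1) by simp, map_add, map_smul, smul_eq_mul]

/-- The third derivative along the direction `(a, 1)`, as a polynomial in `a`. -/
theorem dirDeriv_iterate_three (hf : ContDiff ℝ ∞ f) (a : ℝ) (p : ℝ × ℝ) :
    (dirDeriv (a, 1))^[3] f p =
      a ^ 3 * dirDeriv (1, 0) (dirDeriv (1, 0) (dirDeriv (1, 0) f)) p
      + 3 * a ^ 2 * dirDeriv (1, 0) (dirDeriv (1, 0) (dirDeriv (0, 1) f)) p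
      + 3 * a * dirDeriv (1, 0) (dirDeriv (0, 1) (dirDeriv (0, 1) f)) p
      + dirDeriv (0, 1) (dirDeriv (0, 1) (dirDeriv (0, 1) f)) p := by
  have hx := hf.dirDeriv (1, 0)
  have he := hf.dirDeriv (0, 1)
  have hxx := hx.dirDeriv (1, 0)
  have hxe := he.dirDeriv (1, 0)
  have hex := hx.dirDeriv (0, 1)
  have hee := he.dirDeriv (0, 1)
  simp only [iterate_succ_apply, iterate_zero_apply]
  rw [dirDeriv_mk_one f, dirDeriv_mk_one (fun p => _ + _), dirDeriv_mk_one (fun p => _ + _)]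
  have hs1 : ContDiff ℝ ∞ fun p => a * dirDeriv (1, 0) (dirDeriv (1, 0) f) p
      + dirDeriv (1, 0) (dirDeriv (0, 1) f) p := (contDiff_const.mul hxx).add hxe
  have hs2 : ContDiff ℝ ∞ fun p => a * dirDeriv (0, 1) (dirDeriv (1, 0) f) p
      + dirDeriv (0, 1) (dirDeriv (0, 1) f) p := (contDiff_const.mul hex).add hee
  rw [dirDeriv_add hx he, dirDeriv_add hx he, dirDeriv_add hs1 hs2, dirDeriv_add hs1 hs2,
    dirDeriv_add hxx hxe, dirDeriv_add hex hee, dirDeriv_add hxx hxe, dirDeriv_add hex hee,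
    dirDeriv_comm hx (0, 1) (1, 0), dirDeriv_comm hf (0, 1) (1, 0),
    dirDeriv_comm he (0, 1) (1, 0)]
  ring

end DirDeriv

/-! ### Iterated derivatives of parameter integrals. -/

section ParamIntegral

/-- Iterated differentiation under the integral sign. -/
theorem Function.HasTemperateGrowth.iteratedDeriv_integral {μ : Measure ℝ} (hμ : HasMoments μ)
    {f : ℝ × ℝ → ℝ} (hf : f.HasTemperateGrowth) (n : ℕ) (p : ℝ) :
    iteratedDeriv n (fun p => ∫ ξ, f (p, ξ) ∂μ) p
      = ∫ ξ, iteratedDeriv n (fun p => f (p, ξ)) p ∂μ := by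
  induction n generalizing f with
  | zero => simp
  | succ n ih =>
    simp only [iteratedDeriv_succ']
    have h1 : deriv (fun p => ∫ ξ, f (p, ξ) ∂μ) = fun p => ∫ ξ, dirDeriv (1, 0) f (p, ξ) ∂μ :=
      funext fun p => (hf.hasDerivAt_integral hμ p).deriv
    have h2 : ∀ ξ, deriv (fun p => f (p, ξ)) = fun p => dirDeriv (1, 0) f (p, ξ) := fun ξ =>
      funext fun p => by
        simpa using (hasDerivAt_comp_line hf.1 (0, ξ) (1, 0) p).deriv
    rw [h1, ih (hf.dirDeriv_right _)]
    simp only [h2]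

/-- Each derivative in s brings out a factor θ, and θⁿ has integral 1/(n + 1) over (0, 1]. -/
theorem iteratedDeriv_diffQuot_zero {u : ℝ → ℝ} (hu : u.HasTemperateGrowth) (n : ℕ) (x : ℝ) :
    iteratedDeriv n (fun s => diffQuot u (x, s)) 0 = iteratedDeriv (n + 1) u x / (n + 1) := by
  have h0 : (fun p : ℝ × ℝ => x + p.2 * p.1).HasTemperateGrowth := by fun_prop
  have h := (hu.deriv_right.comp h0).iteratedDeriv_integral hasMoments_restrict_Ioc n 0
  have h2 : ∀ θ : ℝ, iteratedDeriv n (fun s => deriv u (x + θ * s)) 0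
      = θ ^ n * iteratedDeriv (n + 1) u x := fun θ => by
    have h3 : ContDiff ℝ n (fun y => deriv u (x + y)) :=
      (hu.deriv_right.1.comp (contDiff_const.add contDiff_id)).of_le (by exact_mod_cast le_top)
    have h4 := congrFun (iteratedDeriv_comp_const_mul h3 θ) 0
    rw [h4, mul_zero, iteratedDeriv_comp_const_add]; simp only [add_zero]; rw [iteratedDeriv_succ']
  simp only [comp_apply, h2] at h
  change iteratedDeriv n (fun s => ∫ θ, deriv u (x + θ * s)
    ∂(volume.restrict (Set.Ioc (0 : ℝ) 1))) 0 = _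
  rw [h, integral_mul_const, ← intervalIntegral.integral_of_le zero_le_one, integral_pow]
  simp
  ring

end ParamIntegral

/-! ### Gaussian moments and the third derivative of the composed distribution function. -/

section Moments

theorem integrable_pow_mul_exp_neg_mul_sq {b : ℝ} (hb : 0 < b) (n : ℕ) :
    Integrable fun x : ℝ => x ^ n * Real.exp (-b * x ^ 2) := by
  have := integrable_rpow_mul_exp_neg_mul_sq hb (s := n) (by linarith [n.cast_nonneg (α := ℝ)])
  simpa using this

/-- Integration by parts: the derivative of x^(n+1) exp(-b x²) has integral zero. -/
theorem integral_pow_mul_exp_neg_mul_sq {b : ℝ} (hb : 0 < b) (n : ℕ) :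
    ∫ x : ℝ, x ^ (n + 2) * Real.exp (-b * x ^ 2)
      = (n + 1) / (2 * b) * ∫ x : ℝ, x ^ n * Real.exp (-b * x ^ 2) := by
  have h1 : ∀ x : ℝ, HasDerivAt (fun x : ℝ => x ^ (n + 1) * Real.exp (-b * x ^ 2))
      ((n + 1) * (x ^ n * Real.exp (-b * x ^ 2))
        - 2 * b * (x ^ (n + 2) * Real.exp (-b * x ^ 2))) x := fun x => by
    have h2 : HasDerivAt (fun x : ℝ => -b * x ^ 2) (-b * (2 * x)) x := by
      simpa using (hasDerivAt_pow 2 x).const_mul (-b)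
    refine ((hasDerivAt_pow (n + 1) x).fun_mul h2.exp).congr_deriv ?_
    simp only [Nat.add_sub_cancel]
    push_cast
    ring
  have hi := fun n => integrable_pow_mul_exp_neg_mul_sq hb n
  have h2 := integral_eq_zero_of_hasDerivAt_of_integrable h1
    (((hi n).const_mul _).sub ((hi (n + 2)).const_mul _)) (hi (n + 1))
  rw [integral_sub ((hi n).const_mul _) ((hi (n + 2)).const_mul _), integral_const_mul,
    integral_const_mul] at h2
  rw [div_mul_eq_mul_div, eq_div_iff (by positivity)]
  linarith

theorem heat_mul_heat (p x : ℝ) :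
    heat x * heat (p * x) = 1 / (4 * Real.pi) * Real.exp (-((1 + p ^ 2) / 4) * x ^ 2) := by
  have h : Real.sqrt (4 * Real.pi) * Real.sqrt (4 * Real.pi) = 4 * Real.pi :=
    Real.mul_self_sqrt (by positivity)
  unfold heat
  rw [mul_mul_mul_comm, ← Real.exp_add, one_div_mul_one_div, h]
  congr 1
  congr 1; ring

/-- The product `heat ξ * heat (p ξ)` is a centred Gaussian weight of variance 2/(1 + p²). For n = 0
and p the slope of the graph, this factor is the source of the denominator in `graphCurv`. -/
theorem integral_pow_mul_heat (p : ℝ) (n : ℕ) :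
    ∫ ξ, ξ ^ (n + 2) * heat (p * ξ) ∂heatMeasure
      = 2 * (n + 1) / (1 + p ^ 2) * ∫ ξ, ξ ^ n * heat (p * ξ) ∂heatMeasure := by
  have h : ∀ k : ℕ, ∫ ξ, ξ ^ k * heat (p * ξ) ∂heatMeasure = 1 / (4 * Real.pi) *
      ∫ ξ : ℝ, ξ ^ k * Real.exp (-((1 + p ^ 2) / 4) * ξ ^ 2) := fun k => by
    rw [integral_heatMeasure, ← integral_const_mul]
    congr 1
    ext ξ
    linear_combination ξ ^ k * heat_mul_heat p ξ
  rw [h, h, integral_pow_mul_exp_neg_mul_sq (by positivity)]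
  field_simp
  ring

theorem integral_pow_heatMeasure (n : ℕ) :
    ∫ ξ, ξ ^ (n + 2) ∂heatMeasure = 2 * (n + 1) * ∫ ξ, ξ ^ n ∂heatMeasure := by
  have := integral_pow_mul_heat 0 n
  simp only [zero_mul, integral_mul_const] at this
  have h0 := (heat_pos 0).ne'
  have h1 : (∫ ξ, ξ ^ (n + 2) ∂heatMeasure) * heat 0
      = (2 * (n + 1) * ∫ ξ, ξ ^ n ∂heatMeasure) * heat 0 := by
    rw [this]; ring
  exact mul_right_cancel₀ h0 h1

theorem integrable_pow_heatMeasure (n : ℕ) : Integrable (fun ξ : ℝ => ξ ^ n) heatMeasure :=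
  (by fun_prop : (fun p : ℝ × ℝ => p.2 ^ n).HasTemperateGrowth).integrable_right
    hasMoments_heatMeasure 0

/-- The even moments are 1, 2, 12, 120 and the odd ones vanish. A fifth power does not occur in the
integrand of the third-order computation. -/
theorem integral_polynomial_heatMeasure (k0 k1 k2 k3 k4 k6 : ℝ) :
    ∫ ξ, (k0 + k1 * ξ + k2 * ξ ^ 2 + k3 * ξ ^ 3 + k4 * ξ ^ 4 + k6 * ξ ^ 6) ∂heatMeasure
      = k0 + 2 * k2 + 12 * k4 + 120 * k6 := by
  have hi := fun n k => (integrable_pow_heatMeasure n).const_mul k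
  have m1 : ∫ ξ, ξ ∂heatMeasure = 0 := ProbabilityTheory.integral_id_gaussianReal
  have m2 : ∫ ξ, ξ ^ 2 ∂heatMeasure = 2 := by
    have := integral_pow_heatMeasure 0
    simpa using this
  have m3 : ∫ ξ, ξ ^ 3 ∂heatMeasure = 0 := by
    have := integral_pow_heatMeasure 1
    simpa [m1] using this
  have m4 : ∫ ξ, ξ ^ 4 ∂heatMeasure = 12 := by
    have := integral_pow_heatMeasure 2
    rw [m2] at this; rw [this]; norm_num
  have m6 : ∫ ξ, ξ ^ 6 ∂heatMeasure = 120 := by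
    have := integral_pow_heatMeasure 4
    rw [m4] at this; rw [this]; norm_num
  have i1 : Integrable (fun ξ : ℝ => k1 * ξ) heatMeasure := by simpa using hi 1 k1
  have s1 := (integrable_const (μ := heatMeasure) k0).fun_add i1
  have s2 := s1.fun_add (hi 2 k2)
  have s3 := s2.fun_add (hi 3 k3)
  have s4 := s3.fun_add (hi 4 k4)
  rw [integral_add s4 (hi 6 k6), integral_add s3 (hi 4 k4), integral_add s2 (hi 3 k3),
    integral_add s1 (hi 2 k2), integral_add (integrable_const _) i1]
  simp only [integral_const_mul, m2, m3, m4, m6]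
  rw [integral_const_mul, m1]
  simp
  ring

end Moments

section Chain

theorem hasDerivAt_heat (x : ℝ) : HasDerivAt heat (-(x / 2) * heat x) x := by
  have h2 : HasDerivAt (fun x : ℝ => -(1 / 4 * x ^ 2)) (-(1 / 4 * (2 * x))) x := by
    simpa only [Nat.cast_ofNat, Nat.add_one_sub_one, pow_one] using
      ((hasDerivAt_pow 2 x).const_mul (1 / 4)).fun_neg
  refine (h2.exp.const_mul (1 / Real.sqrt (4 * Real.pi))).congr_deriv ?_
  unfold heat
  ring

/-- In the third-order chain rule the mixed term drops out because `heat` has zero derivative at 0,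
while its second derivative there is -(1/2) `heat 0`. -/
theorem iteratedDeriv_three_heatCDF_comp {w : ℝ → ℝ} (hw : ContDiff ℝ ∞ w) (h0 : w 0 = 0) :
    iteratedDeriv 3 (fun e => heatCDF (w e)) 0
      = heat 0 * (iteratedDeriv 3 w 0 - 1 / 2 * deriv w 0 ^ 3) := by
  have hc : ContDiff ℝ ∞ heatCDF := hasTemperateGrowth_heatCDF.1
  have d1 : deriv heatCDF = heat := funext fun x => (hasDerivAt_heatCDF x).deriv
  have d2 : deriv heat = fun x => -(x / 2) * heat x := funext fun x => (hasDerivAt_heat x).deriv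
  have d3 : deriv (fun x : ℝ => -(x / 2) * heat x) 0 = -(1 / 2) * heat 0 := by
    have h : HasDerivAt (fun x : ℝ => -(x / 2)) (-(1 / 2)) 0 := by
      simpa using ((hasDerivAt_id (0 : ℝ)).div_const 2).fun_neg
    have := (h.fun_mul (hasDerivAt_heat 0)).deriv
    rw [this]; simp
  have := iteratedDeriv_comp_three (x := (0 : ℝ)) (g := heatCDF) (f := w)
    (hc.of_le three_le_infty).contDiffAt (hw.of_le three_le_infty).contDiffAt
  simp only [comp_def] at this
  rw [this, h0]
  simp only [iteratedDeriv_succ', iteratedDeriv_zero, d1, d2, d3]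
  ring

end Chain

/-! ### First and third ε-derivatives of the level equation. -/

section Coefficients

variable {u : ℝ → ℝ}

theorem IsCorrector.dirDeriv_one_zero {Z : ℝ × ℝ → ℝ} (hZ : IsCorrector Z) (x : ℝ) :
    dirDeriv (1, 0) Z (x, 0) = 0 := by
  have h := hasDerivAt_comp_line hZ.smooth (x, 0) (1, 0) 0
  simp only [Prod.smul_mk, smul_eq_mul, mul_one, mul_zero, Prod.mk_add_mk, add_zero,
    hZ.apply_zero] at h
  exact h.unique (hasDerivAt_const _ _)

/-- The relative height along a graph `Y` over a fixed abscissa. -/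
theorem iteratedDeriv_relHeight (hu : u.HasTemperateGrowth) {Z Y : ℝ × ℝ → ℝ}
    (hZ : IsCorrector Z) (hY : IsCorrector Y) (x ξ : ℝ) (n : ℕ) :
    iteratedDeriv n (fun e => relHeight u Z (((x, e), Y (x, e)), ξ)) 0
      = ξ ^ (n + 1) * (iteratedDeriv (n + 1) u x / (n + 1)) + (dirDeriv (ξ, 1))^[n] Z (x, 0)
        - (dirDeriv (0, 1))^[n] Y (x, 0) := by
  have hq : ContDiff ℝ ∞ (fun s => diffQuot u (x, s)) :=
    hu.diffQuot_right.1.comp (contDiff_const.prodMk contDiff_id)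
  have hle : (n : WithTop ℕ∞) ≤ ∞ := WithTop.coe_le_coe.2 le_top
  have h1 : iteratedDeriv n (fun e => ξ * diffQuot u (x, e * ξ)) 0
      = ξ ^ (n + 1) * (iteratedDeriv (n + 1) u x / (n + 1)) := by
    have := congrFun (iteratedDeriv_comp_const_mul (hq.of_le hle) ξ) 0
    rw [iteratedDeriv_const_mul_field]
    simp only [mul_comm _ ξ]
    rw [this, mul_zero, iteratedDeriv_diffQuot_zero hu]
    ring
  have h2 : iteratedDeriv n (fun e => Z (x + e * ξ, e)) 0 = (dirDeriv (ξ, 1))^[n] Z (x, 0) := by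
    simpa using iteratedDeriv_comp_line hZ.smooth (x, 0) (ξ, 1) n 0
  have h3 : iteratedDeriv n (fun e => Y (x, e)) 0 = (dirDeriv (0, 1))^[n] Y (x, 0) := by
    simpa using iteratedDeriv_comp_line hY.smooth (x, 0) (0, 1) n 0
  have c1 : ContDiff ℝ n (fun e => ξ * diffQuot u (x, e * ξ)) :=
    (contDiff_const.mul (hq.comp (contDiff_id.mul contDiff_const))).of_le hle
  have c2 : ContDiff ℝ n (fun e => Z (x + e * ξ, e)) :=
    (hZ.smooth.comp (by fun_prop : ContDiff ℝ ∞ fun e : ℝ => (x + e * ξ, e))).of_le hle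
  have c3 : ContDiff ℝ n (fun e => Y (x, e)) :=
    (hY.smooth.comp (contDiff_const.prodMk contDiff_id)).of_le hle
  simp only [relHeight]
  rw [iteratedDeriv_fun_sub (c1.add c2).contDiffAt c3.contDiffAt,
    iteratedDeriv_fun_add c1.contDiffAt c2.contDiffAt, h1, h2, h3]

variable {ι : Type*} [Fintype ι] {c : ι → ℝ} {Z : ι → ℝ × ℝ → ℝ} {Y : ℝ × ℝ → ℝ}

theorem hasTemperateGrowth_relHeight_graph (hu : u.HasTemperateGrowth) {Z : ℝ × ℝ → ℝ}
    (hZ : IsCorrector Z) (hY : IsCorrector Y) (x : ℝ) :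
    (fun p : ℝ × ℝ => relHeight u Z (((x, p.1), Y (x, p.1)), p.2)).HasTemperateGrowth := by
  have h1 : (fun p : ℝ × ℝ => (x, p.1)).HasTemperateGrowth := by fun_prop
  have h2 := hY.hasTemperateGrowth.comp h1
  have h3 : (fun p : ℝ × ℝ => p.2).HasTemperateGrowth := by fun_prop
  exact (hasTemperateGrowth_relHeight hu hZ.hasTemperateGrowth).comp ((h1.prodMk h2).prodMk h3)

/-- Differentiating the implicit equation in `ε`. -/
theorem sum_integral_iteratedDeriv (hu : u.HasTemperateGrowth) (hZ : ∀ i, IsCorrector (Z i))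
    (hY : IsCorrector Y) {x : ℝ}
    (h : ∀ᶠ e in 𝓝 (0 : ℝ), sumProfile u c Z ((x, e), Y (x, e)) = 1 / 2) (n : ℕ) (hn : n ≠ 0) :
    ∑ i, c i * ∫ ξ, iteratedDeriv n
      (fun e => heatCDF (relHeight u (Z i) (((x, e), Y (x, e)), ξ))) 0 ∂heatMeasure = 0 := by
  have hT := fun i => hasTemperateGrowth_heatCDF.comp
    (hasTemperateGrowth_relHeight_graph hu (hZ i) hY x)
  have h1 : iteratedDeriv n (fun e => sumProfile u c Z ((x, e), Y (x, e))) 0 = 0 := by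
    have h2 : (fun e => sumProfile u c Z ((x, e), Y (x, e))) =ᶠ[𝓝 0] fun _ => 1 / 2 := h
    rw [(h2.iteratedDeriv n).self_of_nhds, iteratedDeriv_const, if_neg hn]
  refine Eq.trans (Eq.symm ?_) h1
  simp only [sumProfile, profile]
  rw [iteratedDeriv_fun_sum]
  · refine Finset.sum_congr rfl fun i _ => ?_
    rw [iteratedDeriv_const_mul_field]
    congr 1
    exact (hT i).iteratedDeriv_integral hasMoments_heatMeasure n 0
  · intro i _
    exact (contDiff_const.mul (((hT i).integral hasMoments_heatMeasure).1.of_le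
      (WithTop.coe_le_coe.2 le_top))).contDiffAt

/-- The right-hand side of the curvature motion of graphs. -/
noncomputable def graphCurv (u : ℝ → ℝ) (x : ℝ) : ℝ := iteratedDeriv 2 u x / (1 + deriv u x ^ 2)

/-- The first-order coefficient of the level set of the averaged profile. -/
theorem dirDeriv_corrector_eq (hu : u.HasTemperateGrowth) (hZ : ∀ i, IsCorrector (Z i))
    (hY : IsCorrector Y) (hc : ∑ i, c i = 1) {x : ℝ}
    (h : ∀ᶠ e in 𝓝 (0 : ℝ), sumProfile u c Z ((x, e), Y (x, e)) = 1 / 2) :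
    dirDeriv (0, 1) Y (x, 0) = graphCurv u x + ∑ i, c i * dirDeriv (0, 1) (Z i) (x, 0) := by
  have h1 := sum_integral_iteratedDeriv hu hZ hY h 1 one_ne_zero
  set p := deriv u x with hp
  set A := ∫ ξ, ξ ^ 0 * heat (p * ξ) ∂heatMeasure with hA
  have hi : ∀ n : ℕ, Integrable (fun ξ => ξ ^ n * heat (p * ξ)) heatMeasure := fun n => by
    have h1 : (fun q : ℝ × ℝ => p * q.2).HasTemperateGrowth := by fun_prop
    have h2 : (fun q : ℝ × ℝ => q.2 ^ n).HasTemperateGrowth := by fun_prop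
    exact (h2.mul (hasTemperateGrowth_heat.comp h1)).integrable_right hasMoments_heatMeasure 0
  have hApos : 0 < A := by
    rw [hA, integral_pos_iff_support_of_nonneg]
    · have : (support fun ξ => ξ ^ 0 * heat (p * ξ)) = Set.univ := by
        ext ξ; simp [(heat_pos _).ne']
      rw [this]; simp
    · intro ξ; simpa using (heat_pos _).le
    · exact hi 0
  -- At ε = 0 every relative height is p ξ, so all stages carry the same weight `heat (p ξ)`; its
  -- mass A is a common positive factor and cancels at the end.
  have hd : ∀ i ξ, iteratedDeriv 1 (fun e => heatCDF (relHeight u (Z i) (((x, e), Y (x, e)), ξ))) 0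
      = (iteratedDeriv 2 u x / 2) * (ξ ^ (0 + 2) * heat (p * ξ))
        + (dirDeriv (0, 1) (Z i) (x, 0) - dirDeriv (0, 1) Y (x, 0)) * (ξ ^ 0 * heat (p * ξ)) := by
    intro i ξ
    have hw := (hasTemperateGrowth_relHeight_graph hu (hZ i) hY x).1.comp
      (by fun_prop : ContDiff ℝ ∞ fun e : ℝ => (e, ξ))
    have hw' : DifferentiableAt ℝ (fun e => relHeight u (Z i) (((x, e), Y (x, e)), ξ)) 0 :=
      hw.differentiable (by simp) 0
    have h2 := iteratedDeriv_relHeight hu (hZ i) hY x ξ 1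
    rw [iteratedDeriv_one] at h2 ⊢
    have h3 := ((hasDerivAt_heatCDF _).comp 0 hw'.hasDerivAt).deriv
    simp only [comp_def] at h3
    rw [h3, h2]
    simp only [relHeight, hY.apply_zero, (hZ i).apply_zero, zero_mul, diffQuot_zero,
      iterate_one, dirDeriv_mk_one (Z i) ξ, (hZ i).dirDeriv_one_zero, ← hp]
    rw [mul_comm p ξ]
    norm_num
    ring
  simp only [hd] at h1
  have h4 : ∀ i, ∫ ξ, ((iteratedDeriv 2 u x / 2) * (ξ ^ (0 + 2) * heat (p * ξ))
        + (dirDeriv (0, 1) (Z i) (x, 0) - dirDeriv (0, 1) Y (x, 0)) * (ξ ^ 0 * heat (p * ξ)))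
        ∂heatMeasure = A * (graphCurv u x + dirDeriv (0, 1) (Z i) (x, 0)
          - dirDeriv (0, 1) Y (x, 0)) := fun i => by
    rw [integral_add ((hi _).const_mul _) ((hi _).const_mul _), integral_const_mul,
      integral_const_mul, integral_pow_mul_heat, ← hA, graphCurv, ← hp]
    have : (1 + p ^ 2) ≠ 0 := by positivity
    field_simp
    push_cast
    ring
  simp only [h4] at h1
  have h5 : A * (∑ i, c i * (graphCurv u x + dirDeriv (0, 1) (Z i) (x, 0)
      - dirDeriv (0, 1) Y (x, 0))) = 0 := by
    refine Eq.trans ?_ h1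
    rw [Finset.mul_sum]
    exact Finset.sum_congr rfl fun i _ => by ring
  have h6 := (mul_eq_zero.1 h5).resolve_left hApos.ne'
  simp only [mul_sub, mul_add, Finset.sum_sub_distrib, Finset.sum_add_distrib, ← Finset.sum_mul,
    hc] at h6
  linarith

/-- The third-order coefficient of the level set of the averaged profile. -/
theorem sum_third_coefficients (hu : u.HasTemperateGrowth) (hu0 : deriv u 0 = 0)
    (hZ : ∀ i, IsCorrector (Z i)) (hY : IsCorrector Y)
    (h : ∀ᶠ e in 𝓝 (0 : ℝ), sumProfile u c Z ((0, e), Y (0, e)) = 1 / 2) :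
    ∑ i, c i * (3 * iteratedDeriv 4 u 0
      + 6 * dirDeriv (1, 0) (dirDeriv (1, 0) (dirDeriv (0, 1) (Z i))) (0, 0)
      + dirDeriv (0, 1) (dirDeriv (0, 1) (dirDeriv (0, 1) (Z i))) (0, 0)
      - dirDeriv (0, 1) (dirDeriv (0, 1) (dirDeriv (0, 1) Y)) (0, 0)
      - 1 / 2 * (15 * iteratedDeriv 2 u 0 ^ 3
        + 9 * iteratedDeriv 2 u 0 ^ 2 * (dirDeriv (0, 1) (Z i) (0, 0) - dirDeriv (0, 1) Y (0, 0))
        + 3 * iteratedDeriv 2 u 0 * (dirDeriv (0, 1) (Z i) (0, 0) - dirDeriv (0, 1) Y (0, 0)) ^ 2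
        + (dirDeriv (0, 1) (Z i) (0, 0) - dirDeriv (0, 1) Y (0, 0)) ^ 3)) = 0 := by
  have h1 := sum_integral_iteratedDeriv hu hZ hY h 3 three_ne_zero
  have hd : ∀ i, ∫ ξ, iteratedDeriv 3
      (fun e => heatCDF (relHeight u (Z i) (((0, e), Y (0, e)), ξ))) 0 ∂heatMeasure
      = heat 0 * (3 * iteratedDeriv 4 u 0
      + 6 * dirDeriv (1, 0) (dirDeriv (1, 0) (dirDeriv (0, 1) (Z i))) (0, 0)
      + dirDeriv (0, 1) (dirDeriv (0, 1) (dirDeriv (0, 1) (Z i))) (0, 0)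
      - dirDeriv (0, 1) (dirDeriv (0, 1) (dirDeriv (0, 1) Y)) (0, 0)
      - 1 / 2 * (15 * iteratedDeriv 2 u 0 ^ 3
        + 9 * iteratedDeriv 2 u 0 ^ 2 * (dirDeriv (0, 1) (Z i) (0, 0) - dirDeriv (0, 1) Y (0, 0))
        + 3 * iteratedDeriv 2 u 0 * (dirDeriv (0, 1) (Z i) (0, 0) - dirDeriv (0, 1) Y (0, 0)) ^ 2
        + (dirDeriv (0, 1) (Z i) (0, 0) - dirDeriv (0, 1) Y (0, 0)) ^ 3)) := by
    intro i
    have hξ : ∀ ξ, iteratedDeriv 3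
        (fun e => heatCDF (relHeight u (Z i) (((0, e), Y (0, e)), ξ))) 0
        = heat 0 * (ξ ^ 4 * (iteratedDeriv 4 u 0 / 4) + (dirDeriv (ξ, 1))^[3] (Z i) (0, 0)
            - dirDeriv (0, 1) (dirDeriv (0, 1) (dirDeriv (0, 1) Y)) (0, 0)
          - 1 / 2 * (ξ ^ 2 * (iteratedDeriv 2 u 0 / 2)
            + (dirDeriv (0, 1) (Z i) (0, 0) - dirDeriv (0, 1) Y (0, 0))) ^ 3) := fun ξ => by
      have hw : ContDiff ℝ ∞ (fun e => relHeight u (Z i) (((0, e), Y (0, e)), ξ)) :=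
        (hasTemperateGrowth_relHeight_graph hu (hZ i) hY 0).1.comp
          (by fun_prop : ContDiff ℝ ∞ fun e : ℝ => (e, ξ))
      have h2 := iteratedDeriv_relHeight hu (hZ i) hY 0 ξ 1
      rw [iteratedDeriv_one] at h2
      rw [iteratedDeriv_three_heatCDF_comp hw, iteratedDeriv_relHeight hu (hZ i) hY 0 ξ 3, h2]
      · simp only [iterate_one, dirDeriv_mk_one (Z i) ξ, (hZ i).dirDeriv_one_zero]
        simp only [iterate_succ_apply, iterate_zero_apply]
        norm_num
        left
        ring
      · simp [relHeight, hY.apply_zero, (hZ i).apply_zero, diffQuot_zero, hu0]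
    simp only [hξ, dirDeriv_iterate_three (hZ i).smooth]
    rw [integral_const_mul]
    congr 1
    set s := iteratedDeriv 2 u 0
    set d := dirDeriv (0, 1) (Z i) (0, 0) - dirDeriv (0, 1) Y (0, 0)
    set b := dirDeriv (0, 1) (dirDeriv (0, 1) (dirDeriv (0, 1) (Z i))) (0, 0)
    set b' := dirDeriv (0, 1) (dirDeriv (0, 1) (dirDeriv (0, 1) Y)) (0, 0)
    set a := dirDeriv (1, 0) (dirDeriv (1, 0) (dirDeriv (0, 1) (Z i))) (0, 0)
    set k1 := dirDeriv (1, 0) (dirDeriv (0, 1) (dirDeriv (0, 1) (Z i))) (0, 0)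
    set k3 := dirDeriv (1, 0) (dirDeriv (1, 0) (dirDeriv (1, 0) (Z i))) (0, 0)
    -- Coefficients of the powers of ξ after expanding the directional derivative and the cube. The
    -- odd powers, which carry Z_xεε and Z_xxx, integrate to zero, so only Z_xxε and Z_εεε survive.
    have := integral_polynomial_heatMeasure (b - b' - 1 / 2 * d ^ 3) (3 * k1)
      (3 * a - 3 / 4 * s * d ^ 2) k3 (iteratedDeriv 4 u 0 / 4 - 3 / 8 * s ^ 2 * d)
      (-1 / 16 * s ^ 3)
    trans
    · refine Eq.trans ?_ this
      congr 1
      ext ξ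
      ring
    · ring
  simp only [hd] at h1
  have h5 := h1
  simp only [mul_left_comm _ (heat 0) _] at h5
  rw [← Finset.mul_sum] at h5
  exact (mul_eq_zero.1 h5).resolve_left (heat_pos 0).ne'

end Coefficients

/-! ### Taylor expansion of odd functions and the curvature of a graph. -/

section Taylor

theorem ContDiff.taylor_isBigO {φ : ℝ → ℝ} (hφ : ContDiff ℝ ∞ φ) (n : ℕ) :
    (fun e => φ e - ∑ k ∈ Finset.range n, iteratedDeriv k φ 0 / k.factorial * e ^ k)
      =O[𝓝 0] fun e => e ^ n := by
  have h1 := (taylor_isLittleO_univ (x₀ := 0) (hφ.of_le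
    (WithTop.coe_le_coe.2 le_top : (n : WithTop ℕ∞) ≤ ∞))).isBigO
  have h2 : (fun e : ℝ => iteratedDeriv n φ 0 / n.factorial * e ^ n) =O[𝓝 0] fun e => e ^ n :=
    (isBigO_refl _ _).const_mul_left _
  simp only [sub_zero] at h1
  refine (h1.add h2).congr_left fun e => ?_
  simp only [taylor_within_apply, iteratedDerivWithin_univ, sub_zero, smul_eq_mul,
    Finset.sum_range_succ]
  rw [Finset.sum_congr rfl fun k _ => show ((k.factorial : ℝ)⁻¹ * e ^ k) * iteratedDeriv k φ 0
    = iteratedDeriv k φ 0 / k.factorial * e ^ k by ring]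
  ring

theorem iteratedDeriv_even_eq_zero {φ : ℝ → ℝ} (h : ∀ e, φ (-e) = -φ e) (k : ℕ) :
    iteratedDeriv (2 * k) φ 0 = 0 := by
  have h1 := iteratedDeriv_comp_neg (2 * k) φ 0
  simp only [h, neg_zero, iteratedDeriv_fun_neg, even_two_mul, Even.neg_pow, one_pow,
    one_smul] at h1
  linarith

theorem odd_taylor_three {φ : ℝ → ℝ} (hφ : ContDiff ℝ ∞ φ) (h : ∀ e, φ (-e) = -φ e) :
    (fun e => φ e - deriv φ 0 * e) =O[𝓝 0] fun e => e ^ 3 := by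
  refine (hφ.taylor_isBigO 3).congr_left fun e => ?_
  have h0 := iteratedDeriv_even_eq_zero h 0
  have h1 := iteratedDeriv_even_eq_zero h 1
  simp only [mul_zero, mul_one] at h0 h1
  simp [Finset.sum_range_succ, h1, -iteratedDeriv_zero, h0]

theorem odd_taylor_five {φ : ℝ → ℝ} (hφ : ContDiff ℝ ∞ φ) (h : ∀ e, φ (-e) = -φ e) :
    (fun e => φ e - (deriv φ 0 * e + iteratedDeriv 3 φ 0 / 6 * e ^ 3)) =O[𝓝 0] fun e => e ^ 5 := by
  refine (hφ.taylor_isBigO 5).congr_left fun e => ?_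
  have h0 := iteratedDeriv_even_eq_zero h 0
  have h1 := iteratedDeriv_even_eq_zero h 1
  have h2 := iteratedDeriv_even_eq_zero h 2
  norm_num at h1 h2
  simp only [mul_zero] at h0
  simp [Finset.sum_range_succ, h1, h2, -iteratedDeriv_zero, h0, Nat.factorial]

end Taylor

section GraphCurv

variable {u : ℝ → ℝ}

theorem ContDiff.iteratedDeriv_infty (hu : ContDiff ℝ ∞ u) (n : ℕ) :
    ContDiff ℝ ∞ (iteratedDeriv n u) := by
  induction n with
  | zero => simpa using hu
  | succ n ih => rw [iteratedDeriv_succ]; exact (contDiff_infty_iff_deriv.1 ih).2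

theorem hasDerivAt_iteratedDeriv (hu : ContDiff ℝ ∞ u) (n : ℕ) (x : ℝ) :
    HasDerivAt (iteratedDeriv n u) (iteratedDeriv (n + 1) u x) x := by
  rw [iteratedDeriv_succ]
  exact ((hu.iteratedDeriv_infty n).differentiable (by simp) x).hasDerivAt

/-- Quotient rule at a point of zero slope. The same number governs both the spatial second
derivative of a stage at order t and the second time derivative of the exact motion. -/
theorem iteratedDeriv_two_graphCurv (hu : ContDiff ℝ ∞ u) (hu0 : deriv u 0 = 0) :
    iteratedDeriv 2 (graphCurv u) 0 = iteratedDeriv 4 u 0 - 2 * iteratedDeriv 2 u 0 ^ 3 := by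
  have h1 : ∀ x, HasDerivAt (deriv u) (iteratedDeriv 2 u x) x := fun x => by
    simpa using hasDerivAt_iteratedDeriv hu 1 x
  have h2 : ∀ x, HasDerivAt (fun x => 1 + deriv u x ^ 2) (2 * deriv u x * iteratedDeriv 2 u x) x :=
    fun x => by simpa using ((h1 x).fun_pow 2).const_add 1
  have hp : ∀ x, 1 + deriv u x ^ 2 ≠ 0 := fun x => by positivity
  have h3 : deriv (graphCurv u) = fun x => (iteratedDeriv 3 u x * (1 + deriv u x ^ 2)
      - iteratedDeriv 2 u x * (2 * deriv u x * iteratedDeriv 2 u x)) / (1 + deriv u x ^ 2) ^ 2 :=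
    funext fun x => ((hasDerivAt_iteratedDeriv hu 2 x).fun_div (h2 x) (hp x)).deriv
  rw [iteratedDeriv_succ, iteratedDeriv_one, h3]
  have h4 := (((hasDerivAt_iteratedDeriv hu 3 0).fun_mul (h2 0)).fun_sub
    ((hasDerivAt_iteratedDeriv hu 2 0).fun_mul (((h1 0).const_mul 2).fun_mul
      (hasDerivAt_iteratedDeriv hu 2 0)))).fun_div ((h2 0).fun_pow 2) (pow_ne_zero 2 (hp 0))
  rw [h4.deriv]
  simp [hu0]
  ring

end GraphCurv

/-! ### The recursion for the expansion coefficients. -/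

section Recursion

variable {u : ℝ → ℝ}

/-- The corrector `Y` has first-order coefficient `b₁` times the curvature near the origin, and
third-order coefficient `b` at the origin. -/
structure HasCoefficients (u : ℝ → ℝ) (Y : ℝ × ℝ → ℝ) (b₁ b : ℝ) : Prop where
  first : ∀ᶠ x in 𝓝 (0 : ℝ), dirDeriv (0, 1) Y (x, 0) = b₁ * graphCurv u x
  third : dirDeriv (0, 1) (dirDeriv (0, 1) (dirDeriv (0, 1) Y)) (0, 0) = 6 * b

theorem HasCoefficients.zero : HasCoefficients u (fun _ => 0) 0 0 := by
  have h : ∀ v, dirDeriv v (fun _ => 0) = fun _ => 0 := fun v => by ext; simp [dirDeriv]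
  constructor <;> simp [h]

/-- The derivative Y_xxε is obtained by differentiating the first-order coefficient twice along ε =
0; this is why that coefficient is recorded on a neighbourhood of 0 and not only at 0. -/
theorem HasCoefficients.second {Y : ℝ × ℝ → ℝ} {b₁ b : ℝ} (h : HasCoefficients u Y b₁ b)
    (hY : IsCorrector Y) (hu : ContDiff ℝ ∞ u) (hu0 : deriv u 0 = 0) :
    dirDeriv (1, 0) (dirDeriv (1, 0) (dirDeriv (0, 1) Y)) (0, 0)
      = b₁ * (iteratedDeriv 4 u 0 - 2 * iteratedDeriv 2 u 0 ^ 3) := by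
  have h1 := iteratedDeriv_comp_line (hY.smooth.dirDeriv (0, 1)) (0, 0) (1, 0) 2 0
  simp only [Prod.smul_mk, smul_eq_mul, mul_one, mul_zero, Prod.mk_add_mk, add_zero, zero_add,
    iterate_succ_apply, iterate_zero_apply] at h1
  have h2 : (fun x => dirDeriv (0, 1) Y (x, 0)) =ᶠ[𝓝 0] fun x => b₁ * graphCurv u x := h.first
  rw [← h1, (h2.iteratedDeriv 2).self_of_nhds, iteratedDeriv_const_mul_field,
    iteratedDeriv_two_graphCurv hu hu0]

variable {ι : Type*} [Fintype ι] {c : ι → ℝ} {Z : ι → ℝ × ℝ → ℝ} {Y : ℝ × ℝ → ℝ} {b₁ b : ℝ}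

/-- The known coefficients are substituted in `sum_third_coefficients`, with Y_ε(0, 0) = (1 + Σ c β)
u''(0), and the result is solved for Y_εεε. The sums of c β and c (2β) stand where `beta4` and
`beta5` appear in the definitions. -/
theorem HasCoefficients.step (hu : u.HasTemperateGrowth) (hu0 : deriv u 0 = 0)
    (hZ : ∀ i, IsCorrector (Z i)) (hY : IsCorrector Y) (hc : ∑ i, c i = 1)
    (h : ∀ᶠ q in 𝓝 (0 : ℝ × ℝ), sumProfile u c Z (q, Y q) = 1 / 2) {β b₂ b₃ : ι → ℝ}
    (hβ : ∀ i, HasCoefficients u (Z i) (β i)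
      (b₂ i * iteratedDeriv 4 u 0 - b₃ i * iteratedDeriv 2 u 0 ^ 3)) :
    HasCoefficients u Y (1 + ∑ i, c i * β i)
      ((1 / 2 + ∑ i, c i * b₂ i + ∑ i, c i * β i) * iteratedDeriv 4 u 0
        - (2 / 3 + 1 / 6 * (∑ i, c i * β i) ^ 3 - 1 / 4 * (∑ i, c i * β i) * (∑ i, c i * β i ^ 2)
          + 1 / 12 * ∑ i, c i * β i ^ 3 + ∑ i, c i * b₃ i + ∑ i, c i * (2 * β i))
          * iteratedDeriv 2 u 0 ^ 3) := by
  have hline : ∀ᶠ x in 𝓝 (0 : ℝ), ∀ᶠ e in 𝓝 (0 : ℝ),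
      sumProfile u c Z ((x, e), Y (x, e)) = 1 / 2 := by
    have h1 : Tendsto (fun x : ℝ => ((x, 0) : ℝ × ℝ)) (𝓝 0) (𝓝 0) :=
      (by fun_prop : Continuous fun x : ℝ => ((x, 0) : ℝ × ℝ)).tendsto 0
    filter_upwards [h1.eventually h.eventually_nhds] with x hx
    have h2 : Tendsto (fun e : ℝ => ((x, e) : ℝ × ℝ)) (𝓝 0) (𝓝 (x, 0)) :=
      (by fun_prop : Continuous fun e : ℝ => ((x, e) : ℝ × ℝ)).tendsto 0
    exact h2.eventually hx
  have hfirst : ∀ᶠ x in 𝓝 (0 : ℝ),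
      dirDeriv (0, 1) Y (x, 0) = (1 + ∑ i, c i * β i) * graphCurv u x := by
    filter_upwards [hline, eventually_all.2 fun i => (hβ i).first] with x hx hi
    rw [dirDeriv_corrector_eq hu hZ hY hc hx]
    simp only [hi, add_mul, one_mul, Finset.sum_mul, mul_assoc]
  refine ⟨hfirst, ?_⟩
  have h3 := sum_third_coefficients hu hu0 hZ hY hline.self_of_nhds
  have hg : graphCurv u 0 = iteratedDeriv 2 u 0 := by simp [graphCurv, hu0]
  simp only [(hβ _).second (hZ _) hu.1 hu0, (hβ _).third, (hβ _).first.self_of_nhds,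
    hfirst.self_of_nhds, hg] at h3
  set S := ∑ i, c i * β i
  set s := iteratedDeriv 2 u 0
  set f4 := iteratedDeriv 4 u 0
  set b := dirDeriv (0, 1) (dirDeriv (0, 1) (dirDeriv (0, 1) Y)) (0, 0)
  -- Each summand is sorted by powers of β i, so that summation produces the weighted sums of 1, β,
  -- β² and β³ separately.
  have hexp : ∀ i, c i * (3 * f4 + 6 * (β i * (f4 - 2 * s ^ 3)) + 6 * (b₂ i * f4 - b₃ i * s ^ 3) - b
      - 1 / 2 * (15 * s ^ 3 + 9 * s ^ 2 * (β i * s - (1 + S) * s)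
        + 3 * s * (β i * s - (1 + S) * s) ^ 2 + (β i * s - (1 + S) * s) ^ 3))
      = (3 * f4 - b - 1 / 2 * s ^ 3 * (15 - 9 * (1 + S) + 3 * (1 + S) ^ 2 - (1 + S) ^ 3)) * c i
        + (6 * (f4 - 2 * s ^ 3) - 1 / 2 * s ^ 3 * (9 - 6 * (1 + S) + 3 * (1 + S) ^ 2)) * (c i * β i)
        - 1 / 2 * s ^ 3 * (3 - 3 * (1 + S)) * (c i * β i ^ 2) - 1 / 2 * s ^ 3 * (c i * β i ^ 3)
        + 6 * f4 * (c i * b₂ i) - 6 * s ^ 3 * (c i * b₃ i) := fun i => by ring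
  simp only [hexp, Finset.sum_add_distrib, Finset.sum_sub_distrib, ← Finset.mul_sum, hc] at h3
  have h6 : ∑ i, c i * (2 * β i) = 2 * S := by
    simp only [S, Finset.mul_sum]
    exact Finset.sum_congr rfl fun i _ => by ring
  rw [h6]
  change (_ * _ + _ * S - _ - _ + _ - _ : ℝ) = 0 at h3
  linear_combination -h3

/-- The expansion at the origin of `ε Y(0, ε)`. -/
theorem HasCoefficients.expansion (h : HasCoefficients u Y b₁ b) (hY : IsCorrector Y)
    (hu0 : deriv u 0 = 0) :
    (fun e => e * Y (0, e) - (e ^ 2 * b₁ * iteratedDeriv 2 u 0 + e ^ 4 * b)) =O[𝓝 0]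
      fun e : ℝ => e ^ 6 := by
  have hc : ContDiff ℝ ∞ fun e => Y (0, e) := hY.smooth.comp (contDiff_const.prodMk contDiff_id)
  have hit : ∀ n, iteratedDeriv n (fun e => Y (0, e)) 0 = (dirDeriv (0, 1))^[n] Y (0, 0) := fun n => by
    simpa using iteratedDeriv_comp_line hY.smooth (0, 0) (0, 1) n 0
  have h5 := odd_taylor_five hc (hY.odd 0)
  rw [← iteratedDeriv_one, hit, hit] at h5
  simp only [iterate_succ_apply, iterate_zero_apply, h.third, h.first.self_of_nhds] at h5
  refine (((isBigO_refl (fun e : ℝ => e) (𝓝 0)).mul h5).congr_left fun e => ?_).congr_right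
    fun e => ?_
  · simp [graphCurv, hu0]; ring
  · ring

/-- The expansion at the origin of `ε ∂²Y/∂x²(0, ε)`. -/
theorem HasCoefficients.expansion_snd (h : HasCoefficients u Y b₁ b) (hY : IsCorrector Y)
    (hu : ContDiff ℝ ∞ u) (hu0 : deriv u 0 = 0) :
    (fun e => e * dirDeriv (1, 0) (dirDeriv (1, 0) Y) (0, e)
      - e ^ 2 * (b₁ * (iteratedDeriv 4 u 0 - 2 * iteratedDeriv 2 u 0 ^ 3))) =O[𝓝 0]
      fun e : ℝ => e ^ 4 := by
  have hxx := (hY.smooth.dirDeriv (1, 0)).dirDeriv (1, 0)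
  have hc : ContDiff ℝ ∞ fun e => dirDeriv (1, 0) (dirDeriv (1, 0) Y) (0, e) :=
    hxx.comp (contDiff_const.prodMk contDiff_id)
  have hodd : ∀ e, dirDeriv (1, 0) (dirDeriv (1, 0) Y) (0, -e)
      = -dirDeriv (1, 0) (dirDeriv (1, 0) Y) (0, e) := fun e => by
    have h1 := fun e => iteratedDeriv_comp_line hY.smooth (0, e) (1, 0) 2 0
    simp only [Prod.smul_mk, smul_eq_mul, mul_one, mul_zero, Prod.mk_add_mk, add_zero, zero_add,
      iterate_succ_apply, iterate_zero_apply] at h1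
    rw [← h1, ← h1]
    simp only [hY.odd, iteratedDeriv_fun_neg]
  have h5 := odd_taylor_three hc hodd
  have hd : deriv (fun e => dirDeriv (1, 0) (dirDeriv (1, 0) Y) (0, e)) 0
      = b₁ * (iteratedDeriv 4 u 0 - 2 * iteratedDeriv 2 u 0 ^ 3) := by
    have h1 := (hasDerivAt_comp_line hxx (0, 0) (0, 1) 0).deriv
    simp only [Prod.smul_mk, smul_eq_mul, mul_one, mul_zero, Prod.mk_add_mk, add_zero,
      zero_add] at h1
    rw [h1, dirDeriv_comm (hY.smooth.dirDeriv _), dirDeriv_comm hY.smooth (0, 1),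
      h.second hY hu hu0]
  rw [hd] at h5
  refine (((isBigO_refl (fun e : ℝ => e) (𝓝 0)).mul h5).congr_left fun e => ?_).congr_right
    fun e => ?_ <;> ring

end Recursion

section Beta

variable (γ : ℕ → ℕ → ℝ)

/-- The two recursions coincide. Analytically, Y_xxε is β₁ times the second derivative of the
curvature, which leaves no freedom for separate constants. -/
theorem beta4_eq_beta1 (m : ℕ) : beta4 γ m = beta1 γ m := by
  induction m using Nat.strong_induction_on with
  | _ m ih =>
    cases m with
    | zero => simp [beta4, beta1]
    | succ m =>
      rw [beta4, beta1]
      congr 1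
      exact Finset.sum_congr rfl fun i _ => by rw [ih i i.2]

theorem beta5_eq_two_mul_beta1 (m : ℕ) : beta5 γ m = 2 * beta1 γ m := by
  induction m using Nat.strong_induction_on with
  | _ m ih =>
    cases m with
    | zero => simp [beta5, beta1]
    | succ m =>
      rw [beta5, beta1, mul_add, mul_one, Finset.mul_sum]
      congr 1
      exact Finset.sum_congr rfl fun i _ => by rw [ih i i.2]; ring

end Beta

/-! ### Convolution of bounded functions with Schwartz kernels. -/

section Smear

theorem SchwartzMap.exists_decay {E F : Type*} [NormedAddCommGroup E] [NormedSpace ℝ E]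
    [NormedAddCommGroup F] [NormedSpace ℝ F] (K : SchwartzMap E F) (N : ℕ) :
    ∃ C, 0 ≤ C ∧ ∀ x, ‖K x‖ ≤ C * ((1 + ‖x‖) ^ N)⁻¹ := by
  refine ⟨2 ^ N * ((Finset.Iic (N, 0)).sup fun m => SchwartzMap.seminorm ℝ m.1 m.2) K,
    by positivity, fun x => ?_⟩
  have := SchwartzMap.one_add_le_sup_seminorm_apply (𝕜 := ℝ) (m := (N, 0)) le_rfl le_rfl K x
  rw [norm_iteratedFDeriv_zero] at this
  rw [← div_eq_mul_inv, le_div_iff₀ (by positivity)]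
  linarith

variable {E : Type} [NormedAddCommGroup E] [NormedSpace ℝ E] [MeasurableSpace E] [BorelSpace E]
  [FiniteDimensional ℝ E] {μ : Measure E} [μ.IsAddHaarMeasure]
  {F : Type} [NormedAddCommGroup F] [NormedSpace ℝ F]

/-- The convolution of a bounded function with a Schwartz function. -/
noncomputable def smear (μ : Measure E) (K : SchwartzMap E F) (d : E → ℝ) (p : E) : F :=
  ∫ q, d q • K (p - q) ∂μ

theorem integrable_one_add_norm_inv_pow (μ : Measure E) [μ.IsAddHaarMeasure] :
    Integrable (fun x : E => ((1 + ‖x‖) ^ (Module.finrank ℝ E + 1))⁻¹) μ := by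
  have := integrable_one_add_norm (μ := μ) (E := E) (r := (Module.finrank ℝ E + 1 : ℕ))
    (by push_cast; linarith)
  refine this.congr (ae_of_all _ fun x => ?_)
  simp only
  rw [Real.rpow_neg (by positivity), Real.rpow_natCast]

theorem integrable_smear_bound (μ : Measure E) [μ.IsAddHaarMeasure] (p : E) :
    Integrable (fun q : E => ((1 + ‖p - q‖) ^ (Module.finrank ℝ E + 1))⁻¹) μ :=
  (integrable_one_add_norm_inv_pow μ).comp_sub_left p

variable {d : E → ℝ} {B : ℝ}

theorem aestronglyMeasurable_smear {μ : Measure E} (K : SchwartzMap E F) (hd : Measurable d) (p : E) :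
    AEStronglyMeasurable (fun q => d q • K (p - q)) μ :=
  hd.aestronglyMeasurable.smul
    (K.continuous.comp (continuous_const.sub continuous_id)).aestronglyMeasurable

theorem integrable_smear (K : SchwartzMap E F) (hd : Measurable d) (hB : ∀ q, |d q| ≤ B) (p : E) :
    Integrable (fun q => d q • K (p - q)) μ := by
  obtain ⟨C, hC, h⟩ := K.exists_decay (Module.finrank ℝ E + 1)
  have hB0 : 0 ≤ B := (abs_nonneg _).trans (hB 0)
  refine ((integrable_smear_bound μ p).const_mul (B * C)).mono' (aestronglyMeasurable_smear K hd p)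
    (ae_of_all _ fun q => ?_)
  rw [norm_smul, Real.norm_eq_abs, mul_assoc]
  exact mul_le_mul (hB q) (h _) (norm_nonneg _) hB0

theorem hasFDerivAt_smear (K : SchwartzMap E F) (hd : Measurable d) (hB : ∀ q, |d q| ≤ B) (p : E) :
    HasFDerivAt (smear μ K d) (smear μ (SchwartzMap.fderivCLM ℝ E F K) d p) p := by
  obtain ⟨C, hC, h⟩ := (SchwartzMap.fderivCLM ℝ E F K).exists_decay (Module.finrank ℝ E + 1)
  have hB0 : 0 ≤ B := (abs_nonneg _).trans (hB 0)
  refine hasFDerivAt_integral_of_dominated_of_fderiv_le (s := Metric.ball p 1)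
    (bound := fun q => B * (C * 2 ^ (Module.finrank ℝ E + 1)) *
      ((1 + ‖p - q‖) ^ (Module.finrank ℝ E + 1))⁻¹)
    (F' := fun p q => d q • (SchwartzMap.fderivCLM ℝ E F K) (p - q))
    (Metric.ball_mem_nhds p one_pos)
    (Eventually.of_forall fun p => aestronglyMeasurable_smear K hd p) (integrable_smear K hd hB p)
    (aestronglyMeasurable_smear _ hd p) (ae_of_all _ fun q x hx => ?_)
    ((integrable_smear_bound μ p).const_mul _) (ae_of_all _ fun q x _ => ?_)
  · rw [norm_smul, Real.norm_eq_abs, mul_assoc]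
    refine mul_le_mul (hB q) ((h _).trans ?_) (norm_nonneg _) hB0
    rw [mul_assoc]
    gcongr
    rw [← div_eq_mul_inv, inv_le_comm₀ (by positivity) (by positivity), inv_div, ← div_pow]
    gcongr
    have h1 : ‖p - q‖ ≤ ‖x - q‖ + ‖x - p‖ := by
      have := norm_sub_le (x - q) (x - p)
      rwa [show x - q - (x - p) = p - q by abel] at this
    have h2 : ‖x - p‖ < 1 := by simpa [dist_eq_norm] using hx
    have := norm_nonneg (x - q)
    linarith
  · have h1 : HasFDerivAt (fun x => K (x - q)) (fderiv ℝ K (x - q)) x := by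
      have := (K.differentiableAt (x := x - q)).hasFDerivAt.comp x
        ((hasFDerivAt_id x).sub_const q)
      simpa [comp_def] using this
    simpa using h1.fun_const_smul (d q)

theorem fderiv_smear (K : SchwartzMap E F) (hd : Measurable d) (hB : ∀ q, |d q| ≤ B) :
    fderiv ℝ (smear μ K d) = smear μ (SchwartzMap.fderivCLM ℝ E F K) d :=
  funext fun p => (hasFDerivAt_smear K hd hB p).fderiv

/-- All derivatives fall on the kernel, which remains Schwartz; d need only be measurable and
bounded. -/
theorem contDiff_smear (K : SchwartzMap E F) (hd : Measurable d) (hB : ∀ q, |d q| ≤ B) :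
    ContDiff ℝ ∞ (smear μ K d) := by
  refine contDiff_infty.2 fun n => ?_
  induction n generalizing F with
  | zero => exact contDiff_zero.2 (continuous_iff_continuousAt.2 fun p =>
      (hasFDerivAt_smear K hd hB p).continuousAt)
  | succ n ih =>
    push_cast
    refine contDiff_succ_iff_fderiv.2 ⟨fun p => (hasFDerivAt_smear K hd hB p).differentiableAt,
      by simp, ?_⟩
    rw [fderiv_smear K hd hB]
    exact ih _

/-- The convolution near the origin of a function that is small on a large ball. -/
theorem exists_norm_iteratedFDeriv_smear_le (K : SchwartzMap E F) (n N : ℕ) :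
    ∃ C, 0 ≤ C ∧ ∀ (d : E → ℝ) (B R : ℝ), Measurable d → (∀ q, |d q| ≤ B) → 0 < R →
      ∀ p, ‖p‖ ≤ R → ‖iteratedFDeriv ℝ n (smear μ K d) p‖
        ≤ C * ((∫ q in Metric.ball 0 (2 * R), |d q| ∂μ) + B * (R ^ N)⁻¹) := by
  induction n generalizing F with
  | succ n ih =>
    obtain ⟨C, hC, h⟩ := ih (SchwartzMap.fderivCLM ℝ E F K)
    refine ⟨C, hC, fun d B R hd hB hR p hp => ?_⟩
    rw [← norm_iteratedFDeriv_fderiv, fderiv_smear K hd hB]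
    exact h d B R hd hB hR p hp
  | zero =>
    obtain ⟨C₀, hC₀, h₀⟩ := K.exists_decay 0
    obtain ⟨C₁, hC₁, h₁⟩ := K.exists_decay (N + (Module.finrank ℝ E + 1))
    set I := ∫ x : E, ((1 + ‖x‖) ^ (Module.finrank ℝ E + 1))⁻¹ ∂μ
    have hI : 0 ≤ I := integral_nonneg fun x => by positivity
    refine ⟨C₀ + C₁ * I, by positivity, fun d B R hd hB hR p hp => ?_⟩
    have hB0 : 0 ≤ B := (abs_nonneg _).trans (hB 0)
    have hdi : IntegrableOn (fun q => |d q|) (Metric.ball 0 (2 * R)) μ := by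
      refine Measure.integrableOn_of_bounded measure_ball_lt_top.ne
        (hd.abs.aestronglyMeasurable) (M := B) (ae_of_all _ fun q => ?_)
      simpa using hB q
    have hpt : ∀ q, ‖d q • K (p - q)‖ ≤ C₀ * (Metric.ball (0 : E) (2 * R)).indicator (fun q => |d q|) q
        + B * (R ^ N)⁻¹ * C₁ * ((1 + ‖p - q‖) ^ (Module.finrank ℝ E + 1))⁻¹ := fun q => by
      rw [norm_smul, Real.norm_eq_abs]
      -- Inside the large ball only boundedness of K is used. Outside it p and q are at least R
      -- apart, so N powers of the decay yield R^(-N) and the remaining ones keep the integral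
      -- finite.
      by_cases hq : q ∈ Metric.ball (0 : E) (2 * R)
      · rw [Set.indicator_of_mem hq]
        have : |d q| * ‖K (p - q)‖ ≤ |d q| * C₀ := by
          gcongr
          simpa using h₀ (p - q)
        have h2 : 0 ≤ B * (R ^ N)⁻¹ * C₁ * ((1 + ‖p - q‖) ^ (Module.finrank ℝ E + 1))⁻¹ := by
          positivity
        linarith
      · rw [Set.indicator_of_notMem hq, mul_zero, zero_add]
        have h2 : R ≤ 1 + ‖p - q‖ := by
          have h3 : 2 * R ≤ ‖q‖ := by simpa using hq
          have h4 := norm_sub_norm_le q p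
          rw [norm_sub_rev] at h4
          linarith
        calc |d q| * ‖K (p - q)‖
            ≤ B * (C₁ * ((1 + ‖p - q‖) ^ (N + (Module.finrank ℝ E + 1)))⁻¹) := by
              gcongr
              · exact hB q
              · exact h₁ _
          _ = B * C₁ * ((1 + ‖p - q‖) ^ N)⁻¹ * ((1 + ‖p - q‖) ^ (Module.finrank ℝ E + 1))⁻¹ := by
              rw [pow_add, mul_inv]; ring
          _ ≤ B * C₁ * (R ^ N)⁻¹ * ((1 + ‖p - q‖) ^ (Module.finrank ℝ E + 1))⁻¹ := by
              gcongr
          _ = _ := by ring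
    rw [norm_iteratedFDeriv_zero]
    refine (norm_integral_le_of_norm_le (Integrable.add ((hdi.integrable_indicator
      measurableSet_ball).const_mul C₀) ((integrable_smear_bound μ p).const_mul _))
      (ae_of_all _ hpt)).trans ?_
    have e1 : ∫ q, ((1 + ‖p - q‖) ^ (Module.finrank ℝ E + 1))⁻¹ ∂μ = I :=
      integral_sub_left_eq_self (fun x => ((1 + ‖x‖) ^ (Module.finrank ℝ E + 1))⁻¹) μ p
    rw [integral_add' ((hdi.integrable_indicator measurableSet_ball).const_mul C₀)
      ((integrable_smear_bound μ p).const_mul _), integral_const_mul, integral_const_mul,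
      integral_indicator measurableSet_ball, e1]
    set D := ∫ q in Metric.ball 0 (2 * R), |d q| ∂μ
    have hD : 0 ≤ D := integral_nonneg fun q => abs_nonneg _
    have h5 : 0 ≤ C₁ * I * D := by positivity
    have h6 : 0 ≤ C₀ * (B * (R ^ N)⁻¹) := by positivity
    linarith

end Smear

/-! ### Rescaling of the planar convolution and its reduction to the profile. -/

section Plane

/-- The two-dimensional heat kernel at time `1`. -/
noncomputable def planeHeat : SchwartzMap (ℝ × ℝ) ℝ :=
  (1 / (4 * Real.pi)) • expNegSchwartz (fun p : ℝ × ℝ => 1 / 4 * (p.1 ^ 2 + p.2 ^ 2)) (by fun_prop)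
    (c := 1 / 4) (by norm_num) fun p => by
      have h1 : ‖p‖ ^ 2 ≤ p.1 ^ 2 + p.2 ^ 2 := by
        rcases max_choice ‖p.1‖ ‖p.2‖ with h | h <;> rw [Prod.norm_def, h] <;>
          simp <;> positivity
      linarith

theorem planeHeat_apply (p : ℝ × ℝ) :
    planeHeat p = 1 / (4 * Real.pi) * Real.exp (-(1 / 4 * (p.1 ^ 2 + p.2 ^ 2))) := rfl

theorem planeHeat_eq (p : ℝ × ℝ) : planeHeat p = heat p.1 * heat p.2 := by
  have h : Real.sqrt (4 * Real.pi) * Real.sqrt (4 * Real.pi) = 4 * Real.pi :=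
    Real.mul_self_sqrt (by positivity)
  rw [planeHeat_apply]
  unfold heat
  rw [mul_mul_mul_comm, ← Real.exp_add, one_div_mul_one_div, h]
  congr 2
  ring

/-- Substituting ε q for the integration variable brings a Jacobian ε², which cancels the prefactor
of the kernel at time ε². -/
theorem convolution_gaussKernel {ε : ℝ} (hε : 0 < ε) (s : ℝ × ℝ → ℝ) (p : ℝ × ℝ) :
    convolution (gaussKernel (ε ^ 2)) s (ContinuousLinearMap.mul ℝ ℝ) volume p
      = smear volume planeHeat (fun q => s (ε • q)) (ε⁻¹ • p) := by
  have h1 : ∫ t, gaussKernel (ε ^ 2) t * s (p - t) = ∫ t, gaussKernel (ε ^ 2) (p - t) * s t := by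
    rw [← integral_sub_left_eq_self (fun t => gaussKernel (ε ^ 2) (p - t) * s t) volume p]
    simp
  have h2 := Measure.integral_comp_smul (μ := (volume : Measure (ℝ × ℝ)))
    (fun t => gaussKernel (ε ^ 2) (p - t) * s t) ε
  have h3 : ∀ q : ℝ × ℝ, gaussKernel (ε ^ 2) (p - ε • q)
      = (ε ^ 2)⁻¹ * planeHeat (ε⁻¹ • p - q) := fun q => by
    rw [planeHeat_apply]
    simp only [gaussKernel, Prod.fst_sub, Prod.snd_sub, Prod.smul_fst, Prod.smul_snd, smul_eq_mul]
    rw [← mul_assoc]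
    congr 1
    · field_simp
    · congr 1
      field_simp
  have h4 : Module.finrank ℝ (ℝ × ℝ) = 2 := by simp
  simp only [convolution, ContinuousLinearMap.mul_apply', smear, smul_eq_mul]
  rw [h1]
  simp only [h3, h4, mul_assoc, integral_const_mul, smul_eq_mul] at h2
  rw [abs_of_nonneg (by positivity)] at h2
  have h5 := mul_left_cancel₀ (by positivity) h2
  rw [← h5]
  simp only [mul_comm]

/-- The averaged indicator of the region below a graph is the profile. -/
theorem smear_subgraph {u : ℝ → ℝ} (hu : u.HasTemperateGrowth) {Z : ℝ × ℝ → ℝ}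
    (hZ : Z.HasTemperateGrowth)
    {ε : ℝ} (hε : 0 < ε) (x z : ℝ) :
    smear volume planeHeat (fun q => (subgraph fun a => u a + ε * Z (a, ε)).indicator
        (fun _ => (1 : ℝ)) (ε • q)) (ε⁻¹ * x, ε⁻¹ * u x + z) = profile u Z ((x, ε), z) := by
  set P : ℝ × ℝ := (ε⁻¹ * x, ε⁻¹ * u x + z) with hP
  set w : ℝ → ℝ := fun ξ => relHeight u Z (((x, ε), z), ξ) with hw
  -- Centred at P and measured in units of ε, the region becomes the set below the relative height,
  -- so the vertical integral is a value of `heatCDF`.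
  have hmem : ∀ ζ : ℝ × ℝ, ε • (P + ζ) ∈ (subgraph fun a => u a + ε * Z (a, ε)) ↔
      ζ.2 ≤ w ζ.1 := fun ζ => by
    have h1 := mul_diffQuot hu.1 x (ε * ζ.1)
    have h2 : ε * (ε⁻¹ * x + ζ.1) = x + ε * ζ.1 := by field_simp
    have h3 : ε * (ε⁻¹ * u x + z + ζ.2) = u x + ε * z + ε * ζ.2 := by field_simp
    simp only [subgraph, Set.mem_ofPred_eq, hP, hw, relHeight, Prod.smul_fst, Prod.smul_snd,
      Prod.fst_add, Prod.snd_add, smul_eq_mul, h2, h3]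
    have h4 : u (x + ε * ζ.1) = u x + ε * ζ.1 * diffQuot u (x, ε * ζ.1) := by linarith
    rw [h4]
    constructor
    · intro h
      have : ε * ζ.2 ≤ ε * (ζ.1 * diffQuot u (x, ε * ζ.1) + Z (x + ε * ζ.1, ε) - z) := by linarith
      exact le_of_mul_le_mul_left this hε
    · intro h
      have := mul_le_mul_of_nonneg_left h hε.le
      linarith
  have hwc : Continuous w :=
    (hasTemperateGrowth_relHeight hu hZ).1.continuous.comp (by fun_prop)
  have h1 : smear volume planeHeat (fun q => (subgraph fun a => u a + ε * Z (a, ε)).indicator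
        (fun _ => (1 : ℝ)) (ε • q)) P
      = ∫ ζ : ℝ × ℝ, heat ζ.1 * (Set.Iic (w ζ.1)).indicator heat ζ.2 := by
    rw [smear, ← integral_add_left_eq_self _ P]
    congr 1
    ext ζ
    rw [planeHeat_eq]
    by_cases h : ζ.2 ≤ w ζ.1
    · rw [Set.indicator_of_mem ((hmem ζ).2 h), Set.indicator_of_mem (by simpa using h)]
      simp [heat_neg]
    · rw [Set.indicator_of_notMem (fun h' => h ((hmem ζ).1 h')),
        Set.indicator_of_notMem (by simpa using h)]
      simp
  have hint : Integrable (fun ζ : ℝ × ℝ => heat ζ.1 * (Set.Iic (w ζ.1)).indicator heat ζ.2)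
      (volume.prod volume) := by
    refine (integrable_heat.mul_prod integrable_heat).mono' ?_ (ae_of_all _ fun ζ => ?_)
    · refine AEStronglyMeasurable.mul ?_ ?_
      · exact (continuous_heat.comp continuous_fst).aestronglyMeasurable
      · have : (fun ζ : ℝ × ℝ => (Set.Iic (w ζ.1)).indicator heat ζ.2)
            = {ζ : ℝ × ℝ | ζ.2 ≤ w ζ.1}.indicator fun ζ => heat ζ.2 := by
          ext ζ; simp [Set.indicator_apply]
        rw [this]
        exact ((continuous_heat.comp continuous_snd).aestronglyMeasurable).indicator
          (isClosed_le continuous_snd (hwc.comp continuous_fst)).measurableSet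
    · rw [norm_mul, Real.norm_of_nonneg (heat_pos _).le]
      refine mul_le_mul_of_nonneg_left ?_ (heat_pos _).le
      refine (norm_indicator_le_norm_self _ _).trans ?_
      rw [Real.norm_of_nonneg (heat_pos _).le]
  rw [h1, Measure.volume_eq_prod, integral_prod _ hint, profile, integral_heatMeasure]
  congr 1
  ext ξ
  simp only
  rw [integral_const_mul, integral_indicator measurableSet_Iic, heatCDF_eq_integral]

end Plane

/-! ### Errors from replacing the stages by exact regions. -/

section Approx

/-- The region below the graph of `u + ε Z(·, ε)`. -/
def region (u : ℝ → ℝ) (Z : ℝ × ℝ → ℝ) (ε : ℝ) : Set (ℝ × ℝ) :=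
  subgraph fun x => u x + ε * Z (x, ε)

/-- Near the origin, the sets `S ε` agree with the regions below the graphs of `u + ε Z(·, ε)` up
to sets whose area is smaller than any power of `ε`. -/
structure IsApprox (u : ℝ → ℝ) (Z : ℝ × ℝ → ℝ) (S : ℝ → Set (ℝ × ℝ)) : Prop where
  meas : ∀ ε, 0 < ε → MeasurableSet (S ε)
  close : ∃ ρ > 0, ∀ N : ℕ, ∀ᶠ ε in 𝓝[>] (0 : ℝ),
    volume.real (symmDiff (S ε) (region u Z ε) ∩ Metric.ball 0 ρ) ≤ ε ^ N

theorem measurableSet_region {u : ℝ → ℝ} (hu : Continuous u) {Z : ℝ × ℝ → ℝ} (hZ : Continuous Z)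
    (ε : ℝ) : MeasurableSet (region u Z ε) := by
  have h : Continuous fun p : ℝ × ℝ => u p.1 + ε * Z (p.1, ε) := by fun_prop
  exact (isClosed_le continuous_snd h).measurableSet

variable {ι : Type*} [Fintype ι]

/-- The weighted sum of indicators of rescaled sets. -/
noncomputable def weight (c : ι → ℝ) (T : ι → Set (ℝ × ℝ)) (ε : ℝ) (q : ℝ × ℝ) : ℝ :=
  ∑ i, c i * (T i).indicator (fun _ => (1 : ℝ)) (ε • q)

theorem measurable_weight {c : ι → ℝ} {T : ι → Set (ℝ × ℝ)} (hT : ∀ i, MeasurableSet (T i))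
    (ε : ℝ) : Measurable (weight c T ε) :=
  Finset.measurable_fun_sum _ fun i _ =>
    (((measurable_const.indicator (hT i)).comp (measurable_const_smul ε)).const_mul (c i))

theorem abs_weight_le (c : ι → ℝ) (T : ι → Set (ℝ × ℝ)) (ε : ℝ) (q : ℝ × ℝ) :
    |weight c T ε q| ≤ ∑ i, |c i| := by
  refine (Finset.abs_sum_le_sum_abs _ _).trans (Finset.sum_le_sum fun i _ => ?_)
  rw [abs_mul]
  refine mul_le_of_le_one_right (abs_nonneg _) ?_
  by_cases h : ε • q ∈ T i <;> simp [h]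

/-- The convolution error made when the sets `S i` are replaced by the regions below graphs, at
the point `(x, u x + ε z)`. -/
noncomputable def smearError (u : ℝ → ℝ) (c : ι → ℝ) (Z : ι → ℝ × ℝ → ℝ)
    (S : ι → ℝ → Set (ℝ × ℝ)) (ε : ℝ) (P : (ℝ × ℝ) × ℝ) : ℝ :=
  smear volume planeHeat
    (fun q => weight c (fun i => S i ε) ε q - weight c (fun i => region u (Z i) ε) ε q)
    (ε⁻¹ * P.1.1, ε⁻¹ * u P.1.1 + P.2)

variable {u : ℝ → ℝ} {c : ι → ℝ} {Z : ι → ℝ × ℝ → ℝ} {S : ι → ℝ → Set (ℝ × ℝ)}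

theorem smear_weight_eq (hu : u.HasTemperateGrowth) (hZ : ∀ i, IsCorrector (Z i))
    {ε : ℝ} (hε : 0 < ε) (hS : ∀ i, MeasurableSet (S i ε)) (x z : ℝ) :
    smear volume planeHeat (weight c (fun i => S i ε) ε) (ε⁻¹ * x, ε⁻¹ * u x + z)
      = sumProfile u c Z ((x, ε), z) + smearError u c Z S ε ((x, ε), z) := by
  have hR : ∀ i, MeasurableSet (region u (Z i) ε) := fun i =>
    measurableSet_region hu.1.continuous (hZ i).smooth.continuous ε
  have i1 := integrable_smear (μ := (volume : Measure (ℝ × ℝ))) planeHeat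
    (measurable_weight (c := c) hS ε) (abs_weight_le c _ ε) (ε⁻¹ * x, ε⁻¹ * u x + z)
  have i2 := integrable_smear (μ := (volume : Measure (ℝ × ℝ))) planeHeat
    (measurable_weight (c := c) hR ε) (abs_weight_le c _ ε) (ε⁻¹ * x, ε⁻¹ * u x + z)
  have h1 : sumProfile u c Z ((x, ε), z) = smear volume planeHeat
      (weight c (fun i => region u (Z i) ε) ε) (ε⁻¹ * x, ε⁻¹ * u x + z) := by
    simp only [sumProfile, ← smear_subgraph hu (hZ _).hasTemperateGrowth hε]
    simp only [smear, weight, Finset.sum_smul]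
    rw [integral_finsetSum]
    · refine Finset.sum_congr rfl fun i _ => ?_
      rw [← integral_const_mul]
      congr 1
      ext q
      simp only [smul_eq_mul, mul_assoc]
      rfl
    · intro i _
      refine integrable_smear planeHeat (d := fun q => c i * (region u (Z i) ε).indicator
        (fun _ => (1 : ℝ)) (ε • q)) (B := |c i|) ?_ ?_ _
      · exact ((measurable_const.indicator (hR i)).comp (measurable_const_smul ε)).const_mul (c i)
      · intro q
        rw [abs_mul]
        refine mul_le_of_le_one_right (abs_nonneg _) ?_
        by_cases h : ε • q ∈ region u (Z i) ε <;> simp [h]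
  rw [h1, smearError]
  simp only [smear, sub_smul]
  rw [integral_sub i1 i2]
  ring

theorem contDiff_smearError (hu : u.HasTemperateGrowth) (hZ : ∀ i, IsCorrector (Z i)) {ε : ℝ}
    (hS : ∀ i, MeasurableSet (S i ε)) : ContDiff ℝ ∞ (smearError u c Z S ε) := by
  have hR : ∀ i, MeasurableSet (region u (Z i) ε) := fun i =>
    measurableSet_region hu.1.continuous (hZ i).smooth.continuous ε
  have h1 : ContDiff ℝ ∞ fun P : (ℝ × ℝ) × ℝ => (ε⁻¹ * P.1.1, ε⁻¹ * u P.1.1 + P.2) := by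
    have := hu.1
    fun_prop
  refine (contDiff_smear (μ := volume) planeHeat (B := ∑ i, |c i| + ∑ i, |c i|)
    ((measurable_weight hS ε).sub (measurable_weight hR ε)) fun q => ?_).comp h1
  exact (abs_sub _ _).trans (add_le_add (abs_weight_le _ _ _ _) (abs_weight_le _ _ _ _))

/-- The closeness of finitely many families of sets on a common ball, in rescaled variables. -/
theorem exists_integral_weight_sub_le (hu : u.HasTemperateGrowth) (hZ : ∀ i, IsCorrector (Z i))
    (hS : ∀ i, IsApprox u (Z i) (S i)) :
    ∃ ρ > 0, ∀ N : ℕ, ∀ᶠ ε in 𝓝[>] (0 : ℝ),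
      ∫ q in Metric.ball 0 (ρ / ε), |weight c (fun i => S i ε) ε q
        - weight c (fun i => region u (Z i) ε) ε q| ≤ (∑ i, |c i|) * ε ^ N := by
  choose ρ hρ hclose using fun i => (hS i).close
  obtain ⟨r, hr, hrρ⟩ : ∃ r > 0, ∀ i, r ≤ ρ i := by
    cases isEmpty_or_nonempty ι
    · exact ⟨1, one_pos, fun i => isEmptyElim i⟩
    · obtain ⟨j, hj⟩ := Finite.exists_min ρ
      exact ⟨ρ j, hρ j, hj⟩
  refine ⟨r, hr, fun N => ?_⟩
  -- Two extra powers pay for the rescaling, which multiplies areas by ε^(-2).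
  filter_upwards [self_mem_nhdsWithin, eventually_all.2 fun i => hclose i (N + 2)] with ε hε hi
  replace hε : 0 < ε := hε
  have hR : ∀ i, MeasurableSet (region u (Z i) ε) := fun i =>
    measurableSet_region hu.1.continuous (hZ i).smooth.continuous ε
  have hT : ∀ i, MeasurableSet (symmDiff (S i ε) (region u (Z i) ε) ∩ Metric.ball 0 (ρ i)) :=
    fun i => (((hS i).meas ε hε).symmDiff (hR i)).inter measurableSet_ball
  have hfin : ∀ i, volume (symmDiff (S i ε) (region u (Z i) ε) ∩ Metric.ball 0 (ρ i)) ≠ ⊤ :=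
    fun i => ((measure_mono Set.inter_subset_right).trans_lt measure_ball_lt_top).ne
  set T := fun i => symmDiff (S i ε) (region u (Z i) ε) ∩ Metric.ball 0 (ρ i) with hTdef
  have hTi : ∀ i, Integrable ((T i).indicator fun _ => (1 : ℝ)) := fun i =>
    (integrable_indicator_iff (hT i)).2 (integrableOn_const (hfin i))
  have hscaled : ∀ i, Integrable (fun q => (T i).indicator (fun _ => (1 : ℝ)) (ε • q)) := fun i =>
    (integrable_comp_smul_iff volume _ hε.ne').2 (hTi i)
  have hval : ∀ i, ∫ q, (T i).indicator (fun _ => (1 : ℝ)) (ε • q) ≤ ε ^ N := fun i => by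
    rw [Measure.integral_comp_smul, integral_indicator (hT i)]
    have h4 : Module.finrank ℝ (ℝ × ℝ) = 2 := by simp
    rw [h4, abs_of_nonneg (by positivity)]
    simp only [integral_const, smul_eq_mul, mul_one, measureReal_restrict_apply_univ]
    refine (mul_le_mul_of_nonneg_left (hi i) (by positivity)).trans_eq ?_
    field_simp
    ring
  have hpt : ∀ q ∈ Metric.ball (0 : ℝ × ℝ) (r / ε), |weight c (fun i => S i ε) ε q
      - weight c (fun i => region u (Z i) ε) ε q|
      ≤ ∑ i, |c i| * (T i).indicator (fun _ => (1 : ℝ)) (ε • q) := fun q hq => by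
    have hq' : ∀ i, ε • q ∈ Metric.ball (0 : ℝ × ℝ) (ρ i) := fun i => by
      rw [mem_ball_zero_iff, lt_div_iff₀ hε] at hq
      rw [mem_ball_zero_iff, norm_smul, Real.norm_of_nonneg hε.le]
      linarith [hrρ i]
    simp only [weight]
    rw [← Finset.sum_sub_distrib]
    refine (Finset.abs_sum_le_sum_abs _ _).trans (Finset.sum_le_sum fun i _ => ?_)
    rw [← mul_sub, abs_mul]
    refine mul_le_mul_of_nonneg_left ?_ (abs_nonneg _)
    have hmem : ε • q ∈ T i ↔ ε • q ∈ symmDiff (S i ε) (region u (Z i) ε) :=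
      ⟨fun h => h.1, fun h => ⟨h, hq' i⟩⟩
    by_cases h1 : ε • q ∈ S i ε <;> by_cases h2 : ε • q ∈ region u (Z i) ε <;>
      simp [hmem, Set.mem_symmDiff, h1, h2]
  have hsumi : Integrable fun q => ∑ i, |c i| * (T i).indicator (fun _ => (1 : ℝ)) (ε • q) :=
    integrable_finsetSum _ fun i _ => (hscaled i).const_mul _
  calc _ ≤ ∫ q in Metric.ball 0 (r / ε), ∑ i, |c i| * (T i).indicator (fun _ => (1 : ℝ)) (ε • q) := by
        refine setIntegral_mono_on ?_ hsumi.integrableOn measurableSet_ball hpt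
        refine Measure.integrableOn_of_bounded measure_ball_lt_top.ne
          ((measurable_weight (fun i => (hS i).meas ε hε) ε).sub
            (measurable_weight hR ε)).abs.aestronglyMeasurable
          (M := ∑ i, |c i| + ∑ i, |c i|) (ae_of_all _ fun q => ?_)
        rw [Real.norm_eq_abs, abs_abs]
        exact (abs_sub _ _).trans (add_le_add (abs_weight_le _ _ _ _) (abs_weight_le _ _ _ _))
    _ ≤ ∫ q, ∑ i, |c i| * (T i).indicator (fun _ => (1 : ℝ)) (ε • q) := by
        refine setIntegral_le_integral hsumi (ae_of_all _ fun q => ?_)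
        exact Finset.sum_nonneg fun i _ => mul_nonneg (abs_nonneg _)
          (Set.indicator_nonneg (fun _ _ => zero_le_one) _)
    _ = ∑ i, |c i| * ∫ q, (T i).indicator (fun _ => (1 : ℝ)) (ε • q) := by
        rw [integral_finsetSum _ fun i _ => (hscaled i).const_mul _]
        simp only [integral_const_mul]
    _ ≤ _ := by
        rw [Finset.sum_mul]
        exact Finset.sum_le_sum fun i _ => mul_le_mul_of_nonneg_left (hval i) (abs_nonneg _)

end Approx

section Error

/-- One spare power of ε absorbs any constant, so later bounds of arbitrary order can be stated
without constants. -/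
theorem eventually_mul_pow_succ_le (C : ℝ) (N : ℕ) :
    ∀ᶠ ε in 𝓝[>] (0 : ℝ), C * ε ^ (N + 1) ≤ ε ^ N := by
  have h : Tendsto (fun ε : ℝ => C * ε) (𝓝[>] 0) (𝓝 0) :=
    ((by fun_prop : Continuous fun ε : ℝ => C * ε).tendsto' 0 0 (by simp)).mono_left
      nhdsWithin_le_nhds
  filter_upwards [h.eventually_le_const zero_lt_one, self_mem_nhdsWithin] with ε h1 h2
  have h3 : 0 ≤ ε ^ N := pow_nonneg (le_of_lt h2) N
  calc C * ε ^ (N + 1) = C * ε * ε ^ N := by ring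
    _ ≤ 1 * ε ^ N := by gcongr
    _ = ε ^ N := one_mul _

variable {ι : Type*} [Fintype ι] {u : ℝ → ℝ} {c : ι → ℝ} {Z : ι → ℝ × ℝ → ℝ}
  {S : ι → ℝ → Set (ℝ × ℝ)}

theorem measurable_weight_sub (hu : Continuous u) (hZ : ∀ i, IsCorrector (Z i)) {ε : ℝ}
    (hS : ∀ i, MeasurableSet (S i ε)) :
    Measurable fun q => weight c (fun i => S i ε) ε q - weight c (fun i => region u (Z i) ε) ε q :=
  (measurable_weight hS ε).sub (measurable_weight
    (fun i => measurableSet_region hu (hZ i).smooth.continuous ε) ε)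

theorem abs_weight_sub_le (c : ι → ℝ) (S T : ι → Set (ℝ × ℝ)) (ε : ℝ) (q : ℝ × ℝ) :
    |weight c S ε q - weight c T ε q| ≤ ∑ i, |c i| + ∑ i, |c i| :=
  (abs_sub _ _).trans (add_le_add (abs_weight_le _ _ _ _) (abs_weight_le _ _ _ _))

/-- In rescaled variables the sets agree up to small mass on a ball of radius ρ/ε. Beyond it, the
decay of the kernel at distances of order 1/ε is again a high power of ε. -/
theorem exists_iteratedFDeriv_smear_le_pow (hu : u.HasTemperateGrowth)
    (hZ : ∀ i, IsCorrector (Z i)) (hS : ∀ i, IsApprox u (Z i) (S i)) :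
    ∃ ρ > 0, ∀ k N : ℕ, ∀ᶠ ε in 𝓝[>] (0 : ℝ), ∀ p : ℝ × ℝ, ‖p‖ ≤ ρ / ε →
      ‖iteratedFDeriv ℝ k (smear volume planeHeat (fun q => weight c (fun i => S i ε) ε q
        - weight c (fun i => region u (Z i) ε) ε q)) p‖ ≤ ε ^ N := by
  obtain ⟨ρ, hρ, h⟩ := exists_integral_weight_sub_le (c := c) hu hZ hS
  refine ⟨ρ / 2, by positivity, fun k N => ?_⟩
  obtain ⟨C, hC, hsm⟩ := exists_norm_iteratedFDeriv_smear_le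
    (μ := (volume : Measure (ℝ × ℝ))) planeHeat k (N + 1)
  set B := ∑ i, |c i| with hB
  filter_upwards [self_mem_nhdsWithin, h (N + 1), eventually_mul_pow_succ_le
    (C * (B + (B + B) * ((ρ / 2) ^ (N + 1))⁻¹)) N] with ε hε h1 h2 p hp
  replace hε : 0 < ε := hε
  refine (hsm _ (B + B) (ρ / 2 / ε) (measurable_weight_sub hu.1.continuous hZ
    fun i => (hS i).meas ε hε) (abs_weight_sub_le c _ _ ε) (by positivity) p hp).trans ?_
  refine le_trans ?_ h2
  rw [show 2 * (ρ / 2 / ε) = ρ / ε by ring, mul_assoc]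
  refine mul_le_mul_of_nonneg_left ?_ hC
  have e1 : (B + B) * ((ρ / 2 / ε) ^ (N + 1))⁻¹
      = (B + B) * ((ρ / 2) ^ (N + 1))⁻¹ * ε ^ (N + 1) := by
    rw [div_pow (ρ / 2) ε, inv_div]
    ring
  rw [e1]
  linarith

/-- Two regimes are needed. The bound without derivatives covers a whole square, where z may be of
size 1/ε, and decides membership far from the interface; the derivative bounds are for bounded z,
where the interface lies. -/
theorem exists_abs_smearError_le (hu : u.HasTemperateGrowth) (hu0 : u 0 = 0)
    (hZ : ∀ i, IsCorrector (Z i)) (hS : ∀ i, IsApprox u (Z i) (S i)) :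
    ∃ ρ > 0, (∀ N : ℕ, ∀ᶠ ε in 𝓝[>] (0 : ℝ), ∀ x z : ℝ, |x| ≤ ρ → |u x + ε * z| ≤ ρ →
        |smearError u c Z S ε ((x, ε), z)| ≤ ε ^ N) ∧
      ∀ (k N : ℕ) (L : ℝ), ∀ᶠ ε in 𝓝[>] (0 : ℝ), ∀ x z : ℝ, |x| ≤ ρ → |z| ≤ L →
        ‖iteratedFDeriv ℝ k (smearError u c Z S ε) ((x, ε), z)‖ ≤ ε ^ N := by
  obtain ⟨ρ, hρ, h⟩ := exists_iteratedFDeriv_smear_le_pow (c := c) hu hZ hS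
  have huc : ∀ᶠ x in 𝓝 (0 : ℝ), |u x| < ρ / 2 := by
    have : Continuous fun x => |u x| := hu.1.continuous.abs
    refine this.continuousAt.eventually_lt_const ?_
    simpa [hu0] using hρ
  obtain ⟨r, hr, hur⟩ := Metric.eventually_nhds_iff.1 huc
  have hnorm : ∀ ε > 0, ∀ x z : ℝ, |x| ≤ ρ → |u x + ε * z| ≤ ρ →
      ‖(ε⁻¹ * x, ε⁻¹ * u x + z)‖ ≤ ρ / ε := fun ε hε x z hx hz => by
    rw [Prod.norm_def, max_le_iff]
    have e1 : ε⁻¹ * u x + z = ε⁻¹ * (u x + ε * z) := by field_simp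
    constructor
    · simp only [Real.norm_eq_abs, abs_mul, abs_inv, abs_of_pos hε]
      rw [inv_mul_le_iff₀ hε]
      field_simp
      exact hx
    · simp only [e1, Real.norm_eq_abs, abs_mul, abs_inv, abs_of_pos hε]
      rw [inv_mul_le_iff₀ hε]
      field_simp
      exact hz
  refine ⟨min ρ (r / 2), by positivity, fun N => ?_, fun k N L => ?_⟩
  · filter_upwards [h 0 N, self_mem_nhdsWithin] with ε h1 hε x z hx hz
    have := h1 _ (hnorm ε hε x z (hx.trans (min_le_left _ _)) (hz.trans (min_le_left _ _)))
    rwa [norm_iteratedFDeriv_zero] at this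
  · have hA1 : ContDiff ℝ ∞ fun P : (ℝ × ℝ) × ℝ => (P.1.1, u P.1.1) := by
      have := hu.1
      fun_prop
    have hA2 : ContDiff ℝ ∞ fun P : (ℝ × ℝ) × ℝ => ((0 : ℝ), P.2) := by fun_prop
    set A1 := fun P : (ℝ × ℝ) × ℝ => (P.1.1, u P.1.1) with hA1'
    set A2 := fun P : (ℝ × ℝ) × ℝ => ((0 : ℝ), P.2) with hA2'
    have hcpt : IsCompact (Metric.closedBall (0 : (ℝ × ℝ) × ℝ) (max (max ρ 1) L)) :=
      isCompact_closedBall _ _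
    have hbd : ∀ i : ℕ, ∃ C, ∀ P ∈ Metric.closedBall (0 : (ℝ × ℝ) × ℝ) (max (max ρ 1) L),
        ‖iteratedFDeriv ℝ i A1 P‖ + ‖iteratedFDeriv ℝ i A2 P‖ ≤ C := fun i => by
      have hc : Continuous fun P => ‖iteratedFDeriv ℝ i A1 P‖ + ‖iteratedFDeriv ℝ i A2 P‖ :=
        (hA1.continuous_iteratedFDeriv (WithTop.coe_le_coe.2 le_top)).norm.add
          (hA2.continuous_iteratedFDeriv (WithTop.coe_le_coe.2 le_top)).norm
      obtain ⟨C, hC⟩ := hcpt.bddAbove_image hc.continuousOn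
      exact ⟨C, fun P hP => hC (Set.mem_image_of_mem _ hP)⟩
    choose C hC using hbd
    set D := 1 + ∑ i ∈ Finset.range (k + 1), |C i| with hD
    have hD1 : 1 ≤ D := le_add_of_nonneg_right (Finset.sum_nonneg fun i _ => abs_nonneg _)
    have hCD : ∀ i ≤ k, C i ≤ D := fun i hi => by
      have := Finset.single_le_sum (f := fun i => |C i|) (fun i _ => abs_nonneg _)
        (Finset.mem_range.2 (Nat.lt_succ_of_le hi))
      linarith [le_abs_self (C i)]
    have hsmall : ∀ᶠ ε in 𝓝[>] (0 : ℝ), ε * L ≤ ρ / 2 := by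
      have h : Tendsto (fun ε : ℝ => ε * L) (𝓝[>] 0) (𝓝 0) :=
        ((by fun_prop : Continuous fun ε : ℝ => ε * L).tendsto' 0 0 (by simp)).mono_left
          nhdsWithin_le_nhds
      exact h.eventually_le_const (by positivity)
    have hone : ∀ᶠ ε in 𝓝[>] (0 : ℝ), ε < 1 :=
      mem_nhdsWithin_of_mem_nhds (Iio_mem_nhds zero_lt_one)
    -- The chain rule through the rescaled coordinates costs at most (D/ε)^k; the exponent N + 1 + k
    -- pays for it and leaves one power for the constants.
    filter_upwards [eventually_all_finite (Finset.range (k + 1)).finite_toSet |>.2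
      fun i _ => h i (N + 1 + k), self_mem_nhdsWithin, hsmall, hone,
      eventually_mul_pow_succ_le (k.factorial * D ^ k) N] with ε h1 hε h2 h3 h4 x z hx hz
    replace hε : 0 < ε := hε
    have hux : |u x| < ρ / 2 := by
      refine hur ?_
      rw [Real.dist_eq, sub_zero]
      linarith [hx.trans (min_le_right _ _)]
    have hxz : |u x + ε * z| ≤ ρ := by
      refine (abs_add_le _ _).trans ?_
      rw [abs_mul, abs_of_pos hε]
      have := mul_le_mul_of_nonneg_left hz hε.le
      linarith
    have hmem : ((x, ε), z) ∈ Metric.closedBall (0 : (ℝ × ℝ) × ℝ) (max (max ρ 1) L) := by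
      rw [mem_closedBall_zero_iff, Prod.norm_def, Prod.norm_def]
      simp only [Real.norm_eq_abs, abs_of_pos hε]
      exact max_le ((max_le_max (hx.trans (min_le_left _ _)) h3.le).trans (le_max_left _ _))
        (hz.trans (le_max_right _ _))
    have hscal : ContDiff ℝ ∞ (fun P : (ℝ × ℝ) × ℝ => ε⁻¹ • A1 P + A2 P) := (hA1.const_smul _).add hA2
    have hcomp : smearError u c Z S ε = (smear volume planeHeat (fun q =>
        weight c (fun i => S i ε) ε q - weight c (fun i => region u (Z i) ε) ε q)) ∘
        fun P => ε⁻¹ • A1 P + A2 P := by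
      ext P
      simp [smearError, hA1', hA2']
    rw [hcomp]
    refine (norm_iteratedFDeriv_comp_le (n := k) (contDiff_smear planeHeat
      (measurable_weight_sub hu.1.continuous hZ fun i => (hS i).meas ε hε)
      (abs_weight_sub_le c _ _ ε)) hscal (WithTop.coe_le_coe.2 le_top) _
      (C := ε ^ (N + 1 + k)) (D := D / ε) (fun i hi => ?_) fun i hi1 hi => ?_).trans ?_
    · refine h1 i (Finset.mem_range.2 (Nat.lt_succ_of_le hi)) _ ?_
      have := hnorm ε hε x z (hx.trans (min_le_left _ _)) hxz
      simpa [hA1', hA2'] using this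
    · have e1 : iteratedFDeriv ℝ i (fun P => ε⁻¹ • A1 P + A2 P) ((x, ε), z)
          = ε⁻¹ • iteratedFDeriv ℝ i A1 ((x, ε), z) + iteratedFDeriv ℝ i A2 ((x, ε), z) := by
        have c1 : ContDiffAt ℝ i A1 ((x, ε), z) :=
          hA1.contDiffAt.of_le (WithTop.coe_le_coe.2 le_top)
        have c2 : ContDiffAt ℝ i A2 ((x, ε), z) :=
          hA2.contDiffAt.of_le (WithTop.coe_le_coe.2 le_top)
        exact (iteratedFDeriv_add_apply (c1.const_smul ε⁻¹) c2).trans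
          (congrArg (· + _) (iteratedFDeriv_const_smul_apply' c1))
      rw [e1]
      refine (norm_add_le _ _).trans ?_
      rw [norm_smul, norm_inv, Real.norm_of_nonneg hε.le]
      have h6 : (1 : ℝ) ≤ ε⁻¹ := (one_le_inv₀ hε).2 h3.le
      have h7 := norm_nonneg (iteratedFDeriv ℝ i A2 ((x, ε), z))
      have h8 : 1 ≤ D / ε := by rw [le_div_iff₀ hε]; linarith
      calc _ ≤ ε⁻¹ * ‖iteratedFDeriv ℝ i A1 ((x, ε), z)‖
            + ε⁻¹ * ‖iteratedFDeriv ℝ i A2 ((x, ε), z)‖ := by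
              gcongr
              exact le_mul_of_one_le_left h7 h6
        _ ≤ D / ε := by
            rw [← mul_add, div_eq_inv_mul]
            gcongr
            exact (hC i _ hmem).trans (hCD i hi)
        _ ≤ (D / ε) ^ i := le_self_pow₀ h8 (by omega)
    · refine le_trans (le_of_eq ?_) h4
      rw [pow_add ε (N + 1) k, div_pow]
      field_simp

end Error

/-! ### The averaged profile far from and near the interface. -/

section Far

theorem tendsto_heatCDF_atBot : Tendsto heatCDF atBot (𝓝 0) := ProbabilityTheory.tendsto_cdf_atBot _

theorem monotone_heatCDF : Monotone heatCDF := ProbabilityTheory.monotone_cdf _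

theorem exists_integral_heatCDF_le (a : ℝ) {δ : ℝ} (hδ : 0 < δ) :
    ∃ L > 0, ∫ ξ, heatCDF (a * (1 + |ξ|) - L) ∂heatMeasure ≤ δ := by
  have h : Tendsto (fun L => ∫ ξ, heatCDF (a * (1 + |ξ|) - L) ∂heatMeasure) atTop
      (𝓝 (∫ _, (0 : ℝ) ∂heatMeasure)) := by
    refine tendsto_integral_filter_of_dominated_convergence (fun _ => 1)
      (Eventually.of_forall fun L => ?_) (Eventually.of_forall fun L => ae_of_all _ fun ξ => ?_)
      (integrable_const _) (ae_of_all _ fun ξ => ?_)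
    · exact (hasTemperateGrowth_heatCDF.1.continuous.comp (by fun_prop)).aestronglyMeasurable
    · rw [Real.norm_of_nonneg (heatCDF_nonneg _)]
      exact heatCDF_le_one _
    · refine tendsto_heatCDF_atBot.comp ?_
      exact tendsto_atBot_add_const_left _ _ tendsto_neg_atTop_atBot
  rw [integral_zero] at h
  obtain ⟨L, h1, h2⟩ := ((h.eventually_le_const hδ).and (eventually_gt_atTop 0)).exists
  exact ⟨L, h2, h1⟩

variable {ι : Type*} [Fintype ι] {u : ℝ → ℝ} {c : ι → ℝ} {Z : ι → ℝ × ℝ → ℝ}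

theorem integrable_heatCDF_comp {f : ℝ → ℝ} (hf : Continuous f) :
    Integrable (fun ξ => heatCDF (f ξ)) heatMeasure := by
  refine Integrable.of_bound (hasTemperateGrowth_heatCDF.1.continuous.comp
    hf).aestronglyMeasurable 1 (ae_of_all _ fun ξ => ?_)
  rw [Real.norm_of_nonneg (heatCDF_nonneg _)]
  exact heatCDF_le_one _

/-- With B bounding the slope of u and K all correctors, every relative height is at most (B + K)(1
+ |ξ|) - z, uniformly in (x, ε). Large z is then covered by `exists_integral_heatCDF_le`, and large
negative z by the symmetry `sumProfile_neg`. -/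
theorem exists_sumProfile_far (hu : u.HasTemperateGrowth) {B : ℝ} (hB : ∀ x, |deriv u x| ≤ B)
    (hZ : ∀ i, IsCorrector (Z i)) (hc : ∑ i, c i = 1) {δ : ℝ} (hδ : 0 < δ) :
    ∃ L > 0, ∀ q : ℝ × ℝ, (∀ z ≥ L, sumProfile u c Z (q, z) ≤ δ) ∧
      ∀ z ≤ -L, 1 - δ ≤ sumProfile u c Z (q, z) := by
  have hB0 : 0 ≤ B := (abs_nonneg _).trans (hB 0)
  have hZb : ∀ i, ∃ C, ∀ q, |Z i q| ≤ C := fun i =>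
    (hZ i).smooth.continuous.bounded_above_of_compact_support (hZ i).compact
  choose C hC using hZb
  have hCs : ∀ i q, |Z i q| ≤ ∑ j, |C j| := fun i q => ((hC i q).trans (le_abs_self _)).trans
    (Finset.single_le_sum (f := fun j => |C j|) (fun j _ => abs_nonneg _) (Finset.mem_univ i))
  set K := ∑ j, |C j|
  have hK0 : 0 ≤ K := Finset.sum_nonneg fun i _ => abs_nonneg _
  set A := ∑ i, |c i| with hA
  have hA0 : 0 ≤ A := Finset.sum_nonneg fun i _ => abs_nonneg _
  obtain ⟨L, hL, hint⟩ := exists_integral_heatCDF_le (B + K) (δ := δ / (A + 1)) (by positivity)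
  have hprof : ∀ i (q : ℝ × ℝ), ∀ z ≥ L, |profile u (Z i) (q, z)| ≤ δ / (A + 1) :=
    fun i q z hz => by
    have hr : Continuous fun ξ => relHeight u (Z i) ((q, z), ξ) :=
      (hasTemperateGrowth_relHeight hu (hZ i).hasTemperateGrowth).1.continuous.comp (by fun_prop)
    rw [profile, abs_of_nonneg (integral_nonneg fun ξ => heatCDF_nonneg _)]
    refine le_trans (integral_mono (integrable_heatCDF_comp hr) (integrable_heatCDF_comp
      (by fun_prop)) fun ξ => monotone_heatCDF ?_) hint
    have h1 : ξ * diffQuot u (q.1, q.2 * ξ) ≤ |ξ| * B := by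
      refine (le_abs_self _).trans ?_
      rw [abs_mul]
      exact mul_le_mul_of_nonneg_left (abs_diffQuot_le hB _) (abs_nonneg _)
    have h2 := (le_abs_self _).trans (hCs i (q.1 + q.2 * ξ, q.2))
    have h3 : 0 ≤ K * |ξ| := by positivity
    simp only [relHeight]
    linarith
  have hsum : ∀ (q : ℝ × ℝ), ∀ z ≥ L, sumProfile u c Z (q, z) ≤ δ := fun q z hz => by
    calc sumProfile u c Z (q, z) ≤ ∑ i, |c i| * (δ / (A + 1)) := by
          refine Finset.sum_le_sum fun i _ => (le_abs_self _).trans ?_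
          rw [abs_mul]
          exact mul_le_mul_of_nonneg_left (hprof i q z hz) (abs_nonneg _)
      _ = A * (δ / (A + 1)) := by rw [Finset.sum_mul]
      _ ≤ δ := by
          rw [← mul_div_assoc, div_le_iff₀ (by positivity)]
          nlinarith
  refine ⟨L, hL, fun q => ⟨hsum q, fun z hz => ?_⟩⟩
  have h1 := sumProfile_neg hu hZ hc q.1 q.2 z
  have h2 := hsum (q.1, -q.2) (-z) (by linarith)
  rw [h1] at h2
  linarith

/-- Near the origin the averaged profile is uniformly decreasing on bounded sets. -/
theorem exists_le_sumDensity (hu : u.HasTemperateGrowth) (hu0 : deriv u 0 = 0)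
    (hZ : ∀ i, IsCorrector (Z i)) (hc : ∑ i, c i = 1) (L : ℝ) :
    ∃ κ > 0, ∀ᶠ q in 𝓝 (0 : ℝ × ℝ), ∀ z, |z| ≤ L → κ ≤ sumDensity u c Z (q, z) := by
  have hcont := (hasTemperateGrowth_sumDensity (c := c) hu hZ).1.continuous
  have hcpt : IsCompact (Set.Icc (-L) L) := isCompact_Icc
  obtain ⟨κ, hκ, hκh⟩ : ∃ κ > 0, ∀ z ∈ Set.Icc (-L) L, κ < heat z := by
    rcases (Set.Icc (-L) L).eq_empty_or_nonempty with h | h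
    · exact ⟨1, one_pos, by simp [h]⟩
    · obtain ⟨z₀, -, hz₀⟩ := hcpt.exists_isMinOn h continuous_heat.continuousOn
      exact ⟨heat z₀ / 2, half_pos (heat_pos _), fun z hz =>
        (half_lt_self (heat_pos _)).trans_le (hz₀ hz)⟩
  refine ⟨κ, hκ, ?_⟩
  have h := hcpt.eventually_forall_of_forall_eventually (x₀ := (0 : ℝ × ℝ))
    (P := fun q z => κ < sumDensity u c Z (q, z)) fun z hz => by
    refine (hcont.continuousAt (x := ((0 : ℝ × ℝ), z))).eventually_const_lt (u := κ) ?_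
    have := sumDensity_zero (c := c) hu0 hZ hc z
    exact (hκh z hz).trans_eq this.symm
  filter_upwards [h] with q hq z hz
  exact (hq z (abs_le.1 hz)).le

end Far

/-! ### Existence and smoothness of the true interface. -/

section Crossing

/-- A function that decreases at a definite rate through the level `1/2`. -/
theorem exists_crossing {V V' : ℝ → ℝ} {L κ : ℝ} (hL : 0 < L) (hκ : 0 < κ)
    (hd : ∀ z, |z| ≤ L → HasDerivAt V (V' z) z) (hd' : ∀ z, |z| ≤ L → V' z ≤ -κ)
    (h1 : V L < 1 / 2) (h2 : 1 / 2 < V (-L)) :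
    ∃ ζ, |ζ| ≤ L ∧ V ζ = 1 / 2 ∧ (∀ z, |z| ≤ L → (1 / 2 ≤ V z ↔ z ≤ ζ)) ∧
      ∀ z, |z| ≤ L → κ * |ζ - z| ≤ |V z - 1 / 2| := by
  have hc : ContinuousOn V (Set.Icc (-L) L) := fun z hz =>
    (hd z (abs_le.2 hz)).continuousAt.continuousWithinAt
  have hmv : ∀ a b, |a| ≤ L → |b| ≤ L → a ≤ b → V b - V a ≤ -κ * (b - a) := fun a b ha hb hab => by
    refine (convex_Icc (-L) L).image_sub_le_mul_sub_of_deriv_le hc (fun z hz => ?_)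
      (fun z hz => ?_) a (abs_le.1 ha) b (abs_le.1 hb) hab
    · exact (hd z (abs_le.2 (interior_subset (s := Set.Icc (-L) L) hz))).differentiableAt.differentiableWithinAt
    · rw [(hd z (abs_le.2 (interior_subset (s := Set.Icc (-L) L) hz))).deriv]
      exact hd' z (abs_le.2 (interior_subset (s := Set.Icc (-L) L) hz))
  obtain ⟨ζ, hζ, hVζ⟩ := intermediate_value_Icc' (by linarith) hc ⟨h1.le, h2.le⟩
  have hζ' : |ζ| ≤ L := abs_le.2 hζ
  have key : ∀ z, |z| ≤ L → (z ≤ ζ → κ * (ζ - z) ≤ V z - 1 / 2) ∧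
      (ζ ≤ z → V z - 1 / 2 ≤ -κ * (z - ζ)) := fun z hz => by
    refine ⟨fun h => ?_, fun h => ?_⟩
    · have := hmv z ζ hz hζ' h
      linarith
    · have := hmv ζ z hζ' hz h
      linarith
  refine ⟨ζ, hζ', hVζ, fun z hz => ⟨fun h => ?_, fun h => ?_⟩, fun z hz => ?_⟩
  · by_contra! h'
    have := (key z hz).2 h'.le
    have : 0 < κ * (z - ζ) := mul_pos hκ (sub_pos.2 h')
    linarith
  · have := (key z hz).1 h
    have : 0 ≤ κ * (ζ - z) := mul_nonneg hκ.le (sub_nonneg.2 h)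
    linarith
  · rcases le_total z ζ with h | h
    · rw [abs_of_nonneg (sub_nonneg.2 h)]
      exact ((key z hz).1 h).trans (le_abs_self _)
    · rw [abs_sub_comm, abs_of_nonneg (sub_nonneg.2 h)]
      have := (key z hz).2 h
      have := neg_le_abs (V z - 1 / 2)
      linarith

variable {ι : Type*} [Fintype ι] {u : ℝ → ℝ} {c : ι → ℝ} {Z : ι → ℝ × ℝ → ℝ}
  {S : ι → ℝ → Set (ℝ × ℝ)}

/-- The superlevel set `1/2` of the smeared weighted indicators, in the original variables. -/
noncomputable def nextSet (c : ι → ℝ) (S : ι → ℝ → Set (ℝ × ℝ)) (ε : ℝ) : Set (ℝ × ℝ) :=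
  {p | 1 / 2 ≤ smear volume planeHeat (weight c (fun i => S i ε) ε) (ε⁻¹ • p)}

/-- The smeared weighted indicators at the point `(x, u x + ε z)`. -/
noncomputable def level (u : ℝ → ℝ) (c : ι → ℝ) (Z : ι → ℝ × ℝ → ℝ) (S : ι → ℝ → Set (ℝ × ℝ))
    (ε : ℝ) (P : (ℝ × ℝ) × ℝ) : ℝ :=
  sumProfile u c Z P + smearError u c Z S ε P

theorem mem_nextSet (hu : u.HasTemperateGrowth) (hZ : ∀ i, IsCorrector (Z i)) {ε : ℝ} (hε : 0 < ε)
    (hS : ∀ i, MeasurableSet (S i ε)) (x z : ℝ) :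
    (x, u x + ε * z) ∈ nextSet c S ε ↔ 1 / 2 ≤ level u c Z S ε ((x, ε), z) := by
  rw [level, ← smear_weight_eq hu hZ hε hS]
  simp only [nextSet, Set.mem_ofPred_eq, Prod.smul_mk, smul_eq_mul, mul_add]
  rw [inv_mul_cancel_left₀ hε.ne']

theorem contDiff_level (hu : u.HasTemperateGrowth) (hZ : ∀ i, IsCorrector (Z i)) {ε : ℝ}
    (hS : ∀ i, MeasurableSet (S i ε)) : ContDiff ℝ ∞ (level u c Z S ε) :=
  (hasTemperateGrowth_sumProfile hu hZ).1.add (contDiff_smearError hu hZ hS)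

theorem hasDerivAt_level (hu : u.HasTemperateGrowth) (hZ : ∀ i, IsCorrector (Z i)) {ε : ℝ}
    (hS : ∀ i, MeasurableSet (S i ε)) (q : ℝ × ℝ) (z : ℝ) :
    HasDerivAt (fun z => level u c Z S ε (q, z))
      (-sumDensity u c Z (q, z) + fderiv ℝ (smearError u c Z S ε) (q, z) (0, 1)) z := by
  have h1 := ((contDiff_smearError (u := u) (c := c) (Z := Z) (S := S) hu hZ hS).differentiable
    (by simp) (q, z)).hasFDerivAt.comp_hasDerivAt z ((hasDerivAt_const z q).prodMk (hasDerivAt_id z))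
  exact (hasDerivAt_sumProfile hu hZ q z).fun_add h1

theorem measurableSet_nextSet {ε : ℝ} (hS : ∀ i, MeasurableSet (S i ε)) :
    MeasurableSet (nextSet c S ε) := by
  have h : Continuous (smear volume planeHeat (weight c (fun i => S i ε) ε)) :=
    (contDiff_smear planeHeat (measurable_weight hS ε) (abs_weight_le c _ ε)).continuous
  exact (isClosed_le continuous_const (h.comp (continuous_const_smul ε⁻¹))).measurableSet

theorem eventually_le_nhdsGT {f : ℝ → ℝ} (hf : ContinuousAt f 0) {a : ℝ} (h : f 0 < a) :
    ∀ᶠ ε in 𝓝[>] (0 : ℝ), f ε ≤ a :=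
  (hf.eventually_lt_const h).filter_mono nhdsWithin_le_nhds |>.mono fun _ h => h.le

/-- For |z| ≤ L the level decreases at a definite rate and crosses 1/2 once. For larger |z| inside
the square the profile is within 1/4 of 0 or 1 and the error is at most 1/8, so no further crossing
occurs. The last inequality is transversality in quantitative form; it turns errors in level into
errors in height. -/
theorem exists_interface (hu : u.HasTemperateGrowth) (hu0 : u 0 = 0) (hu1 : deriv u 0 = 0)
    {B : ℝ} (hB : ∀ x, |deriv u x| ≤ B) (hZ : ∀ i, IsCorrector (Z i)) (hc : ∑ i, c i = 1)
    (hS : ∀ i, IsApprox u (Z i) (S i)) :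
    ∃ r > 0, ∃ L > 0, ∃ κ > 0, ∃ ζ : ℝ → ℝ → ℝ, ∀ᶠ ε in 𝓝[>] (0 : ℝ), ∀ x, |x| < r →
      |ζ ε x| ≤ L ∧ level u c Z S ε ((x, ε), ζ ε x) = 1 / 2 ∧ ContDiffAt ℝ ∞ (ζ ε) x ∧
      (∀ y, |y| < r → ((x, y) ∈ nextSet c S ε ↔ y ≤ u x + ε * ζ ε x)) ∧
      ∀ z, |z| ≤ L → κ * |ζ ε x - z| ≤ |level u c Z S ε ((x, ε), z) - 1 / 2| := by
  obtain ⟨ρ, hρ, herr0, herr⟩ := exists_abs_smearError_le (c := c) hu hu0 hZ hS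
  obtain ⟨L, hL, hfar⟩ := exists_sumProfile_far hu hB hZ hc (δ := 1 / 4) (by norm_num)
  obtain ⟨κ, hκ, hnear⟩ := exists_le_sumDensity hu hu1 hZ hc L
  obtain ⟨r₁, hr₁, hnear⟩ := Metric.eventually_nhds_iff.1 hnear
  have huc : ∀ᶠ x in 𝓝 (0 : ℝ), |u x| < ρ / 2 := by
    refine hu.1.continuous.abs.continuousAt.eventually_lt_const ?_
    simpa [hu0] using hρ
  obtain ⟨r₂, hr₂, hur⟩ := Metric.eventually_nhds_iff.1 huc
  set r := min ρ (min r₁ r₂) with hr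
  have hr0 : 0 < r := by positivity
  have main : ∀ᶠ ε in 𝓝[>] (0 : ℝ), 0 < ε ∧ ∀ x, |x| < r → ∃ ζ, |ζ| ≤ L ∧
      level u c Z S ε ((x, ε), ζ) = 1 / 2 ∧
      (∀ y, |y| < r → ((x, y) ∈ nextSet c S ε ↔ y ≤ u x + ε * ζ)) ∧
      ∀ z, |z| ≤ L → κ / 2 * |ζ - z| ≤ |level u c Z S ε ((x, ε), z) - 1 / 2| := by
    filter_upwards [self_mem_nhdsWithin, herr0 1, herr 1 1 L,
      eventually_le_nhdsGT (f := fun ε => ε ^ 1) (by fun_prop) (a := 1 / 8) (by norm_num),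
      eventually_le_nhdsGT (f := fun ε => ε ^ 1) (by fun_prop) (a := κ / 2) (by simpa using hκ),
      eventually_le_nhdsGT (f := fun ε => ε * L) (by fun_prop) (a := ρ / 2) (by simpa using hρ),
      mem_nhdsWithin_of_mem_nhds (Iio_mem_nhds hr₁)] with ε hε e0 e1 h8 hκ2 hεL hεr
    replace hε : 0 < ε := hε
    refine ⟨hε, fun x hx => ?_⟩
    have hxρ : |x| ≤ ρ := hx.le.trans (min_le_left _ _)
    have hx1 : |x| < r₁ := hx.trans_le ((min_le_right _ _).trans (min_le_left _ _))
    have hx2 : |x| < r₂ := hx.trans_le ((min_le_right _ _).trans (min_le_right _ _))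
    have hSm : ∀ i, MeasurableSet (S i ε) := fun i => (hS i).meas ε hε
    have hux : |u x| < ρ / 2 := hur (by simpa [Real.dist_eq] using hx2)
    have hq : dist ((x, ε) : ℝ × ℝ) 0 < r₁ := by
      rw [dist_zero_right, Prod.norm_def]
      simpa [abs_of_pos hε] using ⟨hx1, hεr⟩
    have hinner : ∀ z, |z| ≤ L → |u x + ε * z| ≤ ρ := fun z hz => by
      refine (abs_add_le _ _).trans ?_
      rw [abs_mul, abs_of_pos hε]
      have := mul_le_mul_of_nonneg_left hz hε.le
      linarith
    have hhigh : ∀ z ≥ L, |u x + ε * z| ≤ ρ → level u c Z S ε ((x, ε), z) < 1 / 2 :=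
      fun z hz h => by
        have h3 := (hfar (x, ε)).1 z hz
        have h4 := (le_abs_self _).trans (e0 x z hxρ h)
        simp only [level]
        linarith
    have hlow : ∀ z ≤ -L, |u x + ε * z| ≤ ρ → 1 / 2 < level u c Z S ε ((x, ε), z) :=
      fun z hz h => by
        have h3 := (hfar (x, ε)).2 z hz
        have h4 := (neg_le_abs _).trans (e0 x z hxρ h)
        simp only [level]
        linarith
    have hLL : |L| ≤ L := (abs_of_pos hL).le
    obtain ⟨ζ, hζ, hsol, hiff, hdist⟩ := exists_crossing (κ := κ / 2)
      (V := fun z => level u c Z S ε ((x, ε), z)) hL (by positivity)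
      (fun z _ => hasDerivAt_level hu hZ hSm (x, ε) z) (fun z hz => by
        have h5 := hnear hq z hz
        have h6 := e1 x z hxρ hz
        rw [norm_iteratedFDeriv_one] at h6
        have h7 := (fderiv ℝ (smearError u c Z S ε) ((x, ε), z)).le_opNorm (0, 1)
        have h8 : ‖((0, 1) : (ℝ × ℝ) × ℝ)‖ = 1 := by simp [Prod.norm_def]
        rw [h8, mul_one] at h7
        have h9 := (le_abs_self _).trans h7
        linarith) (hhigh L le_rfl (hinner L hLL)) (hlow (-L) le_rfl (hinner (-L) (by rwa [abs_neg])))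
    refine ⟨ζ, hζ, hsol, fun y hy => ?_, hdist⟩
    obtain ⟨z, rfl⟩ : ∃ z, y = u x + ε * z := ⟨(y - u x) / ε, by field_simp; ring⟩
    have hyρ : |u x + ε * z| ≤ ρ := hy.le.trans (min_le_left _ _)
    rw [mem_nextSet hu hZ hε hSm, add_le_add_iff_left, mul_le_mul_iff_right₀ hε]
    by_cases hz : |z| ≤ L
    · exact hiff z hz
    rcases le_or_gt 0 z with h0 | h0
    · rw [abs_of_nonneg h0, not_le] at hz
      refine iff_of_false (hhigh z hz.le hyρ).not_ge fun h => ?_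
      linarith [(abs_le.1 hζ).2]
    · rw [abs_of_neg h0, not_le] at hz
      refine iff_of_true (hlow z (by linarith) hyρ).le ?_
      linarith [(abs_le.1 hζ).1]
  refine ⟨r, hr0, L, hL, κ / 2, by positivity, ?_⟩
  have main' : ∀ᶠ ε in 𝓝[>] (0 : ℝ), ∃ ζ : ℝ → ℝ, 0 < ε ∧ ∀ x, |x| < r → |ζ x| ≤ L ∧
      level u c Z S ε ((x, ε), ζ x) = 1 / 2 ∧
      (∀ y, |y| < r → ((x, y) ∈ nextSet c S ε ↔ y ≤ u x + ε * ζ x)) ∧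
      ∀ z, |z| ≤ L → κ / 2 * |ζ x - z| ≤ |level u c Z S ε ((x, ε), z) - 1 / 2| := by
    filter_upwards [main] with ε h
    choose! ζ hζ using h.2
    exact ⟨ζ, h.1, hζ⟩
  obtain ⟨ζ, hζ⟩ := main'.choice
  refine ⟨ζ, ?_⟩
  filter_upwards [hζ, herr 1 1 L,
    eventually_le_nhdsGT (f := fun ε => ε ^ 1) (by fun_prop) (a := κ / 2) (by simpa using hκ),
    mem_nhdsWithin_of_mem_nhds (Iio_mem_nhds hr₁)] with ε h e1 hκ2 hεr x hx
  obtain ⟨hε, h⟩ := h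
  obtain ⟨h1, h2, h3, h4⟩ := h x hx
  refine ⟨h1, h2, ?_, h3, h4⟩
  have hSm : ∀ i, MeasurableSet (S i ε) := fun i => (hS i).meas ε hε
  have hW := contDiff_level (u := u) (c := c) (Z := Z) (S := S) hu hZ hSm
  have hnb : ∀ᶠ x' in 𝓝 x, |x'| < r := continuous_abs.continuousAt.eventually_lt_const hx
  -- Transversality at x', tested at the height ζ ε x, bounds |ζ ε x' - ζ ε x| by a quantity
  -- continuous in x' that vanishes at x. Continuity then upgrades to smoothness by the implicit
  -- equation.
  have hcont : ContinuousAt (ζ ε) x := by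
    have hg : ContinuousAt (fun x' => 2 / κ * |level u c Z S ε ((x', ε), ζ ε x) - 1 / 2|) x := by
      have := hW.continuous
      fun_prop
    have hg0 : Tendsto (fun x' => 2 / κ * |level u c Z S ε ((x', ε), ζ ε x) - 1 / 2|) (𝓝 x)
        (𝓝 0) := by
      have := hg.tendsto
      rwa [h2, sub_self, abs_zero, mul_zero] at this
    refine tendsto_iff_dist_tendsto_zero.2 (squeeze_zero' (Eventually.of_forall fun _ =>
      dist_nonneg) ?_ hg0)
    filter_upwards [hnb] with x' hx'
    have := (h x' hx').2.2.2 (ζ ε x) h1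
    rw [Real.dist_eq, div_mul_eq_mul_div, le_div_iff₀ hκ]
    linarith
  have hq : dist ((x, ε) : ℝ × ℝ) 0 < r₁ := by
    rw [dist_zero_right, Prod.norm_def]
    simpa [abs_of_pos hε] using ⟨hx.trans_le ((min_le_right _ _).trans (min_le_left _ _)), hεr⟩
  refine hcont.contDiffAt_of_implicit (n := ∞) (by simp) (c := 1 / 2)
    (f := fun v : ℝ × ℝ => level u c Z S ε ((v.1, ε), v.2)) (hnb.mono fun x' hx' => (h x' hx').2.1)
    (hW.comp (by fun_prop : ContDiff ℝ ∞ fun v : ℝ × ℝ => ((v.1, ε), v.2))).contDiffAt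
    (hasDerivAt_level hu hZ hSm (x, ε) (ζ ε x)) (ne_of_lt ?_)
  have h5 := hnear hq _ h1
  have h6 := e1 x _ (hx.le.trans (min_le_left _ _)) h1
  rw [norm_iteratedFDeriv_one] at h6
  have h7 := (fderiv ℝ (smearError u c Z S ε) ((x, ε), ζ ε x)).le_opNorm (0, 1)
  have h8 : ‖((0, 1) : (ℝ × ℝ) × ℝ)‖ = 1 := by simp [Prod.norm_def]
  rw [h8, mul_one] at h7
  have h9 := (le_abs_self _).trans h7
  linarith

end Crossing

/-! ### Second derivatives of implicit functions and their stability. -/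

section ImplicitSecond

/-- The second derivative of an implicitly defined function of the first variable, in terms of the
first two derivatives of the defining function. -/
noncomputable def implicitSecond (J : (((ℝ × ℝ) × ℝ) →L[ℝ] ℝ) ×
    (((ℝ × ℝ) × ℝ) →L[ℝ] ((ℝ × ℝ) × ℝ) →L[ℝ] ℝ)) : ℝ :=
  -J.2 ((1, 0), -J.1 ((1, 0), 0) / J.1 (0, 1)) ((1, 0), -J.1 ((1, 0), 0) / J.1 (0, 1)) / J.1 (0, 1)

theorem contDiffAt_implicitSecond {J : (((ℝ × ℝ) × ℝ) →L[ℝ] ℝ) ×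
    (((ℝ × ℝ) × ℝ) →L[ℝ] ((ℝ × ℝ) × ℝ) →L[ℝ] ℝ)} (hJ : J.1 (0, 1) ≠ 0) :
    ContDiffAt ℝ 1 implicitSecond J := by
  have h1 : ∀ v : (ℝ × ℝ) × ℝ, ContDiffAt ℝ 1 (fun J : (((ℝ × ℝ) × ℝ) →L[ℝ] ℝ) ×
    (((ℝ × ℝ) × ℝ) →L[ℝ] ((ℝ × ℝ) × ℝ) →L[ℝ] ℝ) => J.1 v) J := fun v =>
    contDiffAt_fst.clm_apply contDiffAt_const
  have h2 := contDiffAt_const (c := ((1, 0) : ℝ × ℝ)) |>.prodMk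
    ((h1 ((1, 0), 0)).neg.fun_div (h1 (0, 1)) hJ)
  exact (((contDiffAt_snd.clm_apply h2).clm_apply h2).neg).fun_div (h1 (0, 1)) hJ

/-- The equation is differentiated twice along the solution. Only the first two derivatives of F at
one point enter, so nearby jets give nearby second derivatives. -/
theorem iteratedDeriv_two_of_implicit {F : (ℝ × ℝ) × ℝ → ℝ} (hF : ContDiff ℝ ∞ F) {φ : ℝ → ℝ}
    {ε x c : ℝ} (hφ : ContDiffAt ℝ 2 φ x) (h : ∀ᶠ x' in 𝓝 x, F ((x', ε), φ x') = c)
    (hne : fderiv ℝ F ((x, ε), φ x) (0, 1) ≠ 0) :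
    iteratedDeriv 2 φ x = implicitSecond
      (fderiv ℝ F ((x, ε), φ x), fderiv ℝ (fderiv ℝ F) ((x, ε), φ x)) := by
  have hd : ∀ᶠ x' in 𝓝 x, HasDerivAt φ (deriv φ x') x' := by
    filter_upwards [hφ.eventually (by simp)] with x' hx'
    exact (hx'.differentiableAt (by simp)).hasDerivAt
  have hγ : ∀ᶠ x' in 𝓝 x, HasDerivAt (fun x' => ((x', ε), φ x')) ((1, 0), deriv φ x') x' := by
    filter_upwards [hd] with x' hx'
    exact ((hasDerivAt_id x').prodMk (hasDerivAt_const x' ε)).prodMk hx'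
  have h0 : (fun x' => fderiv ℝ F ((x', ε), φ x') ((1, 0), deriv φ x')) =ᶠ[𝓝 x] fun _ => 0 := by
    filter_upwards [hγ, h.eventually_nhds] with x' h1 h2
    have h3 := ((hF.differentiable (by simp) ((x', ε), φ x')).hasFDerivAt.comp_hasDerivAt x' h1)
    exact h3.unique ((hasDerivAt_const x' c).congr_of_eventuallyEq h2)
  have hφ2 : HasDerivAt (deriv φ) (iteratedDeriv 2 φ x) x := by
    rw [iteratedDeriv_succ, iteratedDeriv_one]
    have h2 : ContDiffAt ℝ 1 (fderiv ℝ φ) x := hφ.fderiv_right (by norm_num)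
    have h3 : deriv φ = fun y => fderiv ℝ φ y 1 := rfl
    rw [h3]
    exact ((h2.clm_apply contDiffAt_const).differentiableAt (by simp)).hasDerivAt
  have hF' : ContDiff ℝ ∞ (fderiv ℝ F) := hF.fderiv_right (by simp)
  have h4 := (hF'.differentiable (by simp) ((x, ε), φ x)).hasFDerivAt.comp_hasDerivAt x
    hγ.self_of_nhds
  have h5 := h4.clm_apply ((hasDerivAt_const x ((1, 0) : ℝ × ℝ)).prodMk hφ2)
  have h6 := h5.unique ((hasDerivAt_const x (0 : ℝ)).congr_of_eventuallyEq h0)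
  have h7 : fderiv ℝ F ((x, ε), φ x) ((1, 0), deriv φ x) = 0 := h0.self_of_nhds
  have e1 : ∀ (A : ((ℝ × ℝ) × ℝ) →L[ℝ] ℝ) (w : ℝ × ℝ) (b : ℝ), A (w, b) = A (w, 0) + b * A (0, 1) :=
    fun A w b => by
      rw [← smul_eq_mul, ← map_smul, ← map_add]
      simp
  have h8 : deriv φ x = -fderiv ℝ F ((x, ε), φ x) ((1, 0), 0) / fderiv ℝ F ((x, ε), φ x) (0, 1) := by
    rw [e1] at h7
    rw [eq_div_iff hne]
    linarith
  simp only [implicitSecond]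
  rw [← h8, eq_div_iff hne]
  simp only [Function.comp_apply] at h6
  rw [e1 _ (0 : ℝ × ℝ)] at h6
  have e2 : fderiv ℝ F ((x, ε), φ x) ((0 : ℝ × ℝ), (0 : ℝ)) = 0 := map_zero _
  rw [e2] at h6
  linarith

/-- Small perturbations of the arguments of a differentiable function of two jets. -/
theorem isBigO_perturbation {X A D : Type*} [NormedAddCommGroup X] [NormedSpace ℝ X]
    [NormedAddCommGroup A] [NormedSpace ℝ A] [NormedAddCommGroup D] [NormedSpace ℝ D]
    {R : A × D → ℝ} {a : X → A} {b : X → D} {x : X} (ha : ContDiff ℝ 1 a) (hb : ContDiff ℝ 1 b)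
    (hR : ContDiffAt ℝ 1 R (a x, b x)) {l : Filter ℝ} {P₁ P₂ : ℝ → X} {α : ℝ → A} {β : ℝ → D}
    (h₁ : Tendsto P₁ l (𝓝 x)) (h₂ : Tendsto P₂ l (𝓝 x)) (hα : Tendsto α l (𝓝 0))
    (hβ : Tendsto β l (𝓝 0)) {g : ℝ → ℝ} (hP : (fun t => P₁ t - P₂ t) =O[l] g) (hα' : α =O[l] g)
    (hβ' : β =O[l] g) :
    (fun t => R (a (P₁ t) + α t, b (P₁ t) + β t) - R (a (P₂ t), b (P₂ t))) =O[l] g := by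
  have hin : ContDiff ℝ 1 fun v : X × A × D => (a v.1 + v.2.1, b v.1 + v.2.2) := by fun_prop
  have hG : ContDiffAt ℝ 1 (R ∘ fun v : X × A × D => (a v.1 + v.2.1, b v.1 + v.2.2)) (x, 0, 0) :=
    ContDiffAt.comp _ (by simpa using hR) hin.contDiffAt
  have h := (hG.hasStrictFDerivAt (by simp)).isBigO_sub.comp_tendsto
    ((h₁.prodMk_nhds (hα.prodMk_nhds hβ)).prodMk_nhds
      (h₂.prodMk_nhds ((tendsto_const_nhds (x := (0 : A))).prodMk_nhds
        (tendsto_const_nhds (x := (0 : D))))))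
  refine IsBigO.trans (h.congr_left fun t => ?_) (hP.prod_left (hα'.prod_left hβ') |>.congr_left
    fun t => ?_)
  · simp
  · simp

end ImplicitSecond

/-! ### Passage from one stage to the next. -/

section Next

variable {ι : Type*} [Fintype ι] {u : ℝ → ℝ} {c : ι → ℝ} {Z : ι → ℝ × ℝ → ℝ}
  {S : ι → ℝ → Set (ℝ × ℝ)}

/-- The symmetric difference lies in a strip of thickness 4 ε^(N+1) over an interval of length 2r.
Half-thickness 2 ε^(N+1) instead of ε^(N+1) gives the strict inequalities required by
`regionBetween`. -/
theorem isApprox_of_interface (hu : Continuous u) {Y : ℝ × ℝ → ℝ} (hY : Continuous Y)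
    {T : ℝ → Set (ℝ × ℝ)} (hT : ∀ ε, 0 < ε → MeasurableSet (T ε)) {r : ℝ} (hr : 0 < r)
    {ζ : ℝ → ℝ → ℝ}
    (h : ∀ᶠ ε in 𝓝[>] (0 : ℝ), ∀ x, |x| < r → ∀ y, |y| < r →
      ((x, y) ∈ T ε ↔ y ≤ u x + ε * ζ ε x))
    (hζ : ∀ N : ℕ, ∀ᶠ ε in 𝓝[>] (0 : ℝ), ∀ x, |x| < r → |ζ ε x - Y (x, ε)| ≤ ε ^ N) :
    IsApprox u Y T := by
  refine ⟨hT, r, hr, fun N => ?_⟩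
  filter_upwards [self_mem_nhdsWithin, h, hζ N, eventually_mul_pow_succ_le (8 * r) N]
    with ε hε h1 h2 h3
  replace hε : 0 < ε := hε
  set g : ℝ → ℝ := fun x => u x + ε * Y (x, ε) with hg
  have hgc : Continuous g := by fun_prop
  have hsub : symmDiff (T ε) (region u Y ε) ∩ Metric.ball 0 r ⊆
      regionBetween (fun x => g x - 2 * ε ^ (N + 1)) (fun x => g x + 2 * ε ^ (N + 1))
        (Set.Ioo (-r) r) := by
    rintro ⟨x, y⟩ ⟨hxy, hb⟩
    rw [mem_ball_zero_iff, Prod.norm_def, max_lt_iff] at hb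
    obtain ⟨hx, hy⟩ := hb
    simp only [Real.norm_eq_abs] at hx hy
    have hz := mul_le_mul_of_nonneg_left (abs_le.1 (h2 x hx)).1 hε.le
    have hz' := mul_le_mul_of_nonneg_left (abs_le.1 (h2 x hx)).2 hε.le
    have hp : 0 < ε ^ (N + 1) := by positivity
    have e1 : ε * ε ^ N = ε ^ (N + 1) := by ring
    have e2 : ε * -ε ^ N = -ε ^ (N + 1) := by ring
    rw [e1] at hz'
    rw [e2] at hz
    have hm : (x, y) ∈ region u Y ε ↔ y ≤ u x + ε * Y (x, ε) := Iff.rfl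
    refine ⟨abs_lt.1 hx, ?_⟩
    rw [Set.mem_symmDiff, h1 x hx y hy, hm] at hxy
    constructor <;> simp only [hg] <;> rcases hxy with ⟨h4, h5⟩ | ⟨h4, h5⟩ <;> linarith
  have hvol : volume (regionBetween (fun x => g x - 2 * ε ^ (N + 1))
      (fun x => g x + 2 * ε ^ (N + 1)) (Set.Ioo (-r) r)) = ENNReal.ofReal (8 * r * ε ^ (N + 1)) := by
    rw [Measure.volume_eq_prod, volume_regionBetween_eq_lintegral
      (by fun_prop : Continuous fun x => g x - 2 * ε ^ (N + 1)).aemeasurable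
      (by fun_prop : Continuous fun x => g x + 2 * ε ^ (N + 1)).aemeasurable measurableSet_Ioo]
    have e3 : ∀ x, ((fun x => g x + 2 * ε ^ (N + 1)) - fun x => g x - 2 * ε ^ (N + 1)) x
        = 4 * ε ^ (N + 1) := fun x => by simp only [Pi.sub_apply]; ring
    simp only [e3]
    rw [setLIntegral_const, Real.volume_Ioo, ← ENNReal.ofReal_mul (by positivity)]
    congr 1
    ring
  refine le_trans ?_ h3
  have := measure_mono (μ := volume) hsub
  rw [hvol] at this
  exact ENNReal.toReal_le_of_le_ofReal (by positivity) this

theorem norm_fderiv_fderiv_eq {F : (ℝ × ℝ) × ℝ → ℝ} (P : (ℝ × ℝ) × ℝ) :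
    ‖fderiv ℝ (fderiv ℝ F) P‖ = ‖iteratedFDeriv ℝ 2 F P‖ := by
  rw [← norm_iteratedFDeriv_one, norm_iteratedFDeriv_fderiv]

theorem eventually_isBigO_pow {f : ℝ → ℝ} {N : ℕ} (h : ∀ᶠ ε in 𝓝[>] (0 : ℝ), |f ε| ≤ ε ^ N) :
    f =O[𝓝[>] (0 : ℝ)] fun ε => ε ^ N := by
  refine IsBigO.of_bound 1 (h.mono fun ε hε => ?_)
  rw [one_mul, Real.norm_eq_abs]
  exact hε.trans (le_abs_self _)

/-- Near the origin, the boundaries of the sets `T ε` are smooth graphs `u + ε ζ ε`, which agree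
with `u + ε Y(·, ε)` at the origin to all orders, up to second derivatives. -/
structure HasInterface (u : ℝ → ℝ) (Y : ℝ × ℝ → ℝ) (T : ℝ → Set (ℝ × ℝ)) (r L : ℝ)
    (ζ : ℝ → ℝ → ℝ) : Prop where
  mem : ∀ᶠ ε in 𝓝[>] (0 : ℝ), ∀ x, |x| < r → |ζ ε x| ≤ L ∧ ContDiffAt ℝ ∞ (ζ ε) x ∧
    ∀ y, |y| < r → ((x, y) ∈ T ε ↔ y ≤ u x + ε * ζ ε x)
  approx : ∀ N : ℕ, (fun ε => ζ ε 0 - Y (0, ε)) =O[𝓝[>] (0 : ℝ)] fun ε => ε ^ N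
  approx_snd : ∀ N : ℕ, (fun ε => iteratedDeriv 2 (ζ ε) 0 - iteratedDeriv 2 (fun x => Y (x, ε)) 0)
    =O[𝓝[>] (0 : ℝ)] fun ε => ε ^ N

/-- One stage of the scheme, for families of sets that are close to regions below graphs. -/
theorem exists_next (hu : u.HasTemperateGrowth) (hu0 : u 0 = 0) (hu1 : deriv u 0 = 0)
    {B : ℝ} (hB : ∀ x, |deriv u x| ≤ B) (hZ : ∀ i, IsCorrector (Z i)) (hc : ∑ i, c i = 1)
    (hS : ∀ i, IsApprox u (Z i) (S i)) {Y : ℝ × ℝ → ℝ} (hY : IsCorrector Y)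
    (hsol : ∀ᶠ q in 𝓝 (0 : ℝ × ℝ), sumProfile u c Z (q, Y q) = 1 / 2) :
    IsApprox u Y (nextSet c S) ∧ ∃ r > 0, ∃ L > 0, ∃ ζ : ℝ → ℝ → ℝ,
      HasInterface u Y (nextSet c S) r L ζ := by
  obtain ⟨r₀, hr₀, L, hL, κ, hκ, ζ, hζ⟩ := exists_interface (c := c) hu hu0 hu1 hB hZ hc hS
  obtain ⟨ρ, hρ, herr0, herr⟩ := exists_abs_smearError_le (c := c) hu hu0 hZ hS
  have hY0 : Y 0 = 0 := hY.apply_zero 0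
  have hYL : ∀ᶠ q in 𝓝 (0 : ℝ × ℝ), |Y q| < L :=
    hY.smooth.continuous.abs.continuousAt.eventually_lt_const (by simpa [hY0] using hL)
  obtain ⟨r₁, hr₁, hq⟩ := Metric.eventually_nhds_iff.1 (hYL.and hsol)
  set r := min r₀ (min ρ r₁) with hr
  have hr0 : 0 < r := by positivity
  -- At height Y the profile is exactly 1/2, so the level misses 1/2 only by the convolution error;
  -- the transversality inequality converts this into a distance.
  have hdist : ∀ N : ℕ, ∀ᶠ ε in 𝓝[>] (0 : ℝ), ∀ x, |x| < r → |ζ ε x - Y (x, ε)| ≤ ε ^ N := by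
    intro N
    filter_upwards [hζ, herr 0 (N + 1) L, self_mem_nhdsWithin,
      mem_nhdsWithin_of_mem_nhds (Iio_mem_nhds hr₁), eventually_mul_pow_succ_le κ⁻¹ N]
      with ε h1 h2 hε h3 h4 x hx
    replace hε : 0 < ε := hε
    have hx0 : |x| < r₀ := hx.trans_le (min_le_left _ _)
    have hxρ : |x| < ρ := hx.trans_le ((min_le_right _ _).trans (min_le_left _ _))
    have hx1 : |x| < r₁ := hx.trans_le ((min_le_right _ _).trans (min_le_right _ _))
    have hd : dist ((x, ε) : ℝ × ℝ) 0 < r₁ := by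
      rw [dist_zero_right, Prod.norm_def]
      simpa [abs_of_pos hε] using ⟨hx1, h3⟩
    obtain ⟨h5, h6⟩ := hq hd
    have h7 := (h1 x hx0).2.2.2.2 _ h5.le
    have h8 := h2 x _ hxρ.le h5.le
    rw [norm_iteratedFDeriv_zero, Real.norm_eq_abs] at h8
    rw [level, h6, add_sub_cancel_left] at h7
    refine le_trans ?_ h4
    rw [← div_eq_inv_mul, le_div_iff₀ hκ]
    linarith
  have happ : IsApprox u Y (nextSet c S) :=
    isApprox_of_interface hu.1.continuous hY.smooth.continuous
      (fun ε hε => measurableSet_nextSet fun i => (hS i).meas ε hε) hr0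
      (hζ.mono fun ε h x hx y hy => (h x (hx.trans_le (min_le_left _ _))).2.2.2.1 y
        (hy.trans_le (min_le_left _ _))) hdist
  have h0r : |(0 : ℝ)| < r := by simpa using hr0
  have h0r₀ : |(0 : ℝ)| < r₀ := by simpa using hr₀
  have hb : ∀ N : ℕ, (fun ε => ζ ε 0 - Y (0, ε)) =O[𝓝[>] (0 : ℝ)] fun ε => ε ^ N := fun N =>
    eventually_isBigO_pow ((hdist N).mono fun ε h => h 0 h0r)
  refine ⟨happ, r₀, hr₀, L, hL, ζ, hζ.mono fun ε h x hx => ⟨(h x hx).1, (h x hx).2.2.1,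
    (h x hx).2.2.2.1⟩, hb, fun N => ?_⟩
  set F := sumProfile u c Z with hFdef
  have hF : ContDiff ℝ ∞ F := (hasTemperateGrowth_sumProfile hu hZ).1
  have hF1 : ContDiff ℝ ∞ (fderiv ℝ F) := hF.fderiv_right (by simp)
  have hF2 : ContDiff ℝ ∞ (fderiv ℝ (fderiv ℝ F)) := hF1.fderiv_right (by simp)
  have hFz : ∀ q z, fderiv ℝ F (q, z) (0, 1) = -sumDensity u c Z (q, z) := fun q z => by
    have h1 := (hF.differentiable (by simp) (q, z)).hasFDerivAt.comp_hasDerivAt z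
      ((hasDerivAt_const z q).prodMk (hasDerivAt_id z))
    exact h1.unique (hasDerivAt_sumProfile hu hZ q z)
  set e := smearError u c Z S with he
  set P₁ : ℝ → (ℝ × ℝ) × ℝ := fun ε => ((0, ε), ζ ε 0) with hP₁
  set P₂ : ℝ → (ℝ × ℝ) × ℝ := fun ε => ((0, ε), Y (0, ε)) with hP₂
  have h0ρ : |(0 : ℝ)| ≤ ρ := by simpa using hρ.le
  have hE1 : ∀ N : ℕ, (fun ε => fderiv ℝ (e ε) (P₁ ε)) =O[𝓝[>] (0 : ℝ)] fun ε => ε ^ N := fun N => by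
    refine IsBigO.of_bound 1 ?_
    filter_upwards [hζ, herr 1 N L, self_mem_nhdsWithin] with ε h1 h2 hε
    have h6 := h2 0 _ h0ρ (h1 0 h0r₀).1
    rw [norm_iteratedFDeriv_one] at h6
    rwa [one_mul, Real.norm_of_nonneg (pow_nonneg (le_of_lt hε) N)]
  have hE2 : ∀ N : ℕ, (fun ε => fderiv ℝ (fderiv ℝ (e ε)) (P₁ ε)) =O[𝓝[>] (0 : ℝ)]
      fun ε => ε ^ N := fun N => by
    refine IsBigO.of_bound 1 ?_
    filter_upwards [hζ, herr 2 N L, self_mem_nhdsWithin] with ε h1 h2 hε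
    have h6 := h2 0 _ h0ρ (h1 0 h0r₀).1
    rw [← norm_fderiv_fderiv_eq] at h6
    rwa [one_mul, Real.norm_of_nonneg (pow_nonneg (le_of_lt hε) N)]
  have hP : ∀ N : ℕ, (fun ε => P₁ ε - P₂ ε) =O[𝓝[>] (0 : ℝ)] fun ε => ε ^ N := fun N => by
    have h1 : (fun ε => P₁ ε - P₂ ε) = fun ε => ((0 : ℝ × ℝ), ζ ε 0 - Y (0, ε)) := by
      ext ε <;> simp [hP₁, hP₂]
    rw [h1]
    exact (isBigO_zero _ _).prod_left (hb N)
  have htend : ∀ {V : Type} [NormedAddCommGroup V] {f : ℝ → V},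
      f =O[𝓝[>] (0 : ℝ)] (fun ε => ε ^ 1) → Tendsto f (𝓝[>] 0) (𝓝 0) := fun h =>
    h.trans_tendsto (((continuous_pow 1).tendsto' 0 0 (by simp)).mono_left nhdsWithin_le_nhds)
  have ht₂ : Tendsto P₂ (𝓝[>] 0) (𝓝 0) := by
    have : Continuous P₂ := by
      have := hY.smooth.continuous
      fun_prop
    refine (this.tendsto' 0 _ ?_).mono_left nhdsWithin_le_nhds
    simp only [hP₂]
    rw [hY.apply_zero]
    rfl
  have ht₁ : Tendsto P₁ (𝓝[>] 0) (𝓝 0) := by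
    simpa using (htend (hP 1)).add ht₂
  have hne : fderiv ℝ F 0 (0, 1) ≠ 0 := by
    refine (hFz 0 0).trans_ne (neg_ne_zero.2 ?_)
    have := sumDensity_zero (c := c) hu1 hZ hc 0
    exact this.trans_ne (heat_pos 0).ne'
  -- The true interface solves an equation with F + e and the corrector one with F. Their base
  -- points differ by O(εᴺ) and the derivatives of e are O(εᴺ), so the values of `implicitSecond`
  -- differ by O(εᴺ).
  have hdiff := isBigO_perturbation (hF1.of_le (by simp)) (hF2.of_le (by simp))
    (contDiffAt_implicitSecond hne) ht₁ ht₂ (htend (hE1 1)) (htend (hE2 1)) (hP N) (hE1 N) (hE2 N)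
  refine hdiff.congr' ?_ EventuallyEq.rfl
  have hc1 : ContinuousAt (fun v : ((ℝ × ℝ) × ℝ) => fderiv ℝ F v (0, 1)) 0 := by
    have := hF1.continuous
    fun_prop
  have hn₂ := (hc1.tendsto.comp ht₂).eventually_ne hne
  have hn₁ : ∀ᶠ ε in 𝓝[>] (0 : ℝ), fderiv ℝ F (P₁ ε) (0, 1) + fderiv ℝ (e ε) (P₁ ε) (0, 1) ≠ 0 := by
    have h2 : Tendsto (fun ε => fderiv ℝ (e ε) (P₁ ε) (0, 1)) (𝓝[>] 0) (𝓝 0) := by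
      have := ((ContinuousLinearMap.apply ℝ ℝ ((0, 1) : (ℝ × ℝ) × ℝ)).continuous.tendsto 0).comp
        (htend (hE1 1))
      rwa [map_zero] at this
    refine Tendsto.eventually_ne ((hc1.tendsto.comp ht₁).add h2) ?_
    rwa [add_zero]
  filter_upwards [hζ, hn₁, hn₂, self_mem_nhdsWithin, mem_nhdsWithin_of_mem_nhds (Iio_mem_nhds hr₁)]
    with ε h1 h2 h3 hε hε1
  replace hε : 0 < ε := hε
  have hSm : ∀ i, MeasurableSet (S i ε) := fun i => (hS i).meas ε hε
  have hE : ContDiff ℝ ∞ (e ε) := contDiff_smearError hu hZ hSm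
  have hEd : ContDiff ℝ ∞ (fderiv ℝ (e ε)) := hE.fderiv_right (by simp)
  have hfd : fderiv ℝ (level u c Z S ε) = fun P => fderiv ℝ F P + fderiv ℝ (e ε) P := funext fun P =>
    fderiv_add (hF.differentiable (by simp) P) (hE.differentiable (by simp) P)
  have hfd2 : ∀ P, fderiv ℝ (fun P => fderiv ℝ F P + fderiv ℝ (e ε) P) P
      = fderiv ℝ (fderiv ℝ F) P + fderiv ℝ (fderiv ℝ (e ε)) P := fun P =>
    fderiv_add (hF1.differentiable (by simp) P) (hEd.differentiable (by simp) P)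
  have hnb : ∀ {a : ℝ}, 0 < a → ∀ᶠ x' in 𝓝 (0 : ℝ), |x'| < a := fun ha =>
    continuous_abs.continuousAt.eventually_lt_const (by simpa using ha)
  have f1 := iteratedDeriv_two_of_implicit (contDiff_level hu hZ hSm) (φ := ζ ε) (ε := ε) (x := 0)
    ((h1 0 h0r₀).2.2.1.of_le two_le_infty) ((hnb hr₀).mono fun x hx => (h1 x hx).2.1)
    (by rw [hfd]; exact h2)
  have f2 := iteratedDeriv_two_of_implicit hF (φ := fun x => Y (x, ε)) (ε := ε) (x := 0)
    (c := 1 / 2)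
    ((hY.smooth.comp (by fun_prop : ContDiff ℝ ∞ fun x : ℝ => (x, ε))).contDiffAt.of_le two_le_infty)
    ((hnb hr₁).mono fun x hx => (hq (by
      rw [dist_zero_right, Prod.norm_def]
      simpa [abs_of_pos hε] using ⟨hx, hε1⟩)).2) h3
  rw [f1, f2, hfd, hfd2]

end Next

/-! ### Induction over the stages and expansion in t. -/

section Stages

variable {u f : ℝ → ℝ} {Y : ℝ × ℝ → ℝ} {T T' : ℝ → Set (ℝ × ℝ)} {r L b₁ b : ℝ} {ζ : ℝ → ℝ → ℝ}

theorem IsApprox.congr (h : IsApprox u Y T) (hT : ∀ ε, 0 < ε → T' ε = T ε) : IsApprox u Y T' := by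
  refine ⟨fun ε hε => hT ε hε ▸ h.meas ε hε, ?_⟩
  obtain ⟨ρ, hρ, hc⟩ := h.close
  refine ⟨ρ, hρ, fun N => ?_⟩
  filter_upwards [hc N, self_mem_nhdsWithin] with ε h1 hε
  rwa [hT ε hε]

theorem HasInterface.congr (h : HasInterface u Y T r L ζ) (hT : ∀ ε, 0 < ε → T' ε = T ε) :
    HasInterface u Y T' r L ζ := by
  refine ⟨?_, h.approx, h.approx_snd⟩
  filter_upwards [h.mem, self_mem_nhdsWithin] with ε h1 hε
  rwa [hT ε hε]

theorem stage_succ_eq_nextSet (γ : ℕ → ℕ → ℝ) (S : Set (ℝ × ℝ)) (m : ℕ) {ε : ℝ} (hε : 0 < ε) :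
    stage γ (ε ^ 2) S (m + 1) = nextSet (fun i : Fin (m + 1) => γ (m + 1) i)
      (fun i ε => stage γ (ε ^ 2) S i) ε := by
  rw [stage]
  ext p
  simp only [Set.mem_ofPred_eq, nextSet]
  rw [convolution_gaussKernel hε]
  rfl

/-- Strong induction, since a stage uses all earlier ones; correctors, coefficients and `IsApprox`
are what it feeds on. Stage 0 has corrector 0, and agreement of f with u on |x| < 1 suffices because
`IsApprox` is local. -/
theorem exists_stage (hu : u.HasTemperateGrowth) (hu0 : u 0 = 0) (hu1 : deriv u 0 = 0) {B : ℝ}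
    (hB : ∀ x, |deriv u x| ≤ B) (hf : Continuous f) (hfu : ∀ x, |x| < 1 → f x = u x) {M : ℕ}
    {γ : ℕ → ℕ → ℝ} (hγ : ∀ m : ℕ, 1 ≤ m → m ≤ M → ∑ i ∈ Finset.range m, γ m i = 1) :
    ∀ i ≤ M, ∃ Y, IsCorrector Y ∧ HasCoefficients u Y (beta1 γ i)
        (beta2 γ i * iteratedDeriv 4 u 0 - beta3 γ i * iteratedDeriv 2 u 0 ^ 3) ∧
      IsApprox u Y (fun ε => stage γ (ε ^ 2) (subgraph f) i) ∧ ∃ r > 0, ∃ L > 0, ∃ ζ,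
        HasInterface u Y (fun ε => stage γ (ε ^ 2) (subgraph f) i) r L ζ := by
  intro i
  induction i using Nat.strong_induction_on with
  | _ i ih =>
    intro hi
    cases i with
    | zero =>
      have hmem : ∀ ε x : ℝ, |x| < 1 → ∀ y : ℝ, |y| < 1 →
          ((x, y) ∈ stage γ (ε ^ 2) (subgraph f) 0 ↔ y ≤ u x + ε * 0) := fun ε x hx y _ => by
        rw [stage, mul_zero, add_zero, ← hfu x hx]
        rfl
      refine ⟨fun _ => 0, IsCorrector.zero, ?_, ?_, 1, one_pos, 1, one_pos, fun _ _ => 0, ?_, ?_, ?_⟩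
      · simpa [beta1, beta2, beta3] using HasCoefficients.zero
      · refine isApprox_of_interface (ζ := fun _ _ => 0) hu.1.continuous continuous_const
          (fun ε _ => ?_) one_pos (Eventually.of_forall fun ε x hx y hy => hmem ε x hx y hy)
          fun N => ?_
        · rw [stage]
          exact (isClosed_le continuous_snd (hf.comp continuous_fst)).measurableSet
        · filter_upwards [self_mem_nhdsWithin] with ε hε x _
          simpa using pow_nonneg (le_of_lt hε) N
      · exact Eventually.of_forall fun ε x hx => ⟨by simp, contDiffAt_const, hmem ε x hx⟩
      · intro N
        simpa using isBigO_zero _ _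
      · intro N
        simpa using isBigO_zero _ _
    | succ m =>
      have hsum : ∑ i : Fin (m + 1), γ (m + 1) i = 1 := by
        rw [Fin.sum_univ_eq_sum_range]
        exact hγ (m + 1) (by omega) hi
      have h1 : ∀ i : Fin (m + 1), _ := fun i => ih i i.2 (by omega)
      choose Z hZ hcoef happ _ using h1
      obtain ⟨Y, hY, hsol⟩ := exists_corrector hu hu1 hZ hsum
      obtain ⟨hA, r, hr, L, hL, ζ, hI⟩ := exists_next hu hu0 hu1 hB hZ hsum happ hY hsol
      refine ⟨Y, hY, ?_, hA.congr fun ε hε => stage_succ_eq_nextSet γ _ m hε, r, hr, L, hL, ζ,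
        hI.congr fun ε hε => stage_succ_eq_nextSet γ _ m hε⟩
      have := HasCoefficients.step hu hu1 hZ hY hsum hsol hcoef
      rw [beta1, beta2, beta3]
      simpa only [beta4_eq_beta1, beta5_eq_two_mul_beta1] using this

theorem tendsto_sqrt_nhdsGT : Tendsto Real.sqrt (𝓝[>] 0) (𝓝[>] 0) := by
  refine tendsto_nhdsWithin_iff.2 ⟨?_, ?_⟩
  · exact (Real.continuous_sqrt.tendsto' 0 0 Real.sqrt_zero).mono_left nhdsWithin_le_nhds
  · filter_upwards [self_mem_nhdsWithin] with t ht
    exact Real.sqrt_pos.2 ht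

theorem isBigO_of_sqrt {F : ℝ → ℝ} {n : ℕ} (h : (fun ε => F (ε ^ 2)) =O[𝓝[>] (0 : ℝ)]
    fun ε => ε ^ (2 * n)) : F =O[𝓝[>] (0 : ℝ)] fun t => t ^ n := by
  refine (h.comp_tendsto tendsto_sqrt_nhdsGT).congr' ?_ ?_ <;>
    filter_upwards [self_mem_nhdsWithin] with t ht
  · simp [Real.sq_sqrt (le_of_lt ht)]
  · simp [pow_mul, Real.sq_sqrt (le_of_lt ht)]

theorem HasInterface.expansion (h : HasInterface u Y T r L ζ) (hY : IsCorrector Y)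
    (hc : HasCoefficients u Y b₁ b) (hu1 : deriv u 0 = 0) :
    (fun ε => ε * ζ ε 0 - (ε ^ 2 * b₁ * iteratedDeriv 2 u 0 + ε ^ 4 * b)) =O[𝓝[>] (0 : ℝ)]
      fun ε => ε ^ 6 := by
  have h1 := (hc.expansion hY hu1).mono (nhdsWithin_le_nhds (s := Set.Ioi (0 : ℝ)))
  have h2 := (isBigO_refl (fun ε : ℝ => ε) (𝓝[>] 0)).mul (h.approx 5)
  refine ((h2.congr_right fun ε => ?_).add h1).congr_left fun ε => ?_ <;> ring

theorem HasInterface.expansion_snd (h : HasInterface u Y T r L ζ) (hY : IsCorrector Y)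
    (hc : HasCoefficients u Y b₁ b) (hu : ContDiff ℝ ∞ u) (hu1 : deriv u 0 = 0) :
    (fun ε => ε * iteratedDeriv 2 (ζ ε) 0
      - ε ^ 2 * (b₁ * (iteratedDeriv 4 u 0 - 2 * iteratedDeriv 2 u 0 ^ 3))) =O[𝓝[>] (0 : ℝ)]
      fun ε => ε ^ 4 := by
  have h1 := (hc.expansion_snd hY hu hu1).mono (nhdsWithin_le_nhds (s := Set.Ioi (0 : ℝ)))
  have h2 := (isBigO_refl (fun ε : ℝ => ε) (𝓝[>] 0)).mul (h.approx_snd 3)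
  have h3 : ∀ ε, iteratedDeriv 2 (fun x => Y (x, ε)) 0
      = dirDeriv (1, 0) (dirDeriv (1, 0) Y) (0, ε) := fun ε => by
    have := iteratedDeriv_comp_line hY.smooth (0, ε) (1, 0) 2 0
    simpa only [Prod.smul_mk, smul_eq_mul, mul_one, mul_zero, Prod.mk_add_mk, add_zero, zero_add,
      iterate_succ_apply, iterate_zero_apply] using this
  simp only [h3] at h2
  refine ((h2.congr_right fun ε => ?_).add h1).congr_left fun ε => ?_ <;> ring

/-- Two functions that describe the same set near the origin agree near the origin. -/
theorem IsSubgraphNear.eventuallyEq {S : Set (ℝ × ℝ)} {g h : ℝ → ℝ} {r s a : ℝ} (hr : 0 < r)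
    (hs : 0 < s) (hg : IsSubgraphNear r S g) (hh : IsSubgraphNear s S h) (ha : a < min r s)
    (hb : ∀ᶠ x in 𝓝 (0 : ℝ), |g x| ≤ a) : h =ᶠ[𝓝 0] g := by
  have hx : ∀ᶠ x in 𝓝 (0 : ℝ), |x| < min r s :=
    continuous_abs.continuousAt.eventually_lt_const (by simpa using ⟨hr, hs⟩)
  filter_upwards [hx, hb] with x hx hga
  have hxr := hx.trans_le (min_le_left _ _)
  have hxs := hx.trans_le (min_le_right _ _)
  have key : ∀ y, |y| < min r s → (y ≤ h x ↔ y ≤ g x) := fun y hy =>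
    (hh x y hxs (hy.trans_le (min_le_right _ _))).symm.trans
      (hg x y hxr (hy.trans_le (min_le_left _ _)))
  have h1 : g x ≤ h x := (key _ (hga.trans_lt ha)).2 le_rfl
  refine le_antisymm ?_ h1
  by_contra! h2
  -- The value h x may lie outside the square, so the separating height is also kept below `min r
  -- s`.
  obtain ⟨y, hy1, hy2⟩ := exists_between (lt_min h2 ((le_abs_self _).trans_lt (hga.trans_lt ha)))
  have hy : |y| < min r s := by
    refine abs_lt.2 ⟨?_, hy2.trans_le (min_le_right _ _)⟩
    linarith [(abs_le.1 hga).1]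
  exact absurd ((key y hy).1 (hy2.le.trans (min_le_left _ _))) hy1.not_ge

theorem eventually_sqrt_of {P : ℝ → ℝ → Prop} (h : ∀ᶠ ε in 𝓝[>] (0 : ℝ), P ε (ε ^ 2)) :
    ∀ᶠ t in 𝓝[>] (0 : ℝ), P (Real.sqrt t) t := by
  filter_upwards [tendsto_sqrt_nhdsGT.eventually h, self_mem_nhdsWithin] with t h1 ht
  rwa [Real.sq_sqrt (le_of_lt ht)] at h1

/-- A compactly supported smooth function that agrees with a given one near the origin. -/
theorem exists_compactSupport_eq (hf : ContDiff ℝ ∞ f) :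
    ∃ u : ℝ → ℝ, ContDiff ℝ ∞ u ∧ HasCompactSupport u ∧ ∀ x, |x| < 1 → f x = u x := by
  let b : ContDiffBump (0 : ℝ) := ⟨1, 2, one_pos, one_lt_two⟩
  refine ⟨fun x => b x * f x, b.contDiff.mul hf, b.hasCompactSupport.mul_right, fun x hx => ?_⟩
  have : b x = 1 := b.one_of_mem_closedBall (by simpa [b] using hx.le)
  simp only [this, one_mul]

/-- Cutting f off to u provides temperate growth and a bounded slope without changing derivatives at
0. Then ε = √t is substituted, which halves the exponents. -/
theorem exists_stage_interface (hf : ContDiff ℝ ∞ f) (hf0 : f 0 = 0) (hf1 : deriv f 0 = 0) {M : ℕ}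
    {γ : ℕ → ℕ → ℝ} (hγ : ∀ m : ℕ, 1 ≤ m → m ≤ M → ∑ i ∈ Finset.range m, γ m i = 1) :
    ∃ u : ℝ → ℝ, ContDiff ℝ ∞ u ∧ u =ᶠ[𝓝 0] f ∧ ∀ i ≤ M, ∃ r > 0, ∃ L > 0, ∃ ζ : ℝ → ℝ → ℝ,
      (∀ᶠ t in 𝓝[>] (0 : ℝ), ∀ x, |x| < r → |ζ t x| ≤ L ∧ ContDiffAt ℝ ∞ (ζ t) x ∧
        ∀ y, |y| < r → ((x, y) ∈ stage γ t (subgraph f) i ↔ y ≤ u x + Real.sqrt t * ζ t x)) ∧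
      (fun t => Real.sqrt t * ζ t 0 - (t * beta1 γ i * iteratedDeriv 2 f 0
          + t ^ 2 * (beta2 γ i * iteratedDeriv 4 f 0 - beta3 γ i * iteratedDeriv 2 f 0 ^ 3)))
        =O[𝓝[>] (0 : ℝ)] (fun t => t ^ 3) ∧
      (fun t => Real.sqrt t * iteratedDeriv 2 (ζ t) 0
          - t * (beta4 γ i * iteratedDeriv 4 f 0 - beta5 γ i * iteratedDeriv 2 f 0 ^ 3))
        =O[𝓝[>] (0 : ℝ)] (fun t => t ^ 2) := by
  obtain ⟨u, hu, huc, hfu⟩ := exists_compactSupport_eq hf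
  have hfu' : u =ᶠ[𝓝 0] f := by
    have hx : ∀ᶠ x in 𝓝 (0 : ℝ), |x| < 1 :=
      continuous_abs.continuousAt.eventually_lt_const (by simp)
    exact hx.mono fun x hx => (hfu x hx).symm
  have hut : u.HasTemperateGrowth := huc.hasTemperateGrowth hu
  have hu0 : u 0 = 0 := hfu'.self_of_nhds.trans hf0
  have hu1 : deriv u 0 = 0 := hfu'.deriv_eq.trans hf1
  obtain ⟨B, hB⟩ := (hu.continuous_deriv (by simp)).bounded_above_of_compact_support huc.deriv
  refine ⟨u, hu, hfu', fun i hi => ?_⟩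
  obtain ⟨Y, hY, hcoef, -, r, hr, L, hL, ζ, hI⟩ := exists_stage hut hu0 hu1 hB hf.continuous hfu hγ i hi
  have e2 := hI.expansion hY hcoef hu1
  have e3 := hI.expansion_snd hY hcoef hu hu1
  rw [(hfu'.iteratedDeriv 2).self_of_nhds, (hfu'.iteratedDeriv 4).self_of_nhds] at e2 e3
  refine ⟨r, hr, L, hL, fun t => ζ (Real.sqrt t), ?_, ?_, ?_⟩
  · exact eventually_sqrt_of (P := fun ε t => ∀ x, |x| < r → |ζ ε x| ≤ L ∧ ContDiffAt ℝ ∞ (ζ ε) x ∧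
      ∀ y, |y| < r → ((x, y) ∈ stage γ t (subgraph f) i ↔ y ≤ u x + ε * ζ ε x)) hI.mem
  · refine isBigO_of_sqrt (e2.congr' ?_ EventuallyEq.rfl)
    filter_upwards [self_mem_nhdsWithin] with ε hε
    rw [Real.sqrt_sq (le_of_lt hε)]
    ring
  · refine isBigO_of_sqrt (e3.congr' ?_ EventuallyEq.rfl)
    filter_upwards [self_mem_nhdsWithin] with ε hε
    rw [Real.sqrt_sq (le_of_lt hε), beta4_eq_beta1, beta5_eq_two_mul_beta1]
    ring

theorem eventually_sqrt_mul_le (L : ℝ) {a : ℝ} (ha : 0 < a) :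
    ∀ᶠ t in 𝓝[>] (0 : ℝ), Real.sqrt t * L ≤ a :=
  eventually_le_nhdsGT (f := fun t => Real.sqrt t * L)
    (Real.continuous_sqrt.mul continuous_const).continuousAt (by simpa using ha)

theorem exists_stage_graph (hf : ContDiff ℝ ∞ f) (hf0 : f 0 = 0) (hf1 : deriv f 0 = 0) {M : ℕ}
    {γ : ℕ → ℕ → ℝ} (hγ : ∀ m : ℕ, 1 ≤ m → m ≤ M → ∑ i ∈ Finset.range m, γ m i = 1) :
    ∃ r : ℝ, 0 < r ∧ ∃ h : ℕ → ℝ → ℝ → ℝ, ∀ i ≤ M, ∀ᶠ t in 𝓝[>] (0 : ℝ),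
        ContDiffOn ℝ 2 (h i t) (Set.Ioo (-r) r) ∧ (∀ x ∈ Set.Ioo (-r) r, |h i t x| < r) ∧
        IsSubgraphNear r (stage γ t (subgraph f) i) (h i t) := by
  obtain ⟨u, hu, hfu, H⟩ := exists_stage_interface hf hf0 hf1 hγ
  choose! R hR L hL ζ hmem _ _ using H
  have hd : HasDerivAt u 0 0 := by
    have := (hu.differentiable (by simp) 0).hasDerivAt
    rwa [hfu.deriv_eq, hf1] at this
  -- Zero slope at 0 gives |u x| ≤ |x|/4, less than r/4 in the square; with √t L ≤ r/2 the graph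
  -- stays inside the square of half-side r.
  have hsm := (hasDerivAt_iff_isLittleO_nhds_zero.1 hd).def (show (0 : ℝ) < 1 / 4 by norm_num)
  simp only [zero_add, smul_zero, sub_zero, hfu.self_of_nhds.trans hf0, Real.norm_eq_abs] at hsm
  obtain ⟨r₀, hr₀, hur⟩ := Metric.eventually_nhds_iff.1 hsm
  obtain ⟨j, hj, hjmin⟩ := (Finset.range (M + 1)).exists_min_image R ⟨0, by simp⟩
  have hRj := hR j (by simpa [Nat.lt_succ_iff] using hj)
  set r := min r₀ (R j) with hr
  have hr0 : 0 < r := lt_min hr₀ hRj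
  refine ⟨r, hr0, fun i t x => u x + Real.sqrt t * ζ i t x, fun i hi => ?_⟩
  have hri : r ≤ R i := (min_le_right _ _).trans (hjmin i (by simpa [Nat.lt_succ_iff] using hi))
  filter_upwards [hmem i hi, eventually_sqrt_mul_le (L i) (show 0 < r / 2 by positivity)] with t h1 h2
  refine ⟨fun x hx => ?_, fun x hx => ?_, fun x y hx hy => ?_⟩
  · have h3 := (h1 x ((abs_lt.2 hx).trans_le hri)).2.1
    exact ((hu.contDiffAt.add (contDiffAt_const.mul h3)).of_le two_le_infty).contDiffWithinAt
  · have hx' := abs_lt.2 hx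
    have h3 := (h1 x (hx'.trans_le hri)).1
    have h4 : |u x| ≤ 1 / 4 * |x| := hur (by
      simpa [Real.dist_eq] using hx'.trans_le (min_le_left _ _))
    refine (abs_add_le _ _).trans_lt ?_
    rw [abs_mul, abs_of_nonneg (Real.sqrt_nonneg t)]
    have := mul_le_mul_of_nonneg_left h3 (Real.sqrt_nonneg t)
    linarith
  · exact (h1 x (hx.trans_le hri)).2.2 y (hy.trans_le hri)

/-- For each small t, any function describing the stage agrees with u + √t ζ on a neighbourhood of
0, hence shares its value and second derivative there. -/
theorem stage_expansion (hf : ContDiff ℝ ∞ f) (hf0 : f 0 = 0) (hf1 : deriv f 0 = 0) {M : ℕ}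
    {γ : ℕ → ℕ → ℝ} (hγ : ∀ m : ℕ, 1 ≤ m → m ≤ M → ∑ i ∈ Finset.range m, γ m i = 1) {i : ℕ}
    (hi : i ≤ M) {r : ℝ} (hr : 0 < r) {h : ℝ → ℝ → ℝ}
    (hh : ∀ᶠ t in 𝓝[>] (0 : ℝ), IsSubgraphNear r (stage γ t (subgraph f) i) (h t)) :
    (fun t => h t 0 - (t * beta1 γ i * iteratedDeriv 2 f 0
        + t ^ 2 * (beta2 γ i * iteratedDeriv 4 f 0 - beta3 γ i * iteratedDeriv 2 f 0 ^ 3)))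
      =O[𝓝[>] (0 : ℝ)] (fun t => t ^ 3) ∧
    (fun t => iteratedDeriv 2 (h t) 0 - (iteratedDeriv 2 f 0
        + t * (beta4 γ i * iteratedDeriv 4 f 0 - beta5 γ i * iteratedDeriv 2 f 0 ^ 3)))
      =O[𝓝[>] (0 : ℝ)] (fun t => t ^ 2) := by
  obtain ⟨u, hu, hfu, H⟩ := exists_stage_interface hf hf0 hf1 hγ
  obtain ⟨R, hR, L, hL, ζ, hmem, e1, e2⟩ := H i hi
  have hu0 : u 0 = 0 := hfu.self_of_nhds.trans hf0
  have hmin : 0 < min R r := lt_min hR hr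
  have hb : ∀ᶠ x in 𝓝 (0 : ℝ), |u x| < min R r / 4 :=
    hu.continuous.abs.continuousAt.eventually_lt_const (by simpa [hu0] using ⟨hR, hr⟩)
  have hxR : ∀ᶠ x in 𝓝 (0 : ℝ), |x| < R :=
    continuous_abs.continuousAt.eventually_lt_const (by simpa using hR)
  have heq : ∀ᶠ t in 𝓝[>] (0 : ℝ), h t =ᶠ[𝓝 0] fun x => u x + Real.sqrt t * ζ t x := by
    filter_upwards [hh, hmem, eventually_sqrt_mul_le L (show 0 < min R r / 4 by positivity)]
      with t h1 h2 h3
    refine IsSubgraphNear.eventuallyEq (g := fun x => u x + Real.sqrt t * ζ t x)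
      (a := min R r / 2) hR hr (fun x y hx hy => (h2 x hx).2.2 y hy) h1
      (half_lt_self hmin) ?_
    filter_upwards [hb, hxR] with x h4 h5
    refine (abs_add_le _ _).trans ?_
    rw [abs_mul, abs_of_nonneg (Real.sqrt_nonneg t)]
    have := mul_le_mul_of_nonneg_left (h2 x h5).1 (Real.sqrt_nonneg t)
    linarith
  constructor
  · refine e1.congr' ?_ EventuallyEq.rfl
    filter_upwards [heq] with t ht
    rw [ht.self_of_nhds]
    simp only [hu0, zero_add]
  · refine e2.congr' ?_ EventuallyEq.rfl
    filter_upwards [heq, hmem] with t ht h2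
    have h3 := (h2 0 (by simpa using hR)).2.1.of_le two_le_infty
    rw [(ht.iteratedDeriv 2).self_of_nhds, iteratedDeriv_fun_add
      (hu.contDiffAt.of_le two_le_infty) (contDiffAt_const.mul h3),
      iteratedDeriv_const_mul_field, (hfu.iteratedDeriv 2).self_of_nhds]
    ring

end Stages

/-! ### Second-order expansion in time of the curvature motion. -/

section Motion

/-- The closed upper half-plane. -/
def halfPlane : Set (ℝ × ℝ) := Set.univ ×ˢ Set.Ici 0

theorem uniqueDiffOn_halfPlane : UniqueDiffOn ℝ halfPlane :=
  uniqueDiffOn_univ.prod (uniqueDiffOn_Ici 0)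

theorem mem_closure_interior_halfPlane {p : ℝ × ℝ} (hp : p ∈ halfPlane) :
    p ∈ closure (interior halfPlane) := by
  rw [halfPlane, interior_prod_eq, closure_prod_eq]
  simpa [halfPlane] using hp

/-- The derivative in the direction `v` within the closed upper half-plane. -/
noncomputable def halfDeriv (v : ℝ × ℝ) (F : ℝ × ℝ → ℝ) (p : ℝ × ℝ) : ℝ :=
  fderivWithin ℝ F halfPlane p v

variable {F G : ℝ × ℝ → ℝ}

theorem ContDiffOn.halfDeriv (hF : ContDiffOn ℝ ∞ F halfPlane) (v : ℝ × ℝ) :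
    ContDiffOn ℝ ∞ (halfDeriv v F) halfPlane :=
  (hF.fderivWithin uniqueDiffOn_halfPlane (m := ∞) (by simp)).clm_apply contDiffOn_const

theorem halfDeriv_congr (h : Set.EqOn F G halfPlane) (v : ℝ × ℝ) :
    Set.EqOn (halfDeriv v F) (halfDeriv v G) halfPlane := fun p hp => by
  rw [halfDeriv, halfDeriv, fderivWithin_congr h (h hp)]

/-- Symmetry of second derivatives extends to the boundary line t = 0, whose points are limits of
interior points of the half-plane. -/
theorem halfDeriv_comm (hF : ContDiffOn ℝ ∞ F halfPlane) (v w : ℝ × ℝ) :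
    Set.EqOn (halfDeriv v (halfDeriv w F)) (halfDeriv w (halfDeriv v F)) halfPlane := fun p hp => by
  have hd : DifferentiableWithinAt ℝ (fderivWithin ℝ F halfPlane) halfPlane p :=
    (hF.fderivWithin uniqueDiffOn_halfPlane (m := ∞) (by simp)).differentiableOn (by simp) p hp
  have h : ∀ v w, halfDeriv v (halfDeriv w F) p
      = fderivWithin ℝ (fderivWithin ℝ F halfPlane) halfPlane p v w := fun v w => by
    have := (hd.hasFDerivWithinAt.clm_apply (hasFDerivWithinAt_const w p halfPlane)).fderivWithin
      (uniqueDiffOn_halfPlane p hp)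
    rw [halfDeriv]
    change fderivWithin ℝ (fun q => fderivWithin ℝ F halfPlane q w) halfPlane p v = _
    rw [this]; simp
  rw [h, h]
  exact (hF p hp).isSymmSndFDerivWithinAt (by simpa using two_le_infty) uniqueDiffOn_halfPlane
    (mem_closure_interior_halfPlane hp) hp v w

theorem hasDerivAt_halfDeriv (hF : ContDiffOn ℝ ∞ F halfPlane) (x : ℝ) {t : ℝ} (ht : 0 ≤ t) :
    HasDerivAt (fun x => F (x, t)) (halfDeriv (1, 0) F (x, t)) x := by
  have hp : ((x, t) : ℝ × ℝ) ∈ halfPlane := ⟨trivial, ht⟩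
  have h1 := (hF.differentiableOn (by simp) _ hp).hasFDerivWithinAt
  have h2 : HasDerivWithinAt (fun x : ℝ => (x, t)) (1, 0) Set.univ x :=
    ((hasDerivAt_id x).prodMk (hasDerivAt_const x t)).hasDerivWithinAt
  exact hasDerivWithinAt_univ.1 (h1.comp_hasDerivWithinAt x h2
    (t := halfPlane) fun y _ => (⟨trivial, ht⟩ : (y, t) ∈ halfPlane))

theorem hasDerivWithinAt_halfDeriv (hF : ContDiffOn ℝ ∞ F halfPlane) (x : ℝ) {t : ℝ} (ht : 0 ≤ t) :
    HasDerivWithinAt (fun t => F (x, t)) (halfDeriv (0, 1) F (x, t)) (Set.Ici 0) t := by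
  have hp : ((x, t) : ℝ × ℝ) ∈ halfPlane := ⟨trivial, ht⟩
  have h1 := (hF.differentiableOn (by simp) _ hp).hasFDerivWithinAt
  have h2 : HasDerivWithinAt (fun t : ℝ => (x, t)) (0, 1) (Set.Ici 0) t :=
    ((hasDerivAt_const t x).prodMk (hasDerivAt_id t)).hasDerivWithinAt
  exact h1.comp_hasDerivWithinAt t h2 fun y hy => ⟨trivial, hy⟩

theorem iteratedDeriv_two_eq_halfDeriv (hF : ContDiffOn ℝ ∞ F halfPlane) (x : ℝ) {t : ℝ}
    (ht : 0 ≤ t) :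
    iteratedDeriv 2 (fun x => F (x, t)) x = halfDeriv (1, 0) (halfDeriv (1, 0) F) (x, t) := by
  have h1 : deriv (fun x => F (x, t)) = fun x => halfDeriv (1, 0) F (x, t) :=
    funext fun x => (hasDerivAt_halfDeriv hF x ht).deriv
  rw [iteratedDeriv_succ, iteratedDeriv_one, h1]
  exact (hasDerivAt_halfDeriv (hF.halfDeriv _) x ht).deriv

/-- Second order Taylor expansion in time. -/
theorem taylor_two_isBigO (hF : ContDiffOn ℝ ∞ F halfPlane) (x : ℝ) :
    (fun t => F (x, t) - (F (x, 0) + t * halfDeriv (0, 1) F (x, 0)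
      + t ^ 2 / 2 * halfDeriv (0, 1) (halfDeriv (0, 1) F) (x, 0))) =O[𝓝[>] (0 : ℝ)]
      fun t => t ^ 3 := by
  have hg : ContDiffOn ℝ ∞ (fun t => F (x, t)) (Set.Icc 0 1) :=
    hF.comp (by fun_prop : ContDiff ℝ ∞ fun t : ℝ => (x, t)).contDiffOn
      fun t ht => ⟨trivial, ht.1⟩
  have hu := uniqueDiffOn_Icc (zero_lt_one (α := ℝ))
  have hd : ∀ {H : ℝ × ℝ → ℝ}, ContDiffOn ℝ ∞ H halfPlane → ∀ t ∈ Set.Icc (0 : ℝ) 1,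
      derivWithin (fun t => H (x, t)) (Set.Icc 0 1) t = halfDeriv (0, 1) H (x, t) := fun hH t ht =>
    ((hasDerivWithinAt_halfDeriv hH x ht.1).mono Set.Icc_subset_Ici_self).derivWithin (hu t ht)
  have h0 : (0 : ℝ) ∈ Set.Icc (0 : ℝ) 1 := ⟨le_rfl, zero_le_one⟩
  have h1 : iteratedDerivWithin 1 (fun t => F (x, t)) (Set.Icc 0 1) 0
      = halfDeriv (0, 1) F (x, 0) := by
    rw [iteratedDerivWithin_one, hd hF 0 h0]
  have h2 : iteratedDerivWithin 2 (fun t => F (x, t)) (Set.Icc 0 1) 0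
      = halfDeriv (0, 1) (halfDeriv (0, 1) F) (x, 0) := by
    have h3 : ∀ t ∈ Set.Icc (0 : ℝ) 1, iteratedDerivWithin 1 (fun t => F (x, t)) (Set.Icc 0 1) t
        = halfDeriv (0, 1) F (x, t) := fun t ht => by rw [iteratedDerivWithin_one, hd hF t ht]
    rw [iteratedDerivWithin_succ, derivWithin_congr h3 (h3 0 h0), hd (hF.halfDeriv _) 0 h0]
  obtain ⟨C, hC⟩ := exists_taylor_mean_remainder_bound (n := 2) zero_le_one
    (hg.of_le (by exact_mod_cast three_le_infty))
  refine IsBigO.of_bound C ?_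
  filter_upwards [self_mem_nhdsWithin, mem_nhdsWithin_of_mem_nhds (Iio_mem_nhds zero_lt_one)]
    with t ht ht1
  have h3 := hC t ⟨le_of_lt ht, le_of_lt ht1⟩
  rw [taylorWithinEval_succ, taylorWithinEval_succ, taylor_within_zero_eval, sub_zero] at h3
  rw [Real.norm_of_nonneg (pow_nonneg (le_of_lt ht) 3)]
  refine le_trans (le_of_eq ?_) h3
  norm_num [h1, h2]
  ring_nf

variable {f : ℝ → ℝ → ℝ}

theorem ThresholdDynamics.IsCurvatureMotion.contDiff (hf : IsCurvatureMotion f) : ContDiff ℝ ∞ fun x => f x 0 :=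
  contDiffOn_univ.1 (hf.1.comp (by fun_prop : ContDiff ℝ ∞ fun x : ℝ => (x, (0 : ℝ))).contDiffOn
    fun _ _ => ⟨trivial, le_rfl (a := (0 : ℝ))⟩)

/-- The expansion in time of a graph that moves by curvature. -/
theorem ThresholdDynamics.IsCurvatureMotion.expansion (hf : IsCurvatureMotion f) (h0 : f 0 0 = 0)
    (h1 : deriv (fun x => f x 0) 0 = 0) :
    (fun δ => f 0 δ - (δ * iteratedDeriv 2 (fun x => f x 0) 0
      + δ ^ 2 / 2 * (iteratedDeriv 4 (fun x => f x 0) 0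
        - 2 * iteratedDeriv 2 (fun x => f x 0) 0 ^ 3))) =O[𝓝[>] (0 : ℝ)] fun δ => δ ^ 3 := by
  set F : ℝ × ℝ → ℝ := fun p => f p.1 p.2 with hFdef
  have hF : ContDiffOn ℝ ∞ F halfPlane := hf.1
  have hFx := hF.halfDeriv (1, 0)
  have hFxx := hFx.halfDeriv (1, 0)
  have hFt := hF.halfDeriv (0, 1)
  have hmem : ∀ x : ℝ, ((x, 0) : ℝ × ℝ) ∈ halfPlane := fun x => ⟨trivial, le_rfl (a := (0 : ℝ))⟩
  have heq : ∀ x t : ℝ, 0 ≤ t → halfDeriv (0, 1) F (x, t)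
      = halfDeriv (1, 0) (halfDeriv (1, 0) F) (x, t) / (1 + halfDeriv (1, 0) F (x, t) ^ 2) :=
    fun x t ht => by
      rw [← iteratedDeriv_two_eq_halfDeriv hF x ht, ← (hasDerivAt_halfDeriv hF x ht).deriv,
        ← (hasDerivWithinAt_halfDeriv hF x ht).derivWithin (uniqueDiffOn_Ici 0 t ht)]
      exact hf.2 x t ht
  have hx0 : halfDeriv (1, 0) F (0, 0) = 0 := by
    rw [← (hasDerivAt_halfDeriv hF 0 le_rfl).deriv]
    exact h1
  have hfirst : halfDeriv (0, 1) F (0, 0) = iteratedDeriv 2 (fun x => f x 0) 0 := by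
    rw [heq 0 0 le_rfl, hx0, ← iteratedDeriv_two_eq_halfDeriv hF 0 le_rfl]
    simp [hFdef]
  have hmixed : halfDeriv (0, 1) (halfDeriv (1, 0) (halfDeriv (1, 0) F)) (0, 0)
      = iteratedDeriv 2 (graphCurv fun x => f x 0) 0 := by
    have hg : (graphCurv fun x => f x 0) = fun x => halfDeriv (0, 1) F (x, 0) := by
      ext x
      rw [heq x 0 le_rfl, ← iteratedDeriv_two_eq_halfDeriv hF x le_rfl,
        ← (hasDerivAt_halfDeriv hF x le_rfl).deriv]
      rfl
    rw [hg, iteratedDeriv_two_eq_halfDeriv hFt 0 le_rfl, halfDeriv_comm hFx _ _ (hmem 0),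
      halfDeriv_congr (halfDeriv_comm hF _ _) _ (hmem 0)]
  -- In differentiating f_xx/(1 + f_x²) in time, the derivative of the denominator is killed by f_x
  -- = 0 at the origin, leaving f_xxt = (f_t)_xx, already found in `hmixed`.
  have hsecond : halfDeriv (0, 1) (halfDeriv (0, 1) F) (0, 0)
      = iteratedDeriv 2 (graphCurv fun x => f x 0) 0 := by
    have d1 := hasDerivWithinAt_halfDeriv hFxx 0 (le_refl (0 : ℝ))
    have d2 := hasDerivWithinAt_halfDeriv hFx 0 (le_refl (0 : ℝ))
    have d3 := d1.fun_div ((d2.fun_pow 2).const_add 1) (by positivity)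
    have d4 := (hasDerivWithinAt_halfDeriv hFt 0 (le_refl (0 : ℝ))).congr
      (fun t ht => (heq 0 t ht).symm) (heq 0 0 le_rfl).symm
    have := (uniqueDiffOn_Ici (0 : ℝ) 0 (Set.self_mem_Ici)).eq_deriv _ d4 d3
    rw [this, hx0, ← hmixed]
    simp
  have h := taylor_two_isBigO hF 0
  rw [hfirst, hsecond, iteratedDeriv_two_graphCurv hf.contDiff h1] at h
  refine h.congr_left fun δ => ?_
  simp [hFdef, h0]

end Motion

/-! ### An explicit family of curvature motions. -/

section Example

/-- A family of profiles whose graphs move by curvature when `a = A e^{-t}`. -/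
noncomputable def arsinhCos (a b x : ℝ) : ℝ := Real.arsinh (a * Real.cos x) - b

theorem hasDerivAt_arsinhCos (a b x : ℝ) : HasDerivAt (arsinhCos a b)
    (-(a * Real.sin x) / Real.sqrt (1 + (a * Real.cos x) ^ 2)) x := by
  have h := ((Real.hasDerivAt_arsinh (a * Real.cos x)).comp x
    ((Real.hasDerivAt_cos x).const_mul a)).sub_const b
  exact h.congr_deriv (by rw [inv_mul_eq_div]; ring)

theorem hasDerivAt_sqrt_one_add_sq_cos (a x : ℝ) :
    HasDerivAt (fun x => Real.sqrt (1 + (a * Real.cos x) ^ 2))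
      (-(a ^ 2 * Real.cos x * Real.sin x) / Real.sqrt (1 + (a * Real.cos x) ^ 2)) x := by
  have h := ((((Real.hasDerivAt_cos x).const_mul a).fun_pow 2).const_add 1).sqrt
    (by positivity)
  exact h.congr_deriv (by field_simp; push_cast; ring)

/-- The result depends only on a cos x and equals the time derivative of arsinh(a cos x) when a
decays like e^{-t}; this is what makes the family an exact motion. -/
theorem graphCurv_arsinhCos (a b x : ℝ) : graphCurv (arsinhCos a b) x
    = -(a * Real.cos x) / Real.sqrt (1 + (a * Real.cos x) ^ 2) := by
  have hd : deriv (arsinhCos a b) = fun x =>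
      -(a * Real.sin x) / Real.sqrt (1 + (a * Real.cos x) ^ 2) :=
    funext fun x => (hasDerivAt_arsinhCos a b x).deriv
  have hpos : 0 < 1 + (a * Real.cos x) ^ 2 := by positivity
  have h2 := (((Real.hasDerivAt_sin x).const_mul a).fun_neg).fun_div
    (hasDerivAt_sqrt_one_add_sq_cos a x) (Real.sqrt_pos.2 hpos).ne'
  have hcs := Real.sin_sq_add_cos_sq x
  rw [graphCurv, iteratedDeriv_succ, iteratedDeriv_one, hd, h2.deriv]
  have hs := Real.sq_sqrt hpos.le
  set s := Real.sqrt (1 + (a * Real.cos x) ^ 2) with hsdef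
  have hs0 : 0 < s := Real.sqrt_pos.2 hpos
  have hq : 0 < 1 + (-(a * Real.sin x) / s) ^ 2 := by positivity
  have hq' : 0 < s ^ 2 + (a * Real.sin x) ^ 2 := by positivity
  rw [div_eq_div_iff hq.ne' hs0.ne']
  field_simp
  ring

theorem isCurvatureMotion_arsinhCos (A b : ℝ) :
    IsCurvatureMotion fun x t => arsinhCos (A * Real.exp (-t)) b x := by
  constructor
  · refine ContDiff.contDiffOn ?_
    unfold arsinhCos
    fun_prop
  · intro x t ht
    have h1 : HasDerivAt (fun s => A * Real.exp (-s) * Real.cos x)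
        (-(A * Real.exp (-t) * Real.cos x)) t := by
      have := (((hasDerivAt_neg t).exp).const_mul A).mul_const (Real.cos x)
      exact this.congr_deriv (by ring)
    have h2 := ((Real.hasDerivAt_arsinh _).comp t h1).sub_const b
    have h3 : derivWithin (fun s => arsinhCos (A * Real.exp (-s)) b x) (Set.Ici 0) t = _ :=
      h2.hasDerivWithinAt.derivWithin (uniqueDiffOn_Ici 0 t ht)
    refine h3.trans (Eq.trans ?_ (graphCurv_arsinhCos (A * Real.exp (-t)) b x).symm)
    rw [inv_mul_eq_div]

theorem iteratedDeriv_two_arsinhCos (a b : ℝ) :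
    iteratedDeriv 2 (arsinhCos a b) 0 = -a / Real.sqrt (1 + a ^ 2) := by
  have h := graphCurv_arsinhCos a b 0
  simpa [graphCurv, (hasDerivAt_arsinhCos a b 0).deriv] using h

theorem contDiff_arsinhCos (a b : ℝ) : ContDiff ℝ ∞ (arsinhCos a b) := by
  unfold arsinhCos
  fun_prop

/-- Instead of four differentiations, `iteratedDeriv_two_graphCurv` is read backwards, from the
second derivative of the simple curvature function. -/
theorem iteratedDeriv_four_arsinhCos (a b : ℝ) :
    iteratedDeriv 4 (arsinhCos a b) 0 = (a - 2 * a ^ 3) / Real.sqrt (1 + a ^ 2) ^ 3 := by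
  have h0 : deriv (arsinhCos a b) 0 = 0 := by simp [(hasDerivAt_arsinhCos a b 0).deriv]
  have h := iteratedDeriv_two_graphCurv (contDiff_arsinhCos a b) h0
  have hpos : ∀ x : ℝ, 0 < 1 + (a * Real.cos x) ^ 2 := fun x => by positivity
  have hg : graphCurv (arsinhCos a b) = fun x =>
      -(a * Real.cos x) / Real.sqrt (1 + (a * Real.cos x) ^ 2) :=
    funext fun x => graphCurv_arsinhCos a b x
  have hd : deriv (graphCurv (arsinhCos a b)) = fun x =>
      a * Real.sin x / Real.sqrt (1 + (a * Real.cos x) ^ 2) ^ 3 := funext fun x => by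
    rw [hg]
    have h2 := (((Real.hasDerivAt_cos x).const_mul a).fun_neg).fun_div
      (hasDerivAt_sqrt_one_add_sq_cos a x) (Real.sqrt_pos.2 (hpos x)).ne'
    rw [h2.deriv]
    have hs := Real.sq_sqrt (hpos x).le
    set s := Real.sqrt (1 + (a * Real.cos x) ^ 2) with hsdef
    have hs0 : 0 < s := Real.sqrt_pos.2 (hpos x)
    field_simp
    linear_combination (a * Real.sin x) * hs
  have h4 := ((Real.hasDerivAt_sin 0).const_mul a).fun_div
    ((hasDerivAt_sqrt_one_add_sq_cos a 0).fun_pow 3)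
    (pow_ne_zero 3 (Real.sqrt_pos.2 (hpos 0)).ne')
  have h5 : iteratedDeriv 2 (graphCurv (arsinhCos a b)) 0 = a / Real.sqrt (1 + a ^ 2) ^ 3 := by
    rw [iteratedDeriv_succ, iteratedDeriv_one, hd, h4.deriv]
    have hs0 : 0 < Real.sqrt (1 + a ^ 2) := Real.sqrt_pos.2 (by positivity)
    simp
    field_simp
  rw [h5, iteratedDeriv_two_arsinhCos] at h
  have h6 : iteratedDeriv 4 (arsinhCos a b) 0 = a / Real.sqrt (1 + a ^ 2) ^ 3
      + 2 * (-a / Real.sqrt (1 + a ^ 2)) ^ 3 := by linarith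
  rw [h6]
  ring

end Example

/-! ### The consistency equations. -/

section Accuracy

theorem eq_zero_of_mul_sq_isBigO {k : ℝ}
    (h : (fun δ : ℝ => δ ^ 2 * k) =O[𝓝[>] (0 : ℝ)] fun δ => δ ^ 3) : k = 0 := by
  have h1 : (fun _ : ℝ => k) =O[𝓝[>] (0 : ℝ)] fun δ => δ := by
    have h2 := (isBigO_refl (fun δ : ℝ => (δ ^ 2)⁻¹) (𝓝[>] 0)).mul h
    refine h2.congr' ?_ ?_ <;> filter_upwards [self_mem_nhdsWithin] with δ hδ <;>
      have : δ ≠ 0 := (Set.mem_Ioi.1 hδ).ne' <;> field_simp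
  have h2 := h1.trans_tendsto (tendsto_id.mono_left nhdsWithin_le_nhds)
  exact tendsto_nhds_unique tendsto_const_nhds h2

theorem tendsto_mul_nhdsGT_zero {k : ℝ} (hk : 0 < k) :
    Tendsto (fun δ => δ * k) (𝓝[>] 0) (𝓝[>] 0) := by
  refine tendsto_nhdsWithin_iff.2 ⟨?_, ?_⟩
  · exact ((continuous_mul_const k).tendsto' 0 0 (zero_mul k)).mono_left nhdsWithin_le_nhds
  · filter_upwards [self_mem_nhdsWithin] with δ hδ
    exact mul_pos hδ hk

variable {M : ℕ} {γ : ℕ → ℕ → ℝ} {f : ℝ → ℝ → ℝ}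

/-- The leading error of one time step. -/
theorem step_error_isBigO
    (hγ : ∀ m : ℕ, 1 ≤ m → m ≤ M → ∑ i ∈ Finset.range m, γ m i = 1) (hβ : 0 < beta1 γ M)
    (hf : IsCurvatureMotion f) (h0 : f 0 0 = 0) (h1 : deriv (fun x => f x 0) 0 = 0) {r : ℝ}
    (hr : 0 < r) {H : ℝ → ℝ → ℝ}
    (hH : ∀ᶠ δ in 𝓝[>] (0 : ℝ),
      IsSubgraphNear r (stage γ (δ / beta1 γ M) (subgraph fun x => f x 0) M) (H δ)) :
    (fun δ => (H δ 0 - f 0 δ) - δ ^ 2 *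
      ((beta2 γ M / beta1 γ M ^ 2 - 1 / 2) * iteratedDeriv 4 (fun x => f x 0) 0
        - (beta3 γ M / beta1 γ M ^ 2 - 1) * iteratedDeriv 2 (fun x => f x 0) 0 ^ 3))
      =O[𝓝[>] (0 : ℝ)] fun δ => δ ^ 3 := by
  set β := beta1 γ M with hβdef
  have hH' : ∀ᶠ t in 𝓝[>] (0 : ℝ),
      IsSubgraphNear r (stage γ t (subgraph fun x => f x 0) M) (H (t * β)) := by
    filter_upwards [(tendsto_mul_nhdsGT_zero hβ).eventually hH] with t ht
    rwa [mul_div_cancel_right₀ _ hβ.ne'] at ht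
  have e1 := (stage_expansion hf.contDiff h0 h1 hγ le_rfl hr hH').1.comp_tendsto
    (tendsto_mul_nhdsGT_zero (inv_pos.2 hβ))
  have e2 := hf.expansion h0 h1
  have e3 : ((fun t : ℝ => t ^ 3) ∘ fun δ => δ * β⁻¹) =O[𝓝[>] (0 : ℝ)] fun δ => δ ^ 3 := by
    refine IsBigO.congr_left ((isBigO_refl (fun δ : ℝ => δ ^ 3) _).const_mul_left (β⁻¹ ^ 3))
      fun δ => ?_
    simp only [Function.comp_apply]
    ring
  refine ((e1.trans e3).sub e2).congr_left fun δ => ?_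
  simp only [Function.comp_apply, inv_mul_cancel_right₀ hβ.ne', ← hβdef]
  field_simp
  ring

/-- The δ² coefficient in `step_error_isBigO` must vanish for every admissible motion, and the
explicit family is rich enough to separate its two constants. -/
theorem isSecondOrderAccurate_iff
    (hγ : ∀ m : ℕ, 1 ≤ m → m ≤ M → ∑ i ∈ Finset.range m, γ m i = 1) (hβ : 0 < beta1 γ M) :
    IsSecondOrderAccurate γ M ↔
      beta2 γ M / beta1 γ M ^ 2 = 1 / 2 ∧ beta3 γ M / beta1 γ M ^ 2 = 1 := by
  constructor
  · intro hacc
    have key : ∀ A : ℝ, (beta2 γ M / beta1 γ M ^ 2 - 1 / 2) * (A - 2 * A ^ 3)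
        + (beta3 γ M / beta1 γ M ^ 2 - 1) * A ^ 3 = 0 := fun A => by
      have hm := isCurvatureMotion_arsinhCos A (Real.arsinh A)
      have hfun : (fun x => arsinhCos (A * Real.exp (-0)) (Real.arsinh A) x)
          = arsinhCos A (Real.arsinh A) := by simp
      have h0 : arsinhCos (A * Real.exp (-0)) (Real.arsinh A) 0 = 0 := by simp [arsinhCos]
      have h1 : deriv (fun x => arsinhCos (A * Real.exp (-0)) (Real.arsinh A) x) 0 = 0 := by
        rw [hfun, (hasDerivAt_arsinhCos _ _ 0).deriv]
        simp
      obtain ⟨r, hr, H, hH, hO⟩ := hacc _ hm h0 h1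
      have e := step_error_isBigO hγ hβ hm h0 h1 hr (hH.mono fun δ h => h.2.2)
      have e' := eq_zero_of_mul_sq_isBigO ((hO.sub e).congr_left fun δ => sub_sub_cancel _ _)
      rw [hfun, iteratedDeriv_two_arsinhCos, iteratedDeriv_four_arsinhCos] at e'
      have hs : 0 < Real.sqrt (1 + A ^ 2) := Real.sqrt_pos.2 (by positivity)
      field_simp at e' ⊢
      linarith
    -- With p and q the two deviations, A = 1 gives -p + q = 0 and A = 2 gives -14p + 8q = 0, so
    -- both vanish.
    have k1 := key 1
    have k2 := key 2
    constructor <;> linarith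
  · rintro ⟨h2, h3⟩ f hf h0 h1
    obtain ⟨r, hr, h, hh⟩ := exists_stage_graph hf.contDiff h0 h1 hγ
    have hM := (tendsto_mul_nhdsGT_zero (inv_pos.2 hβ)).eventually (hh M le_rfl)
    simp only [← div_eq_mul_inv] at hM
    refine ⟨r, hr, fun δ => h M (δ / beta1 γ M), hM.mono fun δ h => ⟨h.1.continuousOn, h.2⟩, ?_⟩
    have e := step_error_isBigO (H := fun δ => h M (δ / beta1 γ M)) hγ hβ hf h0 h1 hr
      (hM.mono fun δ h => h.2.2)
    refine e.congr_left fun δ => ?_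
    rw [h2, h3]
    ring

end Accuracy

end Development

theorem mainTheorem2 (M : ℕ) (γ : ℕ → ℕ → ℝ)
    (hγ : ∀ m : ℕ, 1 ≤ m → m ≤ M → ∑ i ∈ Finset.range m, γ m i = 1) :
    -- near the origin every stage is the region below the graph of a twice differentiable function
    (∀ f : ℝ → ℝ, ContDiff ℝ ∞ f → f 0 = 0 → deriv f 0 = 0 →
      (∃ r : ℝ, 0 < r ∧ ∃ h : ℕ → ℝ → ℝ → ℝ, ∀ i ≤ M, ∀ᶠ t in 𝓝[>] (0 : ℝ),
        ContDiffOn ℝ 2 (h i t) (Set.Ioo (-r) r) ∧ (∀ x ∈ Set.Ioo (-r) r, |h i t x| < r) ∧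
        IsSubgraphNear r (stage γ t (subgraph f) i) (h i t)) ∧
      -- whatever function describes a stage near the origin, it has the two expansions
      (∀ i ≤ M, ∀ r : ℝ, 0 < r → ∀ h : ℝ → ℝ → ℝ,
        (∀ᶠ t in 𝓝[>] (0 : ℝ), IsSubgraphNear r (stage γ t (subgraph f) i) (h t)) →
        (fun t => h t 0 - (t * beta1 γ i * iteratedDeriv 2 f 0
            + t ^ 2 * (beta2 γ i * iteratedDeriv 4 f 0 - beta3 γ i * iteratedDeriv 2 f 0 ^ 3)))
          =O[𝓝[>] (0 : ℝ)] (fun t => t ^ 3) ∧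
        (fun t => iteratedDeriv 2 (h t) 0 - (iteratedDeriv 2 f 0
            + t * (beta4 γ i * iteratedDeriv 4 f 0 - beta5 γ i * iteratedDeriv 2 f 0 ^ 3)))
          =O[𝓝[>] (0 : ℝ)] (fun t => t ^ 2))) ∧
    -- the consistency equations characterise second order accuracy
    (0 < beta1 γ M →
      (IsSecondOrderAccurate γ M ↔
        beta2 γ M / beta1 γ M ^ 2 = 1 / 2 ∧ beta3 γ M / beta1 γ M ^ 2 = 1)) :=
  ⟨fun _ hf hf0 hf1 => ⟨exists_stage_graph hf hf0 hf1 hγ,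
    fun _ hi _ hr _ hh => stage_expansion hf hf0 hf1 hγ hi hr hh⟩,
    fun hβ => isSecondOrderAccurate_iff hγ hβ⟩
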